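/- Let $\Gamma=\mathrm{PSL}_2(\mathbb Z)$, with $S=\begin{pmatrix}0&-1\\1&0\end{pmatrix}$, $U=\begin{pmatrix}1&-1\\1&0\end{pmatrix}$, $T=US=\begin{pmatrix}1&1\\0&1\end{pmatrix}$ (as elements of $\Gamma$). Let $n$ be a positive integer, let $\mathcal M_n$ be the set of $2\times2$ integer matrices of determinant $n$ modulo $\{\pm1\}$, and let $\mathcal R_n=\mathbb Q[\mathcal M_n]$ be the rational vector space with basis $\mathcal M_n$, with its left and right actions of $\mathbb Q[\Gamma]$. Let $T_n^\infty=\sum_{M\in\mathcal M_n^\infty}M$, where $\mathcal M_n^\infty\subset\mathcal M_n$ is any set of representatives for $\Gamma\backslash\mathcal M_n$ all of whose elements fix $\infty$ (that is, have lower left entry $0$). For $\xi=\sum_M c_M M\in\mathcal R_n$ and $\mathcal S\subset\mathcal M_n$ write $\langle\xi,\mathcal S\rangle=\sum_{M\in\mathcal S}c_M$. Define the weight $w(M)$ of $M\in\mathcal M_n$ as follows: $w(M)=\frac16$ if $M$ is scalar; $w(M)=-1/|\Gamma_M|$, where $\Gamma_M$ is the centralizer of $M$ in $\Gamma$, if $M$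 is elliptic ($\operatorname{tr}(M)^2<4n$); $w(M)=1$ if $M$ is split hyperbolic ($\operatorname{tr}(M)^2-4n$ is a positive square); $w(M)=0$ if $M$ is non-split hyperbolic ($\operatorname{tr}(M)^2-4n$ is a positive non-square) or parabolic ($\operatorname{tr}(M)^2=4n$ and $M$ is not scalar). It depends only on the $\Gamma$-conjugacy class $X=\{\gamma^{-1}M\gamma\mid\gamma\in\Gamma\}$ of $M$, and is also denoted $w(X)$. Theorem. Let $\widetilde T_n\in\mathcal R_n$ satisfy $$\text{(A)}\quad (1-S)\widetilde T_n-T_n^\infty(1-S)\in(1-T)\mathcal R_n$$ and $$\text{(B)}\quad \widetilde T_n(1+S)\in(1+U+U^2)\mathcal R_n,\qquad \widetilde T_n(1+U+U^2)\in(1+S)\mathcal R_n.$$ Then: (i) for every right coset $K=M_0\Gamma\subset\mathcal M_n$ one has $\langle\widetilde T_n,K\rangle=-1$; (ii) for every $\Gamma$-conjugacy class $X\subset\mathcal M_n$ one has $\langle\widetilde T_n,X\rangle=w(X)$. -/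

import Mathlib

namespace HeckeTrace

/-- The congruence on integral `2 × 2` matrices that identifies `A` with `-A`. -/
def signCon : Con (Matrix (Fin 2) (Fin 2) ℤ) where
  r A B := A = B ∨ A = -B
  iseqv :=
    { refl := fun _ => Or.inl rfl
      symm := by
        rintro A B (rfl | rfl)
        · exact Or.inl rfl
        · exact Or.inr (neg_neg B).symm
      trans := by
        rintro A B C (rfl | rfl) (rfl | rfl)
        · exact Or.inl rfl
        · exact Or.inr rfl
        · exact Or.inr rfl
        · exact Or.inl (neg_neg C) }
  mul' := by
    rintro A B C D (rfl | rfl) (rfl | rfl)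
    · exact Or.inl rfl
    · exact Or.inr (mul_neg _ _)
    · exact Or.inr (neg_mul _ _)
    · exact Or.inl (neg_mul_neg _ _)

/-- The multiplicative monoid of integral `2 × 2` matrices modulo `{±1}`. -/
abbrev PMat : Type := signCon.Quotient

/-- The class of a matrix modulo sign. -/
def PMat.mk : Matrix (Fin 2) (Fin 2) ℤ →* PMat := signCon.mk'

/-- The determinant, which does not see the sign of a `2 × 2` matrix. -/
def PMat.det (M : PMat) : ℤ :=
  Quotient.lift (fun A : Matrix (Fin 2) (Fin 2) ℤ => A.det) (by
    rintro A B (rfl | rfl)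
    · rfl
    · simp [Matrix.det_neg]) M

/-- The square of the trace, well defined modulo sign. -/
def PMat.trSq (M : PMat) : ℤ :=
  Quotient.lift (fun A : Matrix (Fin 2) (Fin 2) ℤ => A.trace ^ 2) (by
    rintro A B (rfl | rfl)
    · rfl
    · simp [Matrix.trace_neg]) M

/-- The discriminant `tr(M)² - 4 det(M)`. -/
def PMat.disc (M : PMat) : ℤ := M.trSq - 4 * M.det

/-- `𝓜ₙ`: integral matrices of determinant `n`, modulo `{±1}`. -/
def matSet (n : ℕ) : Set PMat := {M | M.det = n}

/-- The modular group `Γ = PSL₂(ℤ)`. -/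
abbrev Gam : Type := Matrix.ProjectiveSpecialLinearGroup (Fin 2) ℤ

/-- The centre `{±1}` of `SL₂(ℤ)` becomes trivial modulo sign. -/
theorem center_le_ker :
    Subgroup.center (Matrix.SpecialLinearGroup (Fin 2) ℤ) ≤
      (PMat.mk.comp (Matrix.SpecialLinearGroup.coeMonoidHom (ι := Fin 2) (R := ℤ))).ker := by
  intro A hA
  obtain ⟨r, hr, hrA⟩ := Matrix.SpecialLinearGroup.mem_center_iff.mp hA
  have hr' : r = 1 ∨ r = -1 := by
    rw [Fintype.card_fin] at hr
    exact mul_self_eq_one_iff.mp (by rw [← pow_two]; exact hr)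
  rw [MonoidHom.mem_ker, ← map_one PMat.mk]
  refine (Con.eq signCon).mpr ?_
  change (A : Matrix (Fin 2) (Fin 2) ℤ) = 1 ∨ (A : Matrix (Fin 2) (Fin 2) ℤ) = -1
  rw [← hrA]
  rcases hr' with rfl | rfl
  · exact Or.inl (map_one _)
  · exact Or.inr (by rw [map_neg, map_one])

/-- The inclusion of `Γ = PSL₂(ℤ)` into the monoid of integral matrices modulo sign. Through it,
`Γ` acts on `𝓜ₙ` by left multiplication, by right multiplication and by conjugation. -/
def incl : Gam →* PMat :=
  QuotientGroup.lift (Subgroup.center (Matrix.SpecialLinearGroup (Fin 2) ℤ))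
    (PMat.mk.comp Matrix.SpecialLinearGroup.coeMonoidHom) center_le_ker

/-- The right coset `K = M Γ`. -/
def rightCoset (M : PMat) : Set PMat := {N | ∃ γ : Gam, N = M * incl γ}

/-- The `Γ`-conjugacy class `X = {γ⁻¹ M γ}` of `M`. -/
def conjClass (M : PMat) : Set PMat := {N | ∃ γ : Gam, N = incl γ⁻¹ * M * incl γ}

/-- The centralizer `Γ_M` of `M` in `Γ`. -/
def centralizer (M : PMat) : Subgroup Gam where
  carrier := {γ | incl γ * M = M * incl γ}
  mul_mem' := by
    intro a b ha hb
    change incl a * M = M * incl a at ha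
    change incl b * M = M * incl b at hb
    change incl (a * b) * M = M * incl (a * b)
    rw [map_mul, mul_assoc, hb, ← mul_assoc, ha, mul_assoc]
  one_mem' := by
    change incl 1 * M = M * incl 1
    rw [map_one, one_mul, mul_one]
  inv_mem' := by
    intro a ha
    change incl a * M = M * incl a at ha
    change incl a⁻¹ * M = M * incl a⁻¹
    calc incl a⁻¹ * M = incl a⁻¹ * M * (incl a * incl a⁻¹) := by
          rw [← map_mul, mul_inv_cancel, map_one, mul_one]
      _ = incl a⁻¹ * (incl a * M) * incl a⁻¹ := by rw [ha]; simp only [mul_assoc]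
      _ = M * incl a⁻¹ := by
          rw [← mul_assoc (incl a⁻¹), ← map_mul incl, inv_mul_cancel, map_one, one_mul]

/-- `M` is the class of a scalar matrix. -/
def IsScalar (M : PMat) : Prop := ∃ a : ℤ, M = PMat.mk (Matrix.scalar (Fin 2) a)

/-- `M` is elliptic: `tr(M)² < 4 det(M)`. -/
def IsElliptic (M : PMat) : Prop := M.disc < 0

/-- `M` is split hyperbolic: `tr(M)² - 4 det(M)` is a positive square. -/
def IsSplitHyperbolic (M : PMat) : Prop := 0 < M.disc ∧ IsSquare M.disc

open Classical in
/-- The weight `w(M)`. The last value `0` is taken on the two remaining types: non-split hyperbolic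
(`disc M` a positive non-square) and parabolic (`disc M = 0` with `M` not scalar). -/
noncomputable def weight (M : PMat) : ℚ :=
  if IsScalar M then 1 / 6
  else if IsElliptic M then -1 / (Nat.card (centralizer M) : ℚ)
  else if IsSplitHyperbolic M then 1
  else 0

/-- The rational monoid algebra of the integral matrices modulo sign. -/
abbrev Alg : Type := MonoidAlgebra ℚ PMat

/-- `𝓡ₙ = ℚ[𝓜ₙ]`, as the set of elements supported on `𝓜ₙ`. -/
def Rn (n : ℕ) : Set Alg := {ξ | ∀ M : PMat, ξ.coeff M ≠ 0 → M ∈ matSet n}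

open Classical in
/-- `⟨ξ, 𝓢⟩`, the sum of the coefficients of `ξ` over the elements of `𝓢`. -/
noncomputable def pairing (ξ : Alg) (𝓢 : Set PMat) : ℚ :=
  ∑ M ∈ ξ.coeff.support with M ∈ 𝓢, ξ.coeff M

/-- The image of an element of `SL₂(ℤ)` in the monoid algebra. -/
noncomputable def ofSL (g : Matrix.SpecialLinearGroup (Fin 2) ℤ) : Alg :=
  MonoidAlgebra.of ℚ PMat (incl (QuotientGroup.mk g))

/-- `S = (0 -1; 1 0)`. -/
noncomputable def S : Alg := ofSL ModularGroup.S

/-- `U = (1 -1; 1 0)`. -/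
noncomputable def U : Alg := ofSL ⟨!![1, -1; 1, 0], by simp [Matrix.det_fin_two]⟩

/-- `T = (1 1; 0 1)`. -/
noncomputable def T : Alg := ofSL ModularGroup.T

/-- `M` fixes the cusp `∞`: its lower left entry vanishes. -/
def FixesInfty (M : PMat) : Prop :=
  ∃ A : Matrix (Fin 2) (Fin 2) ℤ, M = PMat.mk A ∧ A 1 0 = 0

/-- `R` is a set of representatives for `Γ\𝓜ₙ` (left quotient) all of whose elements fix `∞`. -/
def IsReprSet (n : ℕ) (R : Finset PMat) : Prop :=
  (∀ M ∈ R, M ∈ matSet n ∧ FixesInfty M) ∧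
    ∀ M ∈ matSet n, ∃! N, N ∈ R ∧ ∃ γ : Gam, N = incl γ * M

/-- The sum `T_n^∞` of the elements of a set of representatives. -/
noncomputable def Tinf (R : Finset PMat) : Alg := ∑ M ∈ R, MonoidAlgebra.of ℚ PMat M

/-- Condition (A): `(1 - S) ξ - T_n^∞ (1 - S) ∈ (1 - T) 𝓡ₙ`. -/
def CondA (n : ℕ) (R : Finset PMat) (ξ : Alg) : Prop :=
  ∃ ρ ∈ Rn n, (1 - S) * ξ - Tinf R * (1 - S) = (1 - T) * ρ

/-- Condition (B): `ξ (1 + S) ∈ (1 + U + U²) 𝓡ₙ` and `ξ (1 + U + U²) ∈ (1 + S) 𝓡ₙ`. -/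
def CondB (n : ℕ) (ξ : Alg) : Prop :=
  (∃ ρ ∈ Rn n, ξ * (1 + S) = (1 + U + U ^ 2) * ρ) ∧
    ∃ ρ ∈ Rn n, ξ * (1 + U + U ^ 2) = (1 + S) * ρ

end HeckeTrace

/-!
Write `ξ` for the given element, `τ` (`leftSum`) for the version of `T_n^∞` made of the matrices
`(a b; 0 d)` with `0 ≤ b < d`, and `τ'` (`rightSum`) for the sum of those with `0 ≤ b < a`, which
represent the right cosets. Then `τ (1 - T) = (1 - T) τ'`, and replacing `T_n^∞` by `τ` changes the
element `ρ` with `(1 - S) ξ - τ (1 - S) = (1 - T) ρ` only. As `T = U S` and left multiplication by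
`1 - T` is injective on `𝓡ₙ`, condition (B) turns into two identities for `ρ`
(`IsSolution.exists_rho`):
`ρ (1 + S) = -S ξ (1 + S)` and `ρ (1 + U + U²) = τ' S (1 + U + U²)`.
A linear form that is invariant under right multiplication by `Γ` therefore takes opposite values
on `S ξ` and on `τ'`. For the sum over a right coset this is (i), since `τ'` contains each right
coset once.

For (ii) let `L` be the sum over a conjugacy class `X`, so that `L (γ z) = L (z γ)`. The equation
for `ρ` can be separated into a part in `(1 - S) 𝓡ₙ` and a part in `(1 - U) 𝓡ₙ`, two subspaces with
intersection `0` because `Γ` is the free product of the groups generated by `S` and by `U`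
(`one_sub_S_direct`). To make this explicit, one needs an element that agrees with `τ` modulo
`(1 - S) 𝓡ₙ + (1 - U) 𝓡ₙ` and that splits in a way compatible with the actions of `S` and of `U`
from both sides. It comes from the Farey tessellation of the upper half plane: the function `side`
records on which side of the geodesic from `0` to `∞` the centre `N ρ` of the triangle
`N (0, 1, ∞)` lies, the element `crossing` has the coefficients `side N - side (N S)`, and
`incidence` has the coefficients `tri N`, which detect whether `N ρ` lies in the triangle `0, 1, ∞`
(`leftSum_decomposition`). Traces of both parts give a formula of Lefschetz type with contributions
from cusps, edges and triangles (`trace_formula`, `IsSolution.pairFun_conj`),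
`L ξ = L τ - L τ' + L crossing / 2 - L incidence / 3`.

The cusps cancel: in a class, the `b` of the matrices `(a b; 0 d)` with given `a ≠ d` form one
residue class modulo `a - d`, and the class contains such matrices with `a` and `d` in either order
(`pairFun_leftSum_conjClass`). In the other terms the point `N ρ` may be replaced by the fixed
points of `N`: the function `fixSide` differs from `side` at finitely many elements of `X`, and the
differences cancel between edges and triangles (`crossing_sub_incidence`). As conjugation by `S`
exchanges the sides, the edges now contribute nothing, and what remains is `-1/3` times the sum over
`X` of `fixTri N`, the number of sides of the triangle `0, 1, ∞` that have the fixed points of `N`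
on the inner side, minus `2`.

* If `N` is scalar then `fixTri N = -1/2`.
* If `X` is elliptic then the translates of the fixed point by `Γ` are in the triangle `0, 1, ∞`
  three times in all (`finsum_triangles`), and each element of `X` comes from `|Γ_M|` translates.
* If the fixed points are real then `fixTri` is minus the number of vertices of the triangle at
  which the fixed points are placed in a certain way (`fixTri_eq_corner`): up to a rotation, `∞` is
  an attracting fixed point and the other one lies in `(0, 1]`. A class contains exactly one such
  matrix if it is split hyperbolic, and none otherwise (`classSum_cornerSet`).
-/

namespace HeckeTrace

open Matrix

/-! ### Integral matrices modulo sign -/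

theorem mk_surj (M : PMat) : ∃ A, M = PMat.mk A := by
  obtain ⟨A, rfl⟩ := Quotient.exists_rep M
  exact ⟨A, rfl⟩

theorem mk_eq_mk {A B : Matrix (Fin 2) (Fin 2) ℤ} :
    PMat.mk A = PMat.mk B ↔ A = B ∨ A = -B :=
  Con.eq signCon

theorem det_mk (A : Matrix (Fin 2) (Fin 2) ℤ) : (PMat.mk A).det = A.det := rfl

theorem trSq_mk (A : Matrix (Fin 2) (Fin 2) ℤ) : (PMat.mk A).trSq = A.trace ^ 2 := rfl

theorem incl_mk (g : SpecialLinearGroup (Fin 2) ℤ) :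
    incl (QuotientGroup.mk g) = PMat.mk (g : Matrix (Fin 2) (Fin 2) ℤ) := rfl

theorem gam_surj (γ : Gam) : ∃ g : SpecialLinearGroup (Fin 2) ℤ, γ = QuotientGroup.mk g := by
  obtain ⟨g, rfl⟩ := QuotientGroup.mk_surjective γ
  exact ⟨g, rfl⟩

theorem det_mul (M N : PMat) : (M * N).det = M.det * N.det := by
  obtain ⟨A, rfl⟩ := mk_surj M
  obtain ⟨B, rfl⟩ := mk_surj N
  rw [← map_mul, det_mk, det_mk, det_mk, Matrix.det_mul]

theorem det_incl (γ : Gam) : (incl γ).det = 1 := by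
  obtain ⟨g, rfl⟩ := gam_surj γ
  rw [incl_mk, det_mk, g.det_coe]

@[simp] theorem incl_mul_inv (γ : Gam) : incl γ * incl γ⁻¹ = 1 := by
  rw [← map_mul, mul_inv_cancel, map_one]

@[simp] theorem incl_inv_mul (γ : Gam) : incl γ⁻¹ * incl γ = 1 := by
  rw [← map_mul, inv_mul_cancel, map_one]

@[simp] theorem incl_mul_inv_mul (γ : Gam) (M : PMat) : incl γ * (incl γ⁻¹ * M) = M := by
  rw [← mul_assoc, incl_mul_inv, one_mul]

@[simp] theorem incl_inv_mul_mul (γ : Gam) (M : PMat) : incl γ⁻¹ * (incl γ * M) = M := by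
  rw [← mul_assoc, incl_inv_mul, one_mul]

@[simp] theorem mul_incl_mul_inv (γ : Gam) (M : PMat) : M * incl γ * incl γ⁻¹ = M := by
  rw [mul_assoc, incl_mul_inv, mul_one]

@[simp] theorem mul_incl_inv_mul (γ : Gam) (M : PMat) : M * incl γ⁻¹ * incl γ = M := by
  rw [mul_assoc, incl_inv_mul, mul_one]

@[simp] theorem incl_mul_mem {n : ℕ} {γ : Gam} {M : PMat} :
    incl γ * M ∈ matSet n ↔ M ∈ matSet n := by
  simp [matSet, det_mul, det_incl]

@[simp] theorem mul_incl_mem {n : ℕ} {γ : Gam} {M : PMat} :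
    M * incl γ ∈ matSet n ↔ M ∈ matSet n := by
  simp [matSet, det_mul, det_incl]

/-- `Γ` acts freely from the left on matrices of non-zero determinant. -/
theorem incl_mul_left_inj {n : ℕ} (hn : 0 < n) {M : PMat} (hM : M ∈ matSet n) {γ γ' : Gam}
    (h : incl γ * M = incl γ' * M) : γ = γ' := by
  obtain ⟨A, rfl⟩ := mk_surj M
  obtain ⟨g, rfl⟩ := gam_surj γ
  obtain ⟨g', rfl⟩ := gam_surj γ'
  have hA : A.det ≠ 0 := by
    have : A.det = n := hM
    omega
  have hc : ∀ B C : Matrix (Fin 2) (Fin 2) ℤ, B * A = C * A → B = C := by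
    intro B C hBC
    have h2 : (B * A) * A.adjugate = (C * A) * A.adjugate := by rw [hBC]
    rw [mul_assoc, mul_assoc, Matrix.mul_adjugate, Matrix.mul_smul, Matrix.mul_smul, mul_one,
      mul_one] at h2
    exact smul_right_injective _ hA h2
  rw [incl_mk, incl_mk, ← map_mul, ← map_mul, mk_eq_mk] at h
  rcases h with h | h
  · have := hc _ _ h
    congr 1
    exact Subtype.ext this
  · rw [← Matrix.neg_mul] at h
    have h1 := hc _ _ h
    rw [QuotientGroup.eq, Matrix.SpecialLinearGroup.mem_center_iff]
    refine ⟨-1, by simp, ?_⟩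
    have h2 : g' = -g := by
      apply Subtype.ext
      rw [Matrix.SpecialLinearGroup.coe_neg, h1, neg_neg]
    rw [h2]
    simp

theorem incl_injective : Function.Injective incl := by
  intro γ γ' h
  refine incl_mul_left_inj (n := 1) one_pos (M := 1) ?_ (by rw [h])
  change PMat.det (PMat.mk 1) = _
  rw [det_mk]
  simp

/-! ### Finiteness -/

/-- Only finitely many classes have a representative with entries in a given box. -/
theorem finite_of_bounded (C : ℤ) :
    {N : PMat | ∃ A, N = PMat.mk A ∧ ∀ i j, |A i j| ≤ C}.Finite := by
  have h : (Set.pi Set.univ fun _ : Fin 2 => Set.pi Set.univ fun _ : Fin 2 =>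
      Set.Icc (-C) C).Finite :=
    Set.Finite.pi fun _ => Set.Finite.pi fun _ => Set.finite_Icc _ _
  refine (h.image fun A : Fin 2 → Fin 2 → ℤ => PMat.mk (Matrix.of A)).subset ?_
  rintro N ⟨A, rfl, hA⟩
  exact ⟨A, fun i _ j _ => abs_le.mp (hA i j), rfl⟩

theorem finite_gam_of_bounded (C : ℤ) :
    {γ : Gam | ∃ g : SpecialLinearGroup (Fin 2) ℤ, γ = QuotientGroup.mk g ∧
      ∀ i j, |g i j| ≤ C}.Finite := by
  refine ((finite_of_bounded C).preimage incl_injective.injOn).subset ?_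
  rintro γ ⟨g, rfl, hg⟩
  exact ⟨g, incl_mk g, hg⟩

/-! ### The monoid algebra -/

theorem coeff_of_incl_mul (γ : Gam) (ξ : Alg) (N : PMat) :
    (MonoidAlgebra.of ℚ PMat (incl γ) * ξ).coeff N = ξ.coeff (incl γ⁻¹ * N) := by
  rw [MonoidAlgebra.of_apply, MonoidAlgebra.coeff_single_mul_eq_mul_coeff (m₂ := incl γ⁻¹ * N),
    one_mul]
  intro m _
  constructor
  · rintro rfl; simp
  · rintro rfl; simp

theorem coeff_mul_of_incl (γ : Gam) (ξ : Alg) (N : PMat) :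
    (ξ * MonoidAlgebra.of ℚ PMat (incl γ)).coeff N = ξ.coeff (N * incl γ⁻¹) := by
  rw [MonoidAlgebra.of_apply, MonoidAlgebra.coeff_mul_single_eq_coeff_mul (m₂ := N * incl γ⁻¹),
    mul_one]
  intro m _
  constructor
  · rintro rfl; simp
  · rintro rfl; simp

/-- `𝓡ₙ` as a linear subspace. -/
def RnSub (n : ℕ) : Submodule ℚ Alg where
  carrier := Rn n
  zero_mem' := by intro M h; simp at h
  add_mem' := by
    intro x y hx hy M h
    by_contra hM
    refine h ?_
    have h1 : x.coeff M = 0 := by by_contra h1; exact hM (hx M h1)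
    have h2 : y.coeff M = 0 := by by_contra h2; exact hM (hy M h2)
    rw [MonoidAlgebra.coeff_add, Finsupp.add_apply, h1, h2, add_zero]
  smul_mem' := by
    intro c x hx M h
    refine hx M fun h1 => h ?_
    rw [MonoidAlgebra.coeff_smul_apply, h1, smul_zero]

theorem of_incl_mul_mem {n : ℕ} (γ : Gam) {ξ : Alg} (h : ξ ∈ RnSub n) :
    MonoidAlgebra.of ℚ PMat (incl γ) * ξ ∈ RnSub n := by
  intro M hM
  rw [coeff_of_incl_mul] at hM
  exact incl_mul_mem.mp (h _ hM)

theorem mul_of_incl_mem {n : ℕ} (γ : Gam) {ξ : Alg} (h : ξ ∈ RnSub n) :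
    ξ * MonoidAlgebra.of ℚ PMat (incl γ) ∈ RnSub n := by
  intro M hM
  rw [coeff_mul_of_incl] at hM
  exact mul_incl_mem.mp (h _ hM)

theorem of_mem {n : ℕ} {M : PMat} (h : M ∈ matSet n) : MonoidAlgebra.of ℚ PMat M ∈ RnSub n := by
  classical
  intro N hN
  rw [MonoidAlgebra.of_apply, MonoidAlgebra.coeff_single, Finsupp.single_apply] at hN
  split_ifs at hN with h1
  · exact h1 ▸ h
  · exact absurd rfl hN

/-- The linear form `ξ ↦ ∑ ξ(N) φ(N)` attached to a function `φ` on the basis. -/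
noncomputable def pairFun (φ : PMat → ℚ) : Alg →ₗ[ℚ] ℚ where
  toFun ξ := ξ.coeff.sum fun N c => c * φ N
  map_add' x y := by
    rw [MonoidAlgebra.coeff_add]
    exact Finsupp.sum_add_index' (fun _ => zero_mul _) (fun _ _ _ => add_mul _ _ _)
  map_smul' c x := by
    rw [MonoidAlgebra.coeff_smul, Finsupp.sum_smul_index' (fun _ => zero_mul _)]
    simp [Finsupp.mul_sum, mul_assoc]

theorem pairFun_of (φ : PMat → ℚ) (M : PMat) : pairFun φ (MonoidAlgebra.of ℚ PMat M) = φ M := by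
  change (MonoidAlgebra.of ℚ PMat M).coeff.sum (fun N c => c * φ N) = _
  rw [MonoidAlgebra.of_apply, MonoidAlgebra.coeff_single, Finsupp.sum_single_index] <;> simp

theorem pairFun_eq_finsum (φ : PMat → ℚ) (ξ : Alg) :
    pairFun φ ξ = ∑ᶠ N, ξ.coeff N * φ N := by
  change ξ.coeff.sum (fun N c => c * φ N) = _
  rw [Finsupp.sum, finsum_eq_sum_of_support_subset]
  intro N hN
  simp only [Function.mem_support, ne_eq, mul_eq_zero, not_or] at hN
  simpa using hN.1

theorem alg_induction {P : Alg → Prop} (h0 : P 0) (ha : ∀ x y, P x → P y → P (x + y))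
    (hs : ∀ (c : ℚ) M, P (c • MonoidAlgebra.of ℚ PMat M)) (ξ : Alg) : P ξ := by
  induction ξ using MonoidAlgebra.induction_linear with
  | zero => exact h0
  | add x y hx hy => exact ha x y hx hy
  | single M c =>
    have := hs c M
    rwa [MonoidAlgebra.of_apply, MonoidAlgebra.smul_single, smul_eq_mul, mul_one] at this

theorem pairFun_of_mul (φ : PMat → ℚ) (m : PMat) (ξ : Alg) :
    pairFun φ (MonoidAlgebra.of ℚ PMat m * ξ) = pairFun (fun N => φ (m * N)) ξ := by
  induction ξ using alg_induction with
  | h0 => simp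
  | ha x y hx hy => rw [mul_add, map_add, map_add, hx, hy]
  | hs c M => rw [mul_smul_comm, ← map_mul, map_smul, map_smul, pairFun_of, pairFun_of]

theorem pairFun_mul_of (φ : PMat → ℚ) (m : PMat) (ξ : Alg) :
    pairFun φ (ξ * MonoidAlgebra.of ℚ PMat m) = pairFun (fun N => φ (N * m)) ξ := by
  induction ξ using alg_induction with
  | h0 => simp
  | ha x y hx hy => rw [add_mul, map_add, map_add, hx, hy]
  | hs c M => rw [smul_mul_assoc, ← map_mul, map_smul, map_smul, pairFun_of, pairFun_of]

open Classical in
/-- The characteristic function of a set of classes. -/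
noncomputable def charFun (𝓢 : Set PMat) (N : PMat) : ℚ := if N ∈ 𝓢 then 1 else 0

theorem pairing_eq_pairFun (ξ : Alg) (𝓢 : Set PMat) : pairing ξ 𝓢 = pairFun (charFun 𝓢) ξ := by
  classical
  change _ = ξ.coeff.sum (fun N c => c * charFun 𝓢 N)
  rw [pairing, Finsupp.sum, Finset.sum_filter]
  refine Finset.sum_congr rfl fun N _ => ?_
  unfold charFun
  split_ifs <;> simp

/-- The element of the monoid algebra with prescribed, finitely supported coefficients. -/
noncomputable def ofFinite (φ : PMat → ℚ) (h : φ.support.Finite) : Alg :=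
  MonoidAlgebra.ofCoeff (Finsupp.ofSupportFinite φ h)

/-! ### The generators in coordinates -/

/-- The class of `S` in `Γ`. -/
def Sg : Gam := QuotientGroup.mk ModularGroup.S

/-- The class of `U` in `Γ`. -/
def Ug : Gam := QuotientGroup.mk ⟨!![1, -1; 1, 0], by simp [Matrix.det_fin_two]⟩

/-- The class of `T` in `Γ`. -/
def Tg : Gam := QuotientGroup.mk ModularGroup.T

theorem exists_mk_entries (M : PMat) : ∃ a b c d, M = PMat.mk !![a, b; c, d] := by
  obtain ⟨A, rfl⟩ := mk_surj M
  exact ⟨_, _, _, _, by rw [← Matrix.eta_fin_two A]⟩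

theorem det_mk_entries (a b c d : ℤ) : (PMat.mk !![a, b; c, d]).det = a * d - b * c := by
  rw [det_mk, Matrix.det_fin_two_of]

theorem mem_matSet_mk {n : ℕ} {a b c d : ℤ} :
    PMat.mk !![a, b; c, d] ∈ matSet n ↔ a * d - b * c = n := by
  rw [← det_mk_entries]; rfl

theorem mk_entries_eq_iff {a b c d a' b' c' d' : ℤ} :
    PMat.mk !![a, b; c, d] = PMat.mk !![a', b'; c', d'] ↔
      (a = a' ∧ b = b' ∧ c = c' ∧ d = d') ∨ (a = -a' ∧ b = -b' ∧ c = -c' ∧ d = -d') := by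
  rw [mk_eq_mk, ← Matrix.ext_iff, ← Matrix.ext_iff]
  simp [Fin.forall_fin_two, and_assoc]

theorem exists_gam_entries (γ : Gam) : ∃ p q r s : ℤ, p * s - q * r = 1 ∧
    incl γ = PMat.mk !![p, q; r, s] := by
  obtain ⟨p, q, r, s, h⟩ := exists_mk_entries (incl γ)
  refine ⟨p, q, r, s, ?_, h⟩
  rw [← det_mk_entries, ← h, det_incl]

/-- The element of `Γ` with the given entries. -/
def gamMk (p q r s : ℤ) (h : p * s - q * r = 1) : Gam :=
  QuotientGroup.mk ⟨!![p, q; r, s], by rw [Matrix.det_fin_two_of, h]⟩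

theorem incl_gamMk (p q r s : ℤ) (h : p * s - q * r = 1) :
    incl (gamMk p q r s h) = PMat.mk !![p, q; r, s] := rfl

theorem exists_gamMk (γ : Gam) : ∃ p q r s : ℤ, ∃ h : p * s - q * r = 1, γ = gamMk p q r s h := by
  obtain ⟨p, q, r, s, h, h'⟩ := exists_gam_entries γ
  exact ⟨p, q, r, s, h, incl_injective h'⟩

theorem mk_mul_mk (a b c d a' b' c' d' : ℤ) :
    PMat.mk !![a, b; c, d] * PMat.mk !![a', b'; c', d'] =
      PMat.mk !![a * a' + b * c', a * b' + b * d'; c * a' + d * c', c * b' + d * d'] := by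
  rw [← map_mul, Matrix.mul_fin_two]

theorem incl_gamMk_inv (p q r s : ℤ) (h : p * s - q * r = 1) :
    incl (gamMk p q r s h)⁻¹ = PMat.mk !![s, -q; -r, p] := by
  have h1 : PMat.mk !![s, -q; -r, p] * incl (gamMk p q r s h) = 1 := by
    rw [incl_gamMk, mk_mul_mk, ← map_one PMat.mk, Matrix.one_fin_two, mk_entries_eq_iff]
    left
    refine ⟨?_, ?_, ?_, ?_⟩ <;> linarith
  calc incl (gamMk p q r s h)⁻¹ = 1 * incl (gamMk p q r s h)⁻¹ := (one_mul _).symm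
    _ = _ := by rw [← h1, mul_incl_mul_inv]

theorem incl_Sg : incl Sg = PMat.mk !![0, -1; 1, 0] := rfl
theorem incl_Ug : incl Ug = PMat.mk !![1, -1; 1, 0] := rfl
theorem incl_Tg : incl Tg = PMat.mk !![1, 1; 0, 1] := rfl

theorem Sg_mul_mk (a b c d : ℤ) :
    incl Sg * PMat.mk !![a, b; c, d] = PMat.mk !![-c, -d; a, b] := by
  rw [incl_Sg, mk_mul_mk]; simp

theorem mk_mul_Sg (a b c d : ℤ) :
    PMat.mk !![a, b; c, d] * incl Sg = PMat.mk !![b, -a; d, -c] := by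
  rw [incl_Sg, mk_mul_mk]; simp

theorem Ug_mul_mk (a b c d : ℤ) :
    incl Ug * PMat.mk !![a, b; c, d] = PMat.mk !![a - c, b - d; a, b] := by
  rw [incl_Ug, mk_mul_mk]; simp [sub_eq_add_neg]

theorem mk_mul_Ug (a b c d : ℤ) :
    PMat.mk !![a, b; c, d] * incl Ug = PMat.mk !![a + b, -a; c + d, -c] := by
  rw [incl_Ug, mk_mul_mk]; simp

theorem mk_mul_Ug_inv (a b c d : ℤ) :
    PMat.mk !![a, b; c, d] * incl Ug⁻¹ = PMat.mk !![-b, a + b; -d, c + d] := by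
  have : Ug = gamMk 1 (-1) 1 0 (by norm_num) := rfl
  rw [this, incl_gamMk_inv, mk_mul_mk]; simp

theorem Sg_mul_Sg : Sg * Sg = 1 := by
  apply incl_injective
  rw [map_mul, incl_Sg, mk_mul_mk, map_one, ← map_one PMat.mk, Matrix.one_fin_two,
    mk_entries_eq_iff]
  simp

theorem Sg_inv : Sg⁻¹ = Sg := inv_eq_of_mul_eq_one_left Sg_mul_Sg

theorem Ug_mul_Ug_mul_Ug : Ug * (Ug * Ug) = 1 := by
  apply incl_injective
  rw [map_mul, map_mul, incl_Ug, mk_mul_mk, mk_mul_mk, map_one, ← map_one PMat.mk,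
    Matrix.one_fin_two, mk_entries_eq_iff]
  simp

theorem Ug_inv : Ug⁻¹ = Ug * Ug := inv_eq_of_mul_eq_one_right Ug_mul_Ug_mul_Ug

theorem Tg_eq : Tg = Ug * Sg := by
  apply incl_injective
  rw [map_mul, incl_Ug, mk_mul_Sg, incl_Tg, mk_entries_eq_iff]
  simp

/-! ### The side of the imaginary axis -/

/-- The inner product of the rows for the form `2 (x² + x y + y²)`, the form attached to the
fixed point `ρ` of `U`. Its sign is that of the real part of `A ρ`. -/
def rhoForm (A : Matrix (Fin 2) (Fin 2) ℤ) : ℤ :=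
  2 * (A 0 0 * A 1 0 + A 0 1 * A 1 1) + A 0 0 * A 1 1 + A 0 1 * A 1 0

/-- The side of the geodesic from `0` to `∞` on which `N ρ` lies: `1` on the right, `0` on the
left, and `1/2` on the geodesic. -/
def side (N : PMat) : ℚ :=
  Quotient.lift (fun A : Matrix (Fin 2) (Fin 2) ℤ => (1 + ((rhoForm A).sign : ℚ)) / 2) (by
    rintro A B (rfl | rfl)
    · rfl
    · simp [rhoForm]) N

theorem side_mk (a b c d : ℤ) :
    side (PMat.mk !![a, b; c, d]) =
      (1 + ((2 * (a * c + b * d) + a * d + b * c).sign : ℚ)) / 2 := rfl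

theorem side_Sg_mul (N : PMat) : side (incl Sg * N) = 1 - side N := by
  obtain ⟨a, b, c, d, rfl⟩ := exists_mk_entries N
  rw [Sg_mul_mk, side_mk, side_mk,
    show 2 * (-c * a + -d * b) + -c * b + -d * a = -(2 * (a * c + b * d) + a * d + b * c) by ring,
    Int.sign_neg]
  push_cast
  ring

theorem side_mul_Ug (N : PMat) : side (N * incl Ug) = side N := by
  obtain ⟨a, b, c, d, rfl⟩ := exists_mk_entries N
  rw [mk_mul_Ug, side_mk, side_mk]
  congr 4
  ring

theorem sign_eq_of_mul_pos {x y : ℤ} (h : 0 < x * y) : x.sign = y.sign := by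
  rcases pos_and_pos_or_neg_and_neg_of_mul_pos h with ⟨h1, h2⟩ | ⟨h1, h2⟩
  · rw [Int.sign_eq_one_of_pos h1, Int.sign_eq_one_of_pos h2]
  · rw [Int.sign_eq_neg_one_of_neg h1, Int.sign_eq_neg_one_of_neg h2]

theorem abs_le_of_sq_le {p C : ℤ} (h : p ^ 2 ≤ C) : |p| ≤ C := by
  rw [← sq_abs] at h
  nlinarith [abs_nonneg p, sq_nonneg (|p| - 1)]

/-- Two positive definite binary forms are seen on opposite sides of a geodesic by finitely many
elements of `Γ` only: the mixed discriminant of the two forms, which does not depend on the basis,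
bounds all the values on the basis. -/
theorem finite_opposite {x y z x' y' z' : ℤ} (hx : 0 < x) (hz : 0 < z) (hd : 0 < x * z - y ^ 2)
    (hx' : 0 < x') (hd' : 0 < x' * z' - y' ^ 2) :
    {γ : Gam | ∃ p q r s h, γ = gamMk p q r s h ∧
      (x * (p * r) + y * (p * s + q * r) + z * (q * s)) *
        (x' * (p * r) + y' * (p * s + q * r) + z' * (q * s)) ≤ 0}.Finite := by
  set m := x * z' + x' * z - 2 * y * y' with hm
  refine (finite_gam_of_bounded ((x + z) * m)).subset ?_
  rintro γ ⟨p, q, r, s, h, rfl, hB⟩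
  have key : ∀ {x y z p q : ℤ}, 0 < x → 0 < x * z - y ^ 2 → (p ≠ 0 ∨ q ≠ 0) →
      1 ≤ x * p ^ 2 + 2 * y * (p * q) + z * q ^ 2 := by
    intro x y z p q hx hd hpq
    have h1 : 0 < x * (x * p ^ 2 + 2 * y * (p * q) + z * q ^ 2) := by
      have h2 : x * (x * p ^ 2 + 2 * y * (p * q) + z * q ^ 2) =
          (x * p + y * q) ^ 2 + (x * z - y ^ 2) * q ^ 2 := by ring
      rw [h2]
      by_cases hq : q = 0
      · subst hq
        have : p ≠ 0 := by tauto
        have : x * p + y * 0 ≠ 0 := by simp [hx.ne', this]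
        positivity
      · positivity
    have := pos_of_mul_pos_right h1 hx.le
    omega
  have hbd : ∀ {p q : ℤ}, x * p ^ 2 + 2 * y * (p * q) + z * q ^ 2 ≤ m → 0 ≤ m →
      |p| ≤ (x + z) * m ∧ |q| ≤ (x + z) * m := by
    intro p q hA hm0
    constructor
    · apply abs_le_of_sq_le
      have h2 : z * (x * p ^ 2 + 2 * y * (p * q) + z * q ^ 2) =
          (y * p + z * q) ^ 2 + (x * z - y ^ 2) * p ^ 2 := by ring
      nlinarith [sq_nonneg (y * p + z * q), sq_nonneg p, mul_le_mul_of_nonneg_left hA hz.le,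
        mul_nonneg hx.le hm0]
    · apply abs_le_of_sq_le
      have h2 : x * (x * p ^ 2 + 2 * y * (p * q) + z * q ^ 2) =
          (x * p + y * q) ^ 2 + (x * z - y ^ 2) * q ^ 2 := by ring
      nlinarith [sq_nonneg (x * p + y * q), sq_nonneg q, mul_le_mul_of_nonneg_left hA hx.le,
        mul_nonneg hz.le hm0]
  have hpq : p ≠ 0 ∨ q ≠ 0 := by
    by_contra! hc
    simp [hc.1, hc.2] at h
  have hrs : r ≠ 0 ∨ s ≠ 0 := by
    by_contra! hc
    simp [hc.1, hc.2] at h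
  have hA := key hx hd hpq
  have hC := key hx hd hrs
  have hA' := key hx' hd' hpq
  have hC' := key hx' hd' hrs
  have hmix : (x * p ^ 2 + 2 * y * (p * q) + z * q ^ 2) *
      (x' * r ^ 2 + 2 * y' * (r * s) + z' * s ^ 2) +
      (x' * p ^ 2 + 2 * y' * (p * q) + z' * q ^ 2) *
      (x * r ^ 2 + 2 * y * (r * s) + z * s ^ 2) -
      2 * ((x * (p * r) + y * (p * s + q * r) + z * (q * s)) *
        (x' * (p * r) + y' * (p * s + q * r) + z' * (q * s))) = m := by
    rw [hm]
    linear_combination (x * z' + x' * z - 2 * y * y') * (p * s - q * r + 1) * h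
  have hle : ∀ {A A' C C' P : ℤ}, 1 ≤ A → 1 ≤ A' → 1 ≤ C → 1 ≤ C' → P ≤ 0 →
      A * C' + A' * C - 2 * P = m → A ≤ m ∧ C ≤ m := by
    intro A A' C C' P h1 h2 h3 h4 h5 h6
    constructor <;> nlinarith
  obtain ⟨hAm, hCm⟩ := hle hA hA' hC hC' hB hmix
  have hm0 : 0 ≤ m := by omega
  refine ⟨_, rfl, ?_⟩
  have h1 := hbd hAm hm0
  have h2 := hbd hCm hm0
  intro i j
  fin_cases i <;> fin_cases j
  · exact h1.1
  · exact h1.2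
  · exact h2.1
  · exact h2.2

theorem sign_eq_of_not_mul_nonpos {x y : ℤ} (h : ¬ x * y ≤ 0) : x.sign = y.sign :=
  sign_eq_of_mul_pos (not_le.mp h)

/-- Two points of the upper half plane are on the same side of almost all translates of the
imaginary axis; here the points are `N ρ` and `ρ`. -/
theorem finite_side_ne {n : ℕ} (hn : 0 < n) {N : PMat} (hN : N ∈ matSet n) :
    {γ : Gam | side (incl γ * N) ≠ side (incl γ)}.Finite := by
  obtain ⟨a, b, c, d, rfl⟩ := exists_mk_entries N
  rw [mem_matSet_mk] at hN
  have hn' : (0 : ℤ) < n := by exact_mod_cast hn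
  have hpos : ∀ {a b c d : ℤ}, 0 < a * d - b * c → 0 < 2 * (a ^ 2 + a * b + b ^ 2) := by
    intro a b c d h
    have : a ≠ 0 ∨ b ≠ 0 := by
      by_contra! hc
      simp [hc.1, hc.2] at h
    rcases this with h | h
    · nlinarith [sq_nonneg (a + 2 * b), sq_pos_of_ne_zero h]
    · nlinarith [sq_nonneg (2 * a + b), sq_pos_of_ne_zero h]
  refine (finite_opposite (x := 2 * (a ^ 2 + a * b + b ^ 2))
    (y := 2 * (a * c + b * d) + a * d + b * c) (z := 2 * (c ^ 2 + c * d + d ^ 2))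
    (x' := 2) (y' := 1) (z' := 2) (hpos (hN ▸ hn')) ?_ ?_ (by norm_num) (by norm_num)).subset ?_
  · exact hpos (a := c) (b := d) (c := -a) (d := -b) (by linarith)
  · have : 2 * (a ^ 2 + a * b + b ^ 2) * (2 * (c ^ 2 + c * d + d ^ 2)) -
        (2 * (a * c + b * d) + a * d + b * c) ^ 2 = 3 * (a * d - b * c) ^ 2 := by ring
    rw [this, hN]
    positivity
  · intro γ hγ
    obtain ⟨p, q, r, s, h, rfl⟩ := exists_gamMk γ
    refine ⟨p, q, r, s, h, rfl, ?_⟩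
    by_contra hc
    refine hγ ?_
    have := sign_eq_of_not_mul_nonpos hc
    rw [incl_gamMk, mk_mul_mk, side_mk, side_mk]
    congr 3
    convert this using 2
    · ring
    · ring

/-! ### The sides of an ideal triangle -/

theorem sign_cast_pos {x : ℤ} (h : 0 < x) : (x.sign : ℚ) = 1 := by
  rw [Int.sign_eq_one_of_pos h]; norm_num

theorem sign_cast_neg {x : ℤ} (h : x < 0) : (x.sign : ℚ) = -1 := by
  rw [Int.sign_eq_neg_one_of_neg h]; norm_num

/-- The number of the three sides of the ideal triangle `0, 1, ∞` that have `N ρ` on the side of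
the triangle, minus two. It vanishes unless `N ρ` is inside. -/
def tri (N : PMat) : ℚ := side N + side (incl Ug * N) + side (incl Ug * (incl Ug * N)) - 2

theorem tri_mk (a b c d : ℤ) :
    tri (PMat.mk !![a, b; c, d]) =
      (((2 * (a * c + b * d) + a * d + b * c).sign : ℚ) +
        ((2 * (a ^ 2 + a * b + b ^ 2) - (2 * (a * c + b * d) + a * d + b * c)).sign : ℚ) +
        ((2 * (c ^ 2 + c * d + d ^ 2) - (2 * (a * c + b * d) + a * d + b * c)).sign : ℚ) - 1) /
        2 := by
  rw [tri, Ug_mul_mk, Ug_mul_mk, side_mk, side_mk, side_mk,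
    show 2 * ((a - c) * a + (b - d) * b) + (a - c) * b + (b - d) * a =
      2 * (a ^ 2 + a * b + b ^ 2) - (2 * (a * c + b * d) + a * d + b * c) by ring,
    show 2 * ((a - c - a) * (a - c) + (b - d - b) * (b - d)) + (a - c - a) * (b - d) +
      (b - d - b) * (a - c) =
      2 * (c ^ 2 + c * d + d ^ 2) - (2 * (a * c + b * d) + a * d + b * c) by ring]
  ring

/-- A point on the outer side of one side of the triangle is on the inner side of the others. -/
theorem sign_triple {A B C : ℤ} (hA : 0 < A) (hC : 0 < C) (hd : B ^ 2 < A * C)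
    (h : ¬ (0 ≤ B ∧ B ≤ A ∧ B ≤ C)) :
    ((B.sign : ℚ) + ((A - B).sign : ℚ) + ((C - B).sign : ℚ) - 1) / 2 = 0 := by
  by_cases h1 : B < 0
  · rw [sign_cast_neg h1, sign_cast_pos (by omega : 0 < A - B),
      sign_cast_pos (by omega : 0 < C - B)]
    norm_num
  by_cases h2 : A < B
  · have : B < C := by nlinarith
    rw [sign_cast_pos (by omega : 0 < B), sign_cast_neg (by omega : A - B < 0),
      sign_cast_pos (by omega : 0 < C - B)]
    norm_num
  · have h3 : C < B := by omega
    have : B < A := by nlinarith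
    rw [sign_cast_pos (by omega : 0 < B), sign_cast_neg (by omega : C - B < 0),
      sign_cast_pos (by omega : 0 < A - B)]
    norm_num

theorem gamMk_one : gamMk 1 0 0 1 (by norm_num) = 1 := by
  apply incl_injective
  rw [incl_gamMk, map_one, ← map_one PMat.mk, Matrix.one_fin_two]

theorem Ug_eq : Ug = gamMk 1 (-1) 1 0 (by norm_num) := rfl

theorem Ug_sq_eq : Ug * Ug = gamMk 0 (-1) 1 (-1) (by norm_num) := by
  apply incl_injective
  rw [map_mul, incl_Ug, mk_mul_mk, incl_gamMk]
  norm_num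

theorem gamMk_inj {p q r s p' q' r' s' : ℤ} {h : p * s - q * r = 1}
    {h' : p' * s' - q' * r' = 1} : gamMk p q r s h = gamMk p' q' r' s' h' ↔
      (p = p' ∧ q = q' ∧ r = r' ∧ s = s') ∨ (p = -p' ∧ q = -q' ∧ r = -r' ∧ s = -s') := by
  rw [← incl_injective.eq_iff, incl_gamMk, incl_gamMk, mk_entries_eq_iff]

theorem norm_form_eq_one {x y : ℤ} (hxy : x ^ 2 + x * y + y ^ 2 = 1) :
    (x = 1 ∧ y = 0) ∨ (x = -1 ∧ y = 0) ∨ (x = 0 ∧ y = 1) ∨ (x = 0 ∧ y = -1) ∨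
      (x = 1 ∧ y = -1) ∨ (x = -1 ∧ y = 1) := by
  have hx1 : x ≤ 1 := by nlinarith [sq_nonneg (x + 2 * y)]
  have hx2 : -1 ≤ x := by nlinarith [sq_nonneg (x + 2 * y)]
  have hy1 : y ≤ 1 := by nlinarith [sq_nonneg (2 * x + y)]
  have hy2 : -1 ≤ y := by nlinarith [sq_nonneg (2 * x + y)]
  interval_cases x <;> interval_cases y <;> omega

theorem tri_incl_of_ne {γ : Gam} (h1 : γ ≠ 1) (h2 : γ ≠ Ug) (h3 : γ ≠ Ug * Ug) :
    tri (incl γ) = 0 := by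
  obtain ⟨p, q, r, s, h, rfl⟩ := exists_gamMk γ
  rw [← gamMk_one, Ne, gamMk_inj] at h1
  rw [Ug_eq, Ne, gamMk_inj] at h2
  rw [Ug_sq_eq, Ne, gamMk_inj] at h3
  rw [incl_gamMk, tri_mk]
  have hid : 2 * (p ^ 2 + p * q + q ^ 2) * (2 * (r ^ 2 + r * s + s ^ 2)) =
      (2 * (p * r + q * s) + p * s + q * r) ^ 2 + 3 := by
    linear_combination 3 * (p * s - q * r + 1) * h
  have hA0 : 0 ≤ p ^ 2 + p * q + q ^ 2 := by nlinarith [sq_nonneg (p + q)]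
  have hC0 : 0 ≤ r ^ 2 + r * s + s ^ 2 := by nlinarith [sq_nonneg (r + s)]
  have hB1 : 2 * (p * r + q * s) + p * s + q * r = 2 * (p * r + q * s + q * r) + 1 := by linarith
  have hA1 : 0 < p ^ 2 + p * q + q ^ 2 := by
    rcases hA0.lt_or_eq with h | h
    · exact h
    · rw [← h] at hid; nlinarith
  have hC1 : 0 < r ^ 2 + r * s + s ^ 2 := by
    rcases hC0.lt_or_eq with h | h
    · exact h
    · rw [← h] at hid; nlinarith
  refine sign_triple (by omega) (by omega) (by omega) ?_
  rintro ⟨h4, h5, h6⟩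
  -- the product of the two even values exceeds the square of the odd one by three only
  have hval : ∀ {A C k : ℤ}, 2 * A * (2 * C) = (2 * k + 1) ^ 2 + 3 → 0 ≤ 2 * k + 1 →
      2 * k + 1 ≤ 2 * A → 2 * k + 1 ≤ 2 * C → A = 1 ∧ C = 1 := by
    intro A C k h0 h1 h2 h3
    have h4 : (k + 1) * (k + 1) ≤ A * C :=
      mul_le_mul (by omega) (by omega) (by omega) (by omega)
    have hk : k = 0 := by nlinarith
    subst hk
    have h5 : A * C = 1 := by linarith
    rcases Int.mul_eq_one_iff_eq_one_or_neg_one.mp h5 with h | h <;> omega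
  rw [hB1] at hid h4 h5 h6
  obtain ⟨hA2, hC2⟩ := hval hid h4 h5 h6
  rcases norm_form_eq_one hA2 with ⟨rfl, rfl⟩ | ⟨rfl, rfl⟩ | ⟨rfl, rfl⟩ | ⟨rfl, rfl⟩ |
    ⟨rfl, rfl⟩ | ⟨rfl, rfl⟩ <;>
  omega

theorem tri_incl_one : tri (incl 1) = 1 := by
  rw [← gamMk_one, incl_gamMk, tri_mk]; norm_num

theorem tri_incl_Ug : tri (incl Ug) = 1 := by
  rw [Ug_eq, incl_gamMk, tri_mk]; norm_num

theorem tri_incl_Ug_sq : tri (incl (Ug * Ug)) = 1 := by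
  rw [Ug_sq_eq, incl_gamMk, tri_mk]; norm_num

theorem one_ne_Ug : (1 : Gam) ≠ Ug := by
  rw [← gamMk_one, Ug_eq, Ne, gamMk_inj]; norm_num

theorem one_ne_Ug_sq : (1 : Gam) ≠ Ug * Ug := by
  rw [← gamMk_one, Ug_sq_eq, Ne, gamMk_inj]; norm_num

theorem Ug_ne_Ug_sq : Ug ≠ Ug * Ug := by
  rw [Ug_sq_eq, Ug_eq, Ne, gamMk_inj]; norm_num

theorem support_tri_incl :
    (Function.support fun γ : Gam => tri (incl γ)) ⊆ {1, Ug, Ug * Ug} := by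
  intro γ hγ
  by_contra hc
  simp only [Set.mem_insert_iff, Set.mem_singleton_iff, not_or] at hc
  exact hγ (tri_incl_of_ne hc.1 hc.2.1 hc.2.2)

theorem finsum_tri_incl : ∑ᶠ γ : Gam, tri (incl γ) = 3 := by
  classical
  rw [finsum_eq_sum_of_support_subset (s := {1, Ug, Ug * Ug}) _ (by simpa using support_tri_incl),
    Finset.sum_insert (by simp [one_ne_Ug, one_ne_Ug_sq]),
    Finset.sum_insert (by simpa using Ug_ne_Ug_sq), Finset.sum_singleton, tri_incl_one,
    tri_incl_Ug, tri_incl_Ug_sq]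
  norm_num

theorem finsum_mul_left (γ : Gam) (f : Gam → ℚ) : ∑ᶠ x, f (γ * x) = ∑ᶠ x, f x :=
  finsum_comp_equiv (Equiv.mulLeft γ)

theorem finite_support_mul_left (γ : Gam) {f : Gam → ℚ} (h : f.support.Finite) :
    (Function.support fun x => f (γ * x)).Finite :=
  h.preimage (mul_right_injective γ).injOn

/-- A family of points that, like the translates of `ρ`, are on different sides of each edge of
the tessellation seen from its two ends, is in the triangles three times in all (once for each
rotation of a triangle), provided that it differs from the translates of `ρ` finitely often. -/
theorem finsum_triangles {g : Gam → ℚ} (hS : ∀ γ, g (Sg * γ) = 1 - g γ)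
    (hfin : {γ | g γ ≠ side (incl γ)}.Finite) :
    ∑ᶠ γ, (g γ + g (Ug * γ) + g (Ug * (Ug * γ)) - 2) = 3 := by
  set D : Gam → ℚ := fun γ => g γ - side (incl γ) with hD
  have hDf : D.support.Finite := by
    refine hfin.subset fun γ hγ => ?_
    exact fun h => hγ (sub_eq_zero.mpr h)
  have hD0 : ∑ᶠ γ, D γ = 0 := by
    have h1 : ∑ᶠ γ, D γ = - ∑ᶠ γ, D γ := by
      conv_lhs => rw [← finsum_mul_left Sg]
      rw [← finsum_neg_distrib]
      refine finsum_congr fun γ => ?_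
      simp only [hD, hS, map_mul, side_Sg_mul]
      ring
    linarith
  have h1 := finite_support_mul_left Ug hDf
  have h2 := finite_support_mul_left Ug h1
  have heq : ∀ γ, g γ + g (Ug * γ) + g (Ug * (Ug * γ)) - 2 =
      D γ + D (Ug * γ) + D (Ug * (Ug * γ)) + tri (incl γ) := by
    intro γ
    simp only [hD, tri, map_mul]
    ring
  rw [finsum_congr heq, finsum_add_distrib, finsum_add_distrib, finsum_add_distrib,
    finsum_mul_left Ug fun γ => D (Ug * γ), finsum_mul_left Ug, hD0, finsum_tri_incl]
  · ring
  · exact hDf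
  · exact h1
  · exact (hDf.union h1).subset (Function.support_add _ _)
  · exact h2
  · exact ((hDf.union h1).union h2).subset ((Function.support_add _ _).trans
      (Set.union_subset_union_left _ (Function.support_add _ _)))
  · exact (Set.toFinite _).subset support_tri_incl

/-- The only edge that separates the triangles `γ (0, 1, ∞)` and `γ S (0, 1, ∞)` is their common
side. -/
theorem side_mul_Sg_of_ne {γ : Gam} (h1 : γ ≠ 1) (h2 : γ ≠ Sg) :
    side (incl γ * incl Sg) = side (incl γ) := by
  obtain ⟨p, q, r, s, h, rfl⟩ := exists_gamMk γ
  rw [← gamMk_one, Ne, gamMk_inj] at h1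
  rw [show Sg = gamMk 0 (-1) 1 0 (by norm_num) from rfl, Ne, gamMk_inj] at h2
  rw [incl_gamMk, mk_mul_Sg, side_mk, side_mk]
  congr 3
  apply sign_eq_of_mul_pos
  by_contra! hc
  have hw : (p * r + q * s) ^ 2 = (p * r - q * s) ^ 2 + 4 * (q * r * (q * r + 1)) := by
    have : p * s = q * r + 1 := by linarith
    linear_combination 4 * q * r * this
  have hc' : 4 * (p * r + q * s) ^ 2 ≤ (2 * (q * r) + 1) ^ 2 := by
    have : p * s = q * r + 1 := by linarith
    nlinarith
  have hw0 : p * r + q * s = 0 := by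
    by_contra hne
    have h5 : 1 ≤ (p * r + q * s) ^ 2 := Int.add_one_le_of_lt (sq_pos_of_ne_zero hne)
    have h6 : q * r * (q * r + 1) ≤ 0 := by nlinarith [sq_nonneg (p * r - q * s)]
    nlinarith
  have h7 : q * r * (q * r + 1) = 0 := by
    have h8 : 0 ≤ q * r * (q * r + 1) := by
      rcases le_or_gt 0 (q * r) with h | h
      · positivity
      · nlinarith
    rw [hw0] at hw
    nlinarith [sq_nonneg (p * r - q * s)]
  rw [hw0, h7] at hw
  have h9 : p * r = 0 := by
    have : p * r - q * s = 0 := by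
      apply pow_eq_zero_iff (two_ne_zero) |>.mp; linarith
    linarith
  have h10 : q * s = 0 := by linarith
  have hu : ∀ {x y : ℤ}, x * y = 1 → (x = 1 ∧ y = 1) ∨ (x = -1 ∧ y = -1) := fun h =>
    Int.mul_eq_one_iff_eq_one_or_neg_one.mp h
  rcases mul_eq_zero.mp h9 with rfl | rfl
  · have : (-q) * r = 1 := by linarith
    have hs : s = 0 := by
      rcases mul_eq_zero.mp h10 with rfl | h
      · simp at this
      · exact h
    rcases hu this with ⟨h11, h12⟩ | ⟨h11, h12⟩
    · exact h2 (Or.inl ⟨rfl, by linarith, h12, hs⟩)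
    · exact h2 (Or.inr ⟨by simp, by linarith, h12, by simp [hs]⟩)
  · have : p * s = 1 := by linarith
    have hs : q = 0 := by
      rcases mul_eq_zero.mp h10 with h | rfl
      · exact h
      · simp at this
    rcases hu this with ⟨h11, h12⟩ | ⟨h11, h12⟩
    · exact h1 (Or.inl ⟨h11, hs, rfl, h12⟩)
    · exact h1 (Or.inr ⟨h11, by simp [hs], by simp, h12⟩)

/-! ### Consequences of the two conditions in a bimodule -/

section Algebra

variable {A : Type*} [Ring A] {s u ξ τ τ' ρ ρ' x y v b : A}

/-- The first half of (B), inserted into (A) multiplied by `1 + s`. -/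
theorem cancel_S (hs : s * s = 1) (hu : u * (u * u) = 1)
    (hA : (1 - s) * ξ - τ * (1 - s) = (1 - u * s) * ρ)
    (hB : ξ * (1 + s) = (1 + u + u ^ 2) * ρ') :
    (1 - u * s) * (ρ * (1 + s) + s * ξ * (1 + s)) = 0 := by
  linear_combination (norm := noncomm_ring)
    -hA * (1 + s) - u * hs * (ξ * (1 + s)) + τ * hs + (1 - u) * hB - hu * ρ'

/-- The second half of (B), inserted into (A) multiplied by `1 + u + u²`. -/
theorem cancel_U (hs : s * s = 1) (hu : u * (u * u) = 1)
    (hA : (1 - s) * ξ - τ * (1 - s) = (1 - u * s) * ρ)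
    (hB : ξ * (1 + u + u ^ 2) = (1 + s) * ρ')
    (hC : τ * (1 - u * s) = (1 - u * s) * τ') :
    (1 - u * s) * (ρ * (1 + u + u ^ 2) - τ' * s * (1 + u + u ^ 2)) = 0 := by
  linear_combination (norm := noncomm_ring)
    -hA * (1 + u + u ^ 2) + hC * (s * (1 + u + u ^ 2)) + τ * u * hs * (1 + u + u ^ 2) + τ * hu
      + (1 - s) * hB - hs * ρ'

/-- Condition (A), rewritten as an equality of multiples of `1 - s` and of `1 - u`; the argument of
`1 - s` is chosen with a view to traces of products with `1 - s`. -/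
theorem split_S (hs : s * s = 1)
    (hA : (1 - s) * ξ - τ * (1 - s) = (1 - u * s) * ρ)
    (hD : 6 * τ = 3 * v + b * (1 + s) + 6 * ((1 - s) * x + (1 - u) * y))
    (hsv : s * v = -v) (hvs : v * s = -v) :
    (1 - s) * (6 * ξ - 6 * ρ - 3 * v - 6 * x * (1 - s)) =
      (1 - u) * (6 * s * ρ + 6 * y * (1 - s)) := by
  linear_combination (norm := noncomm_ring)
    6 * hA + hD * (1 - s) + 3 * hsv - 3 * hvs - b * hs

/-- Another such equality, now with a view to traces of products with `1 - u`. -/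
theorem split_U (hs : s * s = 1)
    (hA : (1 - s) * ξ - τ * (1 - s) = (1 - u * s) * ρ)
    (hC : τ * (1 - u * s) = (1 - u * s) * τ')
    (hD : 6 * τ = 3 * v + b * (1 + s) + 6 * ((1 - s) * x + (1 - u) * y))
    (hv : v + u * v + u * (u * v) = b - b * s) (hub : u * b = b) (hbu : b * u = b) :
    (1 - s) * (18 * (ξ - ρ + τ' * s - x * (1 - u))) =
      (1 - u) * (18 * (s * ρ - s * τ' * s + y * (1 - u)) +
        (2 + u) * (3 * v + b * (1 + s)) * (1 - u)) := by
  linear_combination (norm := noncomm_ring)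
    18 * hA - 18 * hC * s + 3 * hD * (1 - u) - 18 * τ * u * hs + 3 * hv * (1 - u) +
      (2 * hub + u * hub) * ((1 + s) * (1 - u)) - 6 * hbu

/-- The value on `ξ` of a trace. The conditions are those satisfied by `ξ` and by an element
`(3 v + b (1 + s)) / 6` that, like `τ`, represents the sum of all left cosets and is compatible
from the left and from the right with the subgroups generated by `s` and by `u`. -/
theorem trace_formula [Algebra ℚ A] (L : A →ₗ[ℚ] ℚ) (hs : s * s = 1)
    (hA : (1 - s) * ξ - τ * (1 - s) = (1 - u * s) * ρ)
    (hC : τ * (1 - u * s) = (1 - u * s) * τ')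
    (hD : 6 * τ = 3 * v + b * (1 + s) + 6 * ((1 - s) * x + (1 - u) * y))
    (hsv : s * v = -v) (hvs : v * s = -v) (hu : u * (u * u) = 1)
    (hv : v + u * v + u * (u * v) = b - b * s) (hub : u * b = b) (hbu : b * u = b)
    (hρs : ρ * (1 + s) = -(s * ξ * (1 + s)))
    (hρu : ρ * (1 + u + u ^ 2) = τ' * s * (1 + u + u ^ 2))
    (hds : (1 - s) * (6 * ξ - 6 * ρ - 3 * v - 6 * x * (1 - s)) =
      (1 - u) * (6 * s * ρ + 6 * y * (1 - s)) →
      (1 - s) * (6 * ξ - 6 * ρ - 3 * v - 6 * x * (1 - s)) = 0)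
    (hdu : (1 - s) * (18 * (ξ - ρ + τ' * s - x * (1 - u))) =
      (1 - u) * (18 * (s * ρ - s * τ' * s + y * (1 - u)) +
        (2 + u) * (3 * v + b * (1 + s)) * (1 - u)) →
      (1 - s) * (18 * (ξ - ρ + τ' * s - x * (1 - u))) = 0)
    (hLs : ∀ z, L (s * z) = L (z * s)) (hLu : ∀ z, L (u * z) = L (z * u)) :
    L ξ = L τ - L τ' + L v / 2 - L b / 3 := by
  have hs0 := hds (split_S hs hA hD hsv hvs)
  have hu1 := split_U hs hA hC hD hv hub hbu
  have hu0 := hu1.symm.trans (hdu hu1)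
  have e1 : L (6 • (ξ - ρ - v - 2 • x + 2 • (x * s) - ξ * s + ρ * s)) = 0 := by
    set X := 6 * ξ - 6 * ρ - 3 * v - 6 * x * (1 - s) with hX
    have h1 : L (X - X * s) = 0 := by
      rw [map_sub, ← hLs, ← map_sub, ← map_zero L, ← hs0]
      congr 1
      noncomm_ring
    rw [← h1, hX]
    congr 1
    linear_combination (norm := noncomm_ring) -3 * hvs + 6 * x * hs
  have e2 : L (18 • (s * ρ) - 18 • (s * τ' * s) + 18 • (y - y * u) +
      (2 + u) * ((3 * v + b * (1 + s)) * (1 - u))) = 0 := by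
    set Y := 18 * (s * ρ - s * τ' * s + y * (1 - u)) +
        (2 + u) * (3 * v + b * (1 + s)) * (1 - u) with hY
    have h1 : L (3 • Y) = 0 := by
      have h2 : L ((1 - u) * (Y * (2 + u))) = 0 := by
        rw [← mul_assoc, hu0, zero_mul, map_zero]
      rw [sub_mul, map_sub, hLu, one_mul, ← map_sub] at h2
      rw [← h2]
      congr 1
      rw [hY]
      linear_combination (norm := noncomm_ring)
        18 * s * hρu - 18 * y * hu - (2 + u) * (3 * v + b * (1 + s)) * hu
    have h3 : L Y = 0 := by
      rw [map_nsmul, smul_eq_zero] at h1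
      exact h1.resolve_left (by norm_num)
    rw [← h3, hY]
    congr 1
    noncomm_ring
  have e3 : L ((2 + u) * ((3 * v + b * (1 + s)) * (1 - u))) =
      L (9 • v + 3 • (b * (1 + s)) - 6 • b) := by
    have h1 : L ((2 + u) * ((3 * v + b * (1 + s)) * (1 - u))) =
        L ((3 * v + b * (1 + s)) * (1 - u) * (2 + u)) := by
      generalize (3 * v + b * (1 + s)) * (1 - u) = z
      rw [add_mul, mul_add, map_add, map_add, hLu, two_mul, mul_two]
    have h2 : L ((3 * v + b * (1 + s)) * (1 + u + u * u)) = L (6 • b) := by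
      have h3 : 3 * v + b * (1 + s) + u * (3 * v + b * (1 + s)) +
          u * (u * (3 * v + b * (1 + s))) = 6 • b := by
        linear_combination (norm := noncomm_ring) 3 * hv + (2 * hub + u * hub) * (1 + s)
      rw [← h3, map_add, map_add, hLu, hLu (u * _), mul_assoc u, hLu, ← map_add, ← map_add]
      congr 1
      noncomm_ring
    rw [h1, map_sub, ← h2, ← map_sub]
    congr 1
    noncomm_ring
  have e4 : L (6 • τ) = L (3 • v + b * (1 + s) + 6 • (x - s * x + y - u * y)) := by
    congr 1
    linear_combination (norm := noncomm_ring) hD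
  have e5 : L (ρ + ρ * s) = L (-(s * ξ) - s * ξ * s) := by
    congr 1
    linear_combination (norm := noncomm_ring) hρs
  have e6 : L (s * ξ * s) = L ξ := by
    rw [mul_assoc, hLs, mul_assoc, hs, mul_one]
  have e7 : L (s * τ' * s) = L τ' := by
    rw [mul_assoc, hLs, mul_assoc, hs, mul_one]
  rw [map_add, e3] at e2
  simp only [map_add, map_sub, map_neg, map_nsmul, hLs, hLu, e6, e7, mul_add, mul_one]
    at e1 e2 e4 e5
  simp only [nsmul_eq_mul, Nat.cast_ofNat] at e1 e2 e4 e5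
  linarith

/-- The value on `s ξ` of a linear form that is invariant under right multiplication. -/
theorem invariant_formula [Algebra ℚ A] (L : A →ₗ[ℚ] ℚ)
    (hρs : ρ * (1 + s) = -(s * ξ * (1 + s)))
    (hρu : ρ * (1 + u + u ^ 2) = τ' * s * (1 + u + u ^ 2))
    (hLs : ∀ z, L (z * s) = L z) (hLu : ∀ z, L (z * u) = L z) :
    L (s * ξ) = -L τ' := by
  have h1 := congrArg L hρs
  have h2 := congrArg L hρu
  simp only [mul_add, mul_one, pow_two, ← mul_assoc, map_add, map_neg, hLs, hLu] at h1 h2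
  linarith

end Algebra

/-! ### The bimodule of integral matrices of determinant `n` -/

theorem S_eq : S = MonoidAlgebra.of ℚ PMat (incl Sg) := rfl
theorem U_eq : U = MonoidAlgebra.of ℚ PMat (incl Ug) := rfl
theorem T_eq : T = MonoidAlgebra.of ℚ PMat (incl Tg) := rfl

theorem S_mul_S : S * S = 1 := by
  rw [S_eq, ← map_mul, ← map_mul, Sg_mul_Sg, map_one, map_one]

theorem U_mul_U_mul_U : U * (U * U) = 1 := by
  rw [U_eq, ← map_mul, ← map_mul, ← map_mul, ← map_mul, Ug_mul_Ug_mul_Ug, map_one, map_one]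

theorem T_eq_U_mul_S : T = U * S := by
  rw [T_eq, Tg_eq, map_mul, map_mul, U_eq, S_eq]

/-- The elements that preserve `𝓡ₙ` under multiplication from both sides. -/
def multipliers (n : ℕ) : Subalgebra ℚ Alg where
  carrier := {a | ∀ ξ ∈ RnSub n, a * ξ ∈ RnSub n ∧ ξ * a ∈ RnSub n}
  mul_mem' := by
    intro a b ha hb ξ hξ
    refine ⟨?_, ?_⟩
    · rw [mul_assoc]
      exact (ha _ (hb _ hξ).1).1
    · rw [← mul_assoc]
      exact (hb _ (ha _ hξ).2).2
  add_mem' := by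
    intro a b ha hb ξ hξ
    rw [add_mul, mul_add]
    exact ⟨add_mem (ha _ hξ).1 (hb _ hξ).1, add_mem (ha _ hξ).2 (hb _ hξ).2⟩
  algebraMap_mem' := by
    intro r ξ hξ
    rw [← Algebra.commutes, ← Algebra.smul_def]
    exact ⟨(RnSub n).smul_mem r hξ, (RnSub n).smul_mem r hξ⟩

theorem of_incl_mem_multipliers (n : ℕ) (γ : Gam) :
    MonoidAlgebra.of ℚ PMat (incl γ) ∈ multipliers n :=
  fun _ hξ => ⟨of_incl_mul_mem γ hξ, mul_of_incl_mem γ hξ⟩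

theorem S_mem_multipliers (n : ℕ) : S ∈ multipliers n := of_incl_mem_multipliers n Sg
theorem U_mem_multipliers (n : ℕ) : U ∈ multipliers n := of_incl_mem_multipliers n Ug

theorem mul_mem_Rn {n : ℕ} {a ξ : Alg} (ha : a ∈ multipliers n) (hξ : ξ ∈ RnSub n) :
    a * ξ ∈ RnSub n := (ha _ hξ).1

theorem mem_Rn_mul {n : ℕ} {a ξ : Alg} (ha : a ∈ multipliers n) (hξ : ξ ∈ RnSub n) :
    ξ * a ∈ RnSub n := (ha _ hξ).2

theorem coeff_S_mul (ξ : Alg) (N : PMat) : (S * ξ).coeff N = ξ.coeff (incl Sg * N) := by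
  rw [S_eq, coeff_of_incl_mul, Sg_inv]

theorem coeff_mul_S (ξ : Alg) (N : PMat) : (ξ * S).coeff N = ξ.coeff (N * incl Sg) := by
  rw [S_eq, coeff_mul_of_incl, Sg_inv]

theorem coeff_U_mul (ξ : Alg) (N : PMat) :
    (U * ξ).coeff N = ξ.coeff (incl Ug * (incl Ug * N)) := by
  rw [U_eq, coeff_of_incl_mul, Ug_inv, map_mul incl, mul_assoc]

theorem incl_Ug_cube (N : PMat) : incl Ug * (incl Ug * (incl Ug * N)) = N := by
  rw [← mul_assoc (incl Ug) (incl Ug) N, ← mul_assoc, ← map_mul, ← map_mul, Ug_mul_Ug_mul_Ug,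
    map_one, one_mul]

theorem coeff_U_mul_U_mul (ξ : Alg) (N : PMat) :
    (U * (U * ξ)).coeff N = ξ.coeff (incl Ug * N) := by
  rw [coeff_U_mul, coeff_U_mul, incl_Ug_cube]

theorem incl_Sg_sq (N : PMat) : incl Sg * (incl Sg * N) = N := by
  rw [← mul_assoc, ← map_mul, Sg_mul_Sg, map_one, one_mul]

theorem mul_incl_Sg_sq (N : PMat) : N * incl Sg * incl Sg = N := by
  rw [mul_assoc, ← map_mul, Sg_mul_Sg, map_one, mul_one]

theorem finite_coeff_comp {n : ℕ} (hn : 0 < n) (ξ : Alg) {N : PMat} (hN : N ∈ matSet n) :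
    (Function.support fun γ : Gam => ξ.coeff (incl γ * N)).Finite :=
  ξ.coeff.hasFiniteSupport.preimage (fun _ _ _ _ h => incl_mul_left_inj hn hN h)

/-- The transvection `T ^ k`. -/
def Tpow (k : ℤ) : Gam := gamMk 1 k 0 1 (by ring)

theorem Tpow_mul_mk (k a b c d : ℤ) :
    incl (Tpow k) * PMat.mk !![a, b; c, d] = PMat.mk !![a + k * c, b + k * d; c, d] := by
  rw [Tpow, incl_gamMk, mk_mul_mk]; simp

theorem mk_mul_Tpow (k a b c d : ℤ) :
    PMat.mk !![a, b; c, d] * incl (Tpow k) = PMat.mk !![a, a * k + b; c, c * k + d] := by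
  rw [Tpow, incl_gamMk, mk_mul_mk]; simp

theorem Tpow_one : Tpow 1 = Tg := rfl

theorem Tpow_add (k l : ℤ) : Tpow (k + l) = Tpow k * Tpow l := by
  apply incl_injective
  rw [map_mul, Tpow, Tpow, incl_gamMk, incl_gamMk, mk_mul_Tpow, mk_entries_eq_iff]
  left; refine ⟨rfl, ?_, rfl, ?_⟩ <;> ring

theorem Tpow_injective : Function.Injective Tpow := by
  intro k l h
  have := gamMk_inj.mp h
  omega

/-- Left multiplication by `1 - T` is injective, since `T` has infinite order and acts freely. -/
theorem eq_zero_of_one_sub_T_mul {n : ℕ} (hn : 0 < n) {ξ : Alg} (hξ : ξ ∈ RnSub n)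
    (h : (1 - T) * ξ = 0) : ξ = 0 := by
  by_contra hne
  obtain ⟨N, hN⟩ : ∃ N, ξ.coeff N ≠ 0 := by
    by_contra! hc
    exact hne (MonoidAlgebra.coeff_injective (Finsupp.ext hc))
  have h1 : ∀ N, ξ.coeff (incl Tg * N) = ξ.coeff N := by
    intro N
    have h2 : T * ξ = ξ := by rw [sub_mul, one_mul, sub_eq_zero] at h; exact h.symm
    conv_lhs => rw [← h2, T_eq, coeff_of_incl_mul, incl_inv_mul_mul]
  have h3 : ∀ k : ℕ, ξ.coeff (incl (Tpow k) * N) = ξ.coeff N := by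
    intro k
    induction k with
    | zero =>
      congr 1
      rw [Tpow, ← one_mul N, ← map_one incl, ← gamMk_one, ← mul_assoc, ← map_mul]
      simp [gamMk_one]
    | succ k ih =>
      rw [Nat.cast_succ, add_comm, Tpow_add, Tpow_one, map_mul incl, mul_assoc, h1, ih]
  refine (Set.infinite_of_injective_forall_mem (f := fun k : ℕ => Tpow k) ?_ ?_)
    (finite_coeff_comp hn ξ (hξ N hN))
  · intro k l hkl
    exact_mod_cast Tpow_injective hkl
  · intro k
    simpa [h3] using hN

/-- The sum `(1 - S) 𝓡ₙ + (1 - U) 𝓡ₙ` is direct. The coefficient at `N` of an element of both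
summands is found by pairing with the function `γ N ↦ side (γ⁻¹)`, which is invariant under `U`
and, after a change of its value at `N`, under `S` as well. -/
theorem one_sub_S_direct {n : ℕ} (hn : 0 < n) {X Y : Alg} (hX : X ∈ RnSub n)
    (h : (1 - S) * X = (1 - U) * Y) : (1 - S) * X = 0 := by
  set ξ := (1 - S) * X with hξ
  have hξmem : ξ ∈ RnSub n :=
    mul_mem_Rn (sub_mem (one_mem _) (S_mem_multipliers n)) hX
  have hS : S * ξ = -ξ := by
    rw [hξ]
    linear_combination (norm := noncomm_ring) -S_mul_S * X
  have hU : ξ + U * ξ + U * (U * ξ) = 0 := by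
    rw [h]
    linear_combination (norm := noncomm_ring) -U_mul_U_mul_U * Y
  clear_value ξ
  have hS' : ∀ N, ξ.coeff (incl Sg * N) = -ξ.coeff N := by
    intro N
    rw [← coeff_S_mul, hS, MonoidAlgebra.coeff_neg, Finsupp.neg_apply]
  have hU' : ∀ N, ξ.coeff N + ξ.coeff (incl Ug * (incl Ug * N)) + ξ.coeff (incl Ug * N) = 0 := by
    intro N
    have h1 := congrArg (fun z : Alg => z.coeff N) hU
    simpa [coeff_U_mul, coeff_U_mul_U_mul, incl_Ug_cube] using h1
  apply MonoidAlgebra.coeff_injective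
  ext N
  by_contra hN
  have hNn : N ∈ matSet n := hξmem N hN
  set a : Gam → ℚ := fun γ => ξ.coeff (incl γ * N) with ha
  have haf : a.support.Finite := finite_coeff_comp hn ξ hNn
  have haS : ∀ γ, a (Sg * γ) = -a γ := by
    intro γ
    simp only [ha, map_mul, mul_assoc, hS']
  have haU : ∀ γ, a γ + a (Ug * (Ug * γ)) + a (Ug * γ) = 0 := by
    intro γ
    simp only [ha, map_mul, mul_assoc, hU']
  set f : Gam → ℚ := fun γ => a γ * side (incl γ⁻¹) with hf
  have hff : f.support.Finite := haf.subset (Function.support_mul_subset_left _ _)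
  have hinvU : ∀ γ : Gam, side (incl (Ug * γ)⁻¹) = side (incl γ⁻¹) := by
    intro γ
    rw [← side_mul_Ug, ← map_mul, _root_.mul_inv_rev, inv_mul_cancel_right]
  have h0 : ∑ᶠ γ, f γ = 0 := by
    have h1 : ∑ᶠ γ, (f γ + f (Ug * (Ug * γ)) + f (Ug * γ)) = 0 := by
      rw [← finsum_zero (α := Gam)]
      refine finsum_congr fun γ => ?_
      simp only [hf, hinvU]
      rw [← add_mul, ← add_mul, haU, zero_mul]
    have h2 := finite_support_mul_left Ug hff
    have h3 := finite_support_mul_left Ug h2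
    rw [finsum_add_distrib, finsum_add_distrib, finsum_mul_left Ug fun γ => f (Ug * γ),
      finsum_mul_left] at h1
    · linarith
    · exact hff
    · exact h3
    · exact (hff.union h3).subset (Function.support_add _ _)
    · exact h2
  have hval : ∑ᶠ γ, (f γ + f (Sg * γ)) = 2 * ξ.coeff N := by
    classical
    have hinvS : ∀ γ : Gam, side (incl (Sg * γ)⁻¹) = side (incl γ⁻¹ * incl Sg) := by
      intro γ
      rw [_root_.mul_inv_rev, Sg_inv, map_mul]
    have h1S : (1 : Gam) ≠ Sg := by
      rw [← gamMk_one, show Sg = gamMk 0 (-1) 1 0 (by norm_num) from rfl, Ne, gamMk_inj]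
      norm_num
    have hs1 : side (incl 1) = 1 := by
      rw [← gamMk_one, incl_gamMk, side_mk]; norm_num
    have hs2 : side (incl Sg) = 0 := by
      rw [incl_Sg, side_mk]; norm_num
    rw [finsum_eq_sum_of_support_subset (s := {1, Sg}), Finset.sum_insert (by simpa using h1S),
      Finset.sum_singleton]
    · simp only [hf, Sg_mul_Sg, Sg_inv, mul_one, inv_one, hs1, hs2]
      simp only [ha, map_one, one_mul, hS']
      ring
    · intro γ hγ
      by_contra hc
      simp only [Finset.coe_insert, Finset.coe_singleton, Set.mem_insert_iff,
        Set.mem_singleton_iff, not_or] at hc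
      refine hγ ?_
      have h1 : γ⁻¹ ≠ 1 := by simpa using hc.1
      have h2 : γ⁻¹ ≠ Sg := fun h => hc.2 (by rw [← Sg_inv, ← h, inv_inv])
      simp only [hf, haS, hinvS, side_mul_Sg_of_ne h1 h2]
      ring
  rw [finsum_add_distrib hff (finite_support_mul_left Sg hff), finsum_mul_left, h0] at hval
  refine hN ?_
  simp only [MonoidAlgebra.coeff_zero, Finsupp.zero_apply]
  linarith

/-- The subspace `(1 - S) 𝓡ₙ + (1 - U) 𝓡ₙ`. -/
noncomputable def augSub (n : ℕ) : Submodule ℚ Alg :=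
  (RnSub n).map (LinearMap.mulLeft ℚ (1 - S)) ⊔ (RnSub n).map (LinearMap.mulLeft ℚ (1 - U))

theorem mem_augSub {n : ℕ} {ξ : Alg} :
    ξ ∈ augSub n ↔ ∃ x ∈ RnSub n, ∃ y ∈ RnSub n, ξ = (1 - S) * x + (1 - U) * y := by
  rw [augSub, Submodule.mem_sup]
  simp only [Submodule.mem_map, LinearMap.mulLeft_apply, exists_exists_and_eq_and]
  simp only [eq_comm]

/-- As `S` and `U` generate `Γ`, the subspace contains all differences `ξ - γ ξ`. -/
theorem sub_incl_mul_mem_augSub {n : ℕ} (γ : Gam) {ξ : Alg} (hξ : ξ ∈ RnSub n) :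
    ξ - MonoidAlgebra.of ℚ PMat (incl γ) * ξ ∈ augSub n := by
  let H : Subgroup Gam :=
    { carrier := {γ | ∀ ξ ∈ RnSub n, ξ - MonoidAlgebra.of ℚ PMat (incl γ) * ξ ∈ augSub n}
      one_mem' := by
        intro ξ _
        rw [map_one, map_one, one_mul, sub_self]
        exact zero_mem _
      mul_mem' := by
        intro a b ha hb ξ hξ
        have h := add_mem (hb ξ hξ) (ha _ (of_incl_mul_mem b hξ))
        rwa [sub_add_sub_cancel, ← mul_assoc, ← map_mul, ← map_mul] at h
      inv_mem' := by
        intro a ha ξ hξ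
        have h := neg_mem (ha _ (of_incl_mul_mem a⁻¹ hξ))
        rwa [neg_sub, ← mul_assoc, ← map_mul, incl_mul_inv, map_one, one_mul] at h }
  have hS : Sg ∈ H := by
    intro ξ hξ
    refine mem_augSub.mpr ⟨ξ, hξ, 0, zero_mem _, ?_⟩
    rw [mul_zero, add_zero, sub_mul, one_mul, S_eq]
  have hU : Ug ∈ H := by
    intro ξ hξ
    refine mem_augSub.mpr ⟨0, zero_mem _, ξ, hξ, ?_⟩
    rw [mul_zero, zero_add, sub_mul, one_mul, U_eq]
  have hT : Tg ∈ H := by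
    rw [Tg_eq]; exact H.mul_mem hU hS
  have htop : H.comap (QuotientGroup.mk' (Subgroup.center (SpecialLinearGroup (Fin 2) ℤ))) = ⊤ := by
    rw [eq_top_iff, ← SpecialLinearGroup.SL2Z_generators, Subgroup.closure_le]
    rintro g (rfl | rfl)
    · exact hS
    · exact hT
  obtain ⟨g, rfl⟩ := gam_surj γ
  have hg : g ∈ H.comap (QuotientGroup.mk' (Subgroup.center (SpecialLinearGroup (Fin 2) ℤ))) := by
    rw [htop]; trivial
  exact hg ξ hξ

/-! ### Upper triangular representatives -/

/-- The index set of the matrices `(a b; 0 d)` with `a d = n`, `0 ≤ b < d`. -/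
def leftIndex (n : ℕ) : Finset (Σ _ : ℕ × ℕ, ℕ) :=
  n.divisorsAntidiagonal.sigma fun x => Finset.range x.2

/-- The index set of the matrices `(a b; 0 d)` with `a d = n`, `0 ≤ b < a`. -/
def rightIndex (n : ℕ) : Finset (Σ _ : ℕ × ℕ, ℕ) :=
  n.divisorsAntidiagonal.sigma fun x => Finset.range x.1

/-- The class of the matrix `(a b; 0 d)`. -/
def upper (a d b : ℤ) : PMat := PMat.mk !![a, b; 0, d]

/-- The matrix with a given index. -/
def upperOf (i : Σ _ : ℕ × ℕ, ℕ) : PMat := upper i.1.1 i.1.2 i.2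

theorem mem_leftIndex {n : ℕ} (hn : 0 < n) {a d b : ℕ} :
    (⟨(a, d), b⟩ : Σ _ : ℕ × ℕ, ℕ) ∈ leftIndex n ↔ a * d = n ∧ b < d := by
  simp [leftIndex, Nat.mem_divisorsAntidiagonal, hn.ne']

theorem mem_rightIndex {n : ℕ} (hn : 0 < n) {a d b : ℕ} :
    (⟨(a, d), b⟩ : Σ _ : ℕ × ℕ, ℕ) ∈ rightIndex n ↔ a * d = n ∧ b < a := by
  simp [rightIndex, Nat.mem_divisorsAntidiagonal, hn.ne']

theorem Tpow_mul_upper (k a d b : ℤ) : incl (Tpow k) * upper a d b = upper a d (b + k * d) := by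
  rw [upper, Tpow_mul_mk, upper]; simp

theorem upper_mul_Tpow (k a d b : ℤ) : upper a d b * incl (Tpow k) = upper a d (b + a * k) := by
  rw [upper, mk_mul_Tpow, upper]; simp [add_comm]

theorem upper_mem {n : ℕ} {a d b : ℤ} : upper a d b ∈ matSet n ↔ a * d = n := by
  rw [upper, mem_matSet_mk]; simp

theorem upper_inj {a d b a' d' b' : ℤ} (ha : 0 < a) (ha' : 0 < a')
    (h : upper a d b = upper a' d' b') : a = a' ∧ d = d' ∧ b = b' := by
  rcases mk_entries_eq_iff.mp h with h | h
  · exact ⟨h.1, h.2.2.2, h.2.1⟩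
  · omega

theorem exists_upper_pos {n : ℕ} (hn : 0 < n) {M : PMat} (hM : M ∈ matSet n) {a b d : ℤ}
    (h : M = PMat.mk !![a, b; 0, d]) :
    ∃ a d : ℕ, ∃ b : ℤ, 0 < a ∧ 0 < d ∧ a * d = n ∧ M = upper a d b := by
  subst h
  have had : a * d = n := by
    have := mem_matSet_mk.mp hM
    simpa using this
  have hpos : 0 < a * d := by rw [had]; exact_mod_cast hn
  rcases pos_and_pos_or_neg_and_neg_of_mul_pos hpos with ⟨h1, h2⟩ | ⟨h1, h2⟩
  · lift a to ℕ using h1.le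
    lift d to ℕ using h2.le
    exact ⟨a, d, b, by exact_mod_cast h1, by exact_mod_cast h2, by exact_mod_cast had, rfl⟩
  · obtain ⟨a', rfl⟩ : ∃ a', a = -a' := ⟨-a, by ring⟩
    obtain ⟨d', rfl⟩ : ∃ d', d = -d' := ⟨-d, by ring⟩
    lift a' to ℕ using by omega
    lift d' to ℕ using by omega
    refine ⟨a', d', -b, by omega, by omega, ?_, ?_⟩
    · rw [neg_mul_neg] at had
      exact_mod_cast had
    · rw [upper, mk_entries_eq_iff]; simp

/-- A non-zero integral vector is a multiple of the first column of an element of `SL₂(ℤ)`. -/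
theorem exists_primitive {x y : ℤ} (h : x ≠ 0 ∨ y ≠ 0) :
    ∃ g p r : ℤ, g ≠ 0 ∧ x = g * p ∧ y = g * r ∧ ∃ q s : ℤ, p * s - q * r = 1 := by
  have hg : 0 < Int.gcd x y := Int.gcd_pos_iff.mpr h
  obtain ⟨p, r, hpr, hx, hy⟩ := Int.exists_gcd_one hg
  obtain ⟨s, q, hsq⟩ := Int.isCoprime_iff_gcd_eq_one.mpr hpr
  exact ⟨Int.gcd x y, p, r, by exact_mod_cast hg.ne', by linarith, by linarith, -q, s,
    by linarith⟩

theorem exists_left_index {n : ℕ} (hn : 0 < n) {M : PMat} (hM : M ∈ matSet n) :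
    ∃ i ∈ leftIndex n, ∃ γ : Gam, M = incl γ * upperOf i := by
  obtain ⟨a, b, c, d, rfl⟩ := exists_mk_entries M
  have hdet := mem_matSet_mk.mp hM
  have hn' : (0 : ℤ) < n := by exact_mod_cast hn
  have hac : a ≠ 0 ∨ c ≠ 0 := by
    by_contra! hc
    rw [hc.1, hc.2] at hdet
    simp at hdet
    omega
  obtain ⟨g, p, r, -, rfl, rfl, q, s, hps⟩ := exists_primitive hac
  have h1 : incl (gamMk p q r s hps)⁻¹ * PMat.mk !![g * p, b; g * r, d] =
      PMat.mk !![s * (g * p) + -q * (g * r), s * b + -q * d; 0, -r * b + p * d] := by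
    rw [incl_gamMk_inv, mk_mul_mk]
    congr 3
    ring_nf
  have hmem : incl (gamMk p q r s hps)⁻¹ * PMat.mk !![g * p, b; g * r, d] ∈ matSet n :=
    incl_mul_mem.mpr hM
  obtain ⟨a', d', b', ha', hd', had, h2⟩ := exists_upper_pos hn hmem h1
  refine ⟨⟨(a', d'), (b' % d').toNat⟩, ?_, gamMk p q r s hps * Tpow (b' / d'), ?_⟩
  · rw [mem_leftIndex hn]
    refine ⟨had, ?_⟩
    have := Int.emod_lt_of_pos b' (by exact_mod_cast hd' : (0 : ℤ) < d')
    omega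
  · have h3 : incl (Tpow (b' / d')) * upperOf ⟨(a', d'), (b' % d').toNat⟩ = upper a' d' b' := by
      rw [upperOf, Tpow_mul_upper]
      congr 1
      have := Int.emod_nonneg b' (by exact_mod_cast hd'.ne' : (d' : ℤ) ≠ 0)
      simp only [Int.toNat_of_nonneg this]
      linarith [Int.emod_add_mul_ediv b' d']
    rw [map_mul, mul_assoc, h3, ← h2, incl_mul_inv_mul]

theorem exists_right_index {n : ℕ} (hn : 0 < n) {M : PMat} (hM : M ∈ matSet n) :
    ∃ i ∈ rightIndex n, ∃ γ : Gam, upperOf i = M * incl γ := by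
  obtain ⟨a, b, c, d, rfl⟩ := exists_mk_entries M
  have hdet := mem_matSet_mk.mp hM
  have hn' : (0 : ℤ) < n := by exact_mod_cast hn
  have hcd : d ≠ 0 ∨ -c ≠ 0 := by
    by_contra! hc
    rw [hc.1, neg_eq_zero.mp hc.2] at hdet
    simp at hdet
    omega
  obtain ⟨g, p, r, -, rfl, hc, q, s, hps⟩ := exists_primitive hcd
  obtain rfl : c = -(g * r) := by linarith
  have h1 : PMat.mk !![a, b; -(g * r), g * p] * incl (gamMk p q r s hps) =
      PMat.mk !![a * p + b * r, a * q + b * s; 0, -(g * r) * q + g * p * s] := by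
    rw [incl_gamMk, mk_mul_mk]
    congr 3
    ring_nf
  have hmem : PMat.mk !![a, b; -(g * r), g * p] * incl (gamMk p q r s hps) ∈ matSet n :=
    mul_incl_mem.mpr hM
  obtain ⟨a', d', b', ha', hd', had, h2⟩ := exists_upper_pos hn hmem h1
  refine ⟨⟨(a', d'), (b' % a').toNat⟩, ?_, gamMk p q r s hps * Tpow (-(b' / a')), ?_⟩
  · rw [mem_rightIndex hn]
    refine ⟨had, ?_⟩
    have := Int.emod_lt_of_pos b' (by exact_mod_cast ha' : (0 : ℤ) < a')
    omega
  · rw [map_mul, ← mul_assoc, h2, upper_mul_Tpow, upperOf]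
    congr 1
    have := Int.emod_nonneg b' (by exact_mod_cast ha'.ne' : (a' : ℤ) ≠ 0)
    simp only [Int.toNat_of_nonneg this]
    linarith [Int.emod_add_mul_ediv b' a']

theorem eq_Tpow_of_upper {γ : Gam} {a b d a' b' d' : ℤ} (ha : a ≠ 0)
    (h : incl γ * PMat.mk !![a, b; 0, d] = PMat.mk !![a', b'; 0, d']) : ∃ k, γ = Tpow k := by
  obtain ⟨p, q, r, s, hps, rfl⟩ := exists_gamMk γ
  rw [incl_gamMk, mk_mul_mk, mk_entries_eq_iff] at h
  have hr : r = 0 := by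
    have : r * a = 0 := by
      rcases h with h | h <;> linarith [h.2.2.1]
    exact (mul_eq_zero.mp this).resolve_right ha
  subst hr
  have h1 : p * s = 1 := by linarith
  rcases Int.mul_eq_one_iff_eq_one_or_neg_one.mp h1 with ⟨rfl, rfl⟩ | ⟨rfl, rfl⟩
  · exact ⟨q, rfl⟩
  · exact ⟨-q, gamMk_inj.mpr (Or.inr ⟨rfl, by simp, rfl, rfl⟩)⟩

theorem eq_Tpow_of_upper_mul {γ : Gam} {a b d a' b' d' : ℤ} (hd : d ≠ 0)
    (h : PMat.mk !![a, b; 0, d] * incl γ = PMat.mk !![a', b'; 0, d']) : ∃ k, γ = Tpow k := by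
  obtain ⟨p, q, r, s, hps, rfl⟩ := exists_gamMk γ
  rw [incl_gamMk, mk_mul_mk, mk_entries_eq_iff] at h
  have hr : r = 0 := by
    have : d * r = 0 := by
      rcases h with h | h <;> linarith [h.2.2.1]
    exact (mul_eq_zero.mp this).resolve_left hd
  subst hr
  have h1 : p * s = 1 := by linarith
  rcases Int.mul_eq_one_iff_eq_one_or_neg_one.mp h1 with ⟨rfl, rfl⟩ | ⟨rfl, rfl⟩
  · exact ⟨q, rfl⟩
  · exact ⟨-q, gamMk_inj.mpr (Or.inr ⟨rfl, by simp, rfl, rfl⟩)⟩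

theorem eq_of_add_mul_eq {b b' d : ℕ} {k : ℤ} (hb : b < d) (hb' : b' < d)
    (h : (b : ℤ) + k * d = b') : b = b' := by
  have h1 : (b : ℤ) % d = (b' : ℤ) % d := by rw [← h, Int.add_mul_emod_self_right]
  rw [Int.emod_eq_of_lt (by omega) (by omega), Int.emod_eq_of_lt (by omega) (by omega)] at h1
  exact_mod_cast h1

theorem left_index_unique {n : ℕ} (hn : 0 < n) {i j : Σ _ : ℕ × ℕ, ℕ} (hi : i ∈ leftIndex n)
    (hj : j ∈ leftIndex n) {γ : Gam} (h : incl γ * upperOf i = upperOf j) : i = j := by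
  obtain ⟨⟨a, d⟩, b⟩ := i
  obtain ⟨⟨a', d'⟩, b'⟩ := j
  rw [mem_leftIndex hn] at hi hj
  have ha : 0 < a := Nat.pos_of_mul_pos_right (hi.1 ▸ hn)
  have ha' : 0 < a' := Nat.pos_of_mul_pos_right (hj.1 ▸ hn)
  obtain ⟨k, rfl⟩ := eq_Tpow_of_upper (by exact_mod_cast ha.ne') h
  rw [upperOf, upperOf, Tpow_mul_upper] at h
  obtain ⟨h1, h2, h3⟩ := upper_inj (by exact_mod_cast ha) (by exact_mod_cast ha') h
  obtain rfl : a = a' := by exact_mod_cast h1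
  obtain rfl : d = d' := by exact_mod_cast h2
  rw [eq_of_add_mul_eq hi.2 hj.2 h3]

theorem right_index_unique {n : ℕ} (hn : 0 < n) {i j : Σ _ : ℕ × ℕ, ℕ} (hi : i ∈ rightIndex n)
    (hj : j ∈ rightIndex n) {γ : Gam} (h : upperOf i * incl γ = upperOf j) : i = j := by
  obtain ⟨⟨a, d⟩, b⟩ := i
  obtain ⟨⟨a', d'⟩, b'⟩ := j
  rw [mem_rightIndex hn] at hi hj
  have ha : 0 < a := Nat.pos_of_mul_pos_right (hi.1 ▸ hn)
  have hd : 0 < d := Nat.pos_of_mul_pos_left (hi.1 ▸ hn)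
  have ha' : 0 < a' := Nat.pos_of_mul_pos_right (hj.1 ▸ hn)
  obtain ⟨k, rfl⟩ := eq_Tpow_of_upper_mul (by exact_mod_cast hd.ne') h
  rw [upperOf, upperOf, upper_mul_Tpow] at h
  obtain ⟨h1, h2, h3⟩ := upper_inj (by exact_mod_cast ha) (by exact_mod_cast ha') h
  obtain rfl : a = a' := by exact_mod_cast h1
  obtain rfl : d = d' := by exact_mod_cast h2
  rw [mul_comm] at h3
  rw [eq_of_add_mul_eq hi.2 hj.2 h3]

theorem upperOf_mem_of_left {n : ℕ} (hn : 0 < n) {i : Σ _ : ℕ × ℕ, ℕ} (hi : i ∈ leftIndex n) :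
    upperOf i ∈ matSet n := by
  obtain ⟨⟨a, d⟩, b⟩ := i
  rw [mem_leftIndex hn] at hi
  rw [upperOf, upper_mem]
  exact_mod_cast hi.1

theorem upperOf_mem_of_right {n : ℕ} (hn : 0 < n) {i : Σ _ : ℕ × ℕ, ℕ} (hi : i ∈ rightIndex n) :
    upperOf i ∈ matSet n := by
  obtain ⟨⟨a, d⟩, b⟩ := i
  rw [mem_rightIndex hn] at hi
  rw [upperOf, upper_mem]
  exact_mod_cast hi.1

/-! ### The standard choice of `T_n^∞` -/

/-- The element `T_n^∞` for the standard representatives `(a b; 0 d)`, `0 ≤ b < d`. -/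
noncomputable def leftSum (n : ℕ) : Alg := ∑ i ∈ leftIndex n, MonoidAlgebra.of ℚ PMat (upperOf i)

/-- The sum of the representatives `(a b; 0 d)`, `0 ≤ b < a`, of the right cosets. -/
noncomputable def rightSum (n : ℕ) : Alg :=
  ∑ i ∈ rightIndex n, MonoidAlgebra.of ℚ PMat (upperOf i)

theorem rightSum_mem {n : ℕ} (hn : 0 < n) : rightSum n ∈ RnSub n :=
  sum_mem fun _ hi => of_mem (upperOf_mem_of_right hn hi)

theorem leftSum_eq (n : ℕ) : leftSum n = ∑ x ∈ n.divisorsAntidiagonal, ∑ b ∈ Finset.range x.2,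
    MonoidAlgebra.of ℚ PMat (upper x.1 x.2 b) := by
  rw [leftSum, leftIndex, Finset.sum_sigma]; rfl

theorem rightSum_eq (n : ℕ) : rightSum n = ∑ x ∈ n.divisorsAntidiagonal, ∑ b ∈ Finset.range x.1,
    MonoidAlgebra.of ℚ PMat (upper x.1 x.2 b) := by
  rw [rightSum, rightIndex, Finset.sum_sigma]; rfl

/-- Both sides are telescoped from sums over `0 ≤ b < a + d`. -/
theorem leftSum_mul_one_sub_T (n : ℕ) : leftSum n * (1 - T) = (1 - T) * rightSum n := by
  rw [leftSum_eq, rightSum_eq, Finset.sum_mul, Finset.mul_sum]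
  refine Finset.sum_congr rfl fun x _ => ?_
  have h1 : ∀ b : ℕ, MonoidAlgebra.of ℚ PMat (upper x.1 x.2 b) * T =
      MonoidAlgebra.of ℚ PMat (upper x.1 x.2 (x.1 + b : ℕ)) := by
    intro b
    rw [T_eq, ← Tpow_one, ← map_mul, upper_mul_Tpow]
    push_cast
    rw [mul_one, add_comm]
  have h2 : ∀ b : ℕ, T * MonoidAlgebra.of ℚ PMat (upper x.1 x.2 b) =
      MonoidAlgebra.of ℚ PMat (upper x.1 x.2 (x.2 + b : ℕ)) := by
    intro b
    rw [T_eq, ← Tpow_one, ← map_mul, Tpow_mul_upper]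
    push_cast
    rw [one_mul, add_comm]
  have h3 := Finset.sum_range_add (fun b : ℕ => MonoidAlgebra.of ℚ PMat (upper x.1 x.2 b)) x.1 x.2
  have h4 := Finset.sum_range_add (fun b : ℕ => MonoidAlgebra.of ℚ PMat (upper x.1 x.2 b)) x.2 x.1
  rw [add_comm x.2 x.1, h3] at h4
  rw [mul_sub, mul_one, sub_mul, one_mul, Finset.sum_mul, Finset.mul_sum,
    Finset.sum_congr rfl fun b _ => h1 b, Finset.sum_congr rfl fun b _ => h2 b]
  linear_combination (norm := abel) -h4

/-- The standard representatives lead to the same element modulo `(1 - T) 𝓡ₙ`. -/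
theorem exists_Tinf_sub_leftSum {n : ℕ} (hn : 0 < n) {R : Finset PMat} (hR : IsReprSet n R) :
    ∃ z ∈ RnSub n, Tinf R - leftSum n = (1 - T) * z := by
  set I := (RnSub n).map (LinearMap.mulLeft ℚ (1 - T)) with hI
  have hmem : ∀ {ξ}, ξ ∈ I ↔ ∃ z ∈ RnSub n, ξ = (1 - T) * z := by
    intro ξ
    simp [hI, eq_comm]
  rw [← hmem]
  have hstep : ∀ {N : PMat}, N ∈ matSet n → MonoidAlgebra.of ℚ PMat (incl Tg * N) -
      MonoidAlgebra.of ℚ PMat N ∈ I := by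
    intro N hN
    refine hmem.mpr ⟨-MonoidAlgebra.of ℚ PMat N, neg_mem (of_mem hN), ?_⟩
    rw [T_eq, map_mul]
    noncomm_ring
  have hpow : ∀ {N : PMat}, N ∈ matSet n → ∀ k : ℤ,
      MonoidAlgebra.of ℚ PMat (incl (Tpow k) * N) - MonoidAlgebra.of ℚ PMat N ∈ I := by
    intro N hN k
    have h1 : ∀ k : ℤ, Tpow (k + 1) = Tg * Tpow k := fun k => by
      rw [add_comm, Tpow_add, Tpow_one]
    have h2 : ∀ k, MonoidAlgebra.of ℚ PMat (incl (Tpow (k + 1)) * N) -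
        MonoidAlgebra.of ℚ PMat (incl (Tpow k) * N) ∈ I := by
      intro k
      rw [h1, map_mul incl, mul_assoc]
      exact hstep (incl_mul_mem.mpr hN)
    induction k using Int.induction_on with
    | zero =>
      rw [Tpow, gamMk_one, map_one, one_mul, sub_self]
      exact zero_mem _
    | succ k ih => simpa using add_mem (h2 k) ih
    | pred k ih =>
      have := h2 (-(k : ℤ) - 1)
      rw [sub_add_cancel] at this
      simpa using sub_mem ih this
  have hex : ∀ i ∈ leftIndex n, ∃ N ∈ R, ∃ γ : Gam, N = incl γ * upperOf i := by
    intro i hi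
    obtain ⟨N, ⟨h1, h2⟩, -⟩ := hR.2 _ (upperOf_mem_of_left hn hi)
    exact ⟨N, h1, h2⟩
  choose! rep hrep hγ using hex
  have hsum : Tinf R = ∑ i ∈ leftIndex n, MonoidAlgebra.of ℚ PMat (rep i) := by
    rw [Tinf]
    symm
    refine Finset.sum_bij (fun i _ => rep i) (fun i hi => hrep i hi) ?_ ?_ fun _ _ => rfl
    · intro i hi j hj hij
      obtain ⟨γ, h1⟩ := hγ i hi
      obtain ⟨γ', h2⟩ := hγ j hj
      refine left_index_unique hn hi hj (γ := γ'⁻¹ * γ) ?_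
      rw [map_mul, mul_assoc, ← h1, hij, h2, incl_inv_mul_mul]
    · intro N hN
      obtain ⟨i, hi, γ, h1⟩ := exists_left_index hn (hR.1 N hN).1
      refine ⟨i, hi, ?_⟩
      exact (hR.2 _ (upperOf_mem_of_left hn hi)).unique ⟨hrep i hi, hγ i hi⟩ ⟨hN, γ, h1⟩
  rw [hsum, leftSum, ← Finset.sum_sub_distrib]
  refine sum_mem fun i hi => ?_
  obtain ⟨γ, h1⟩ := hγ i hi
  obtain ⟨A, h2, h3⟩ := (hR.1 _ (hrep i hi)).2
  have h4 : incl γ * PMat.mk !![(i.1.1 : ℤ), (i.2 : ℤ); 0, (i.1.2 : ℤ)] =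
      PMat.mk !![A 0 0, A 0 1; 0, A 1 1] := by
    have h5 : A = !![A 0 0, A 0 1; 0, A 1 1] := by
      conv_lhs => rw [Matrix.eta_fin_two A, h3]
    rw [← h5, ← h2, h1]; rfl
  have ha : (i.1.1 : ℤ) ≠ 0 := by
    obtain ⟨⟨a, d⟩, b⟩ := i
    rw [mem_leftIndex hn] at hi
    have : 0 < a := Nat.pos_of_mul_pos_right (hi.1 ▸ hn)
    exact_mod_cast this.ne'
  obtain ⟨k, rfl⟩ := eq_Tpow_of_upper ha h4
  rw [h1]
  exact hpow (upperOf_mem_of_left hn hi) k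

/-- The left coset `Γ M`. -/
def leftCoset (M : PMat) : Set PMat := Set.range fun γ : Gam => incl γ * M

/-- Modulo `(1 - S) 𝓡ₙ + (1 - U) 𝓡ₙ` an element is determined by its sums over the left cosets. -/
theorem sub_sum_mem_augSub {n : ℕ} (hn : 0 < n) {ξ : Alg} (hξ : ξ ∈ RnSub n) :
    ξ - ∑ i ∈ leftIndex n, pairFun (charFun (leftCoset (upperOf i))) ξ •
      MonoidAlgebra.of ℚ PMat (upperOf i) ∈ augSub n := by
  classical
  set Φ : Alg →ₗ[ℚ] Alg := LinearMap.id - ∑ i ∈ leftIndex n,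
    (pairFun (charFun (leftCoset (upperOf i)))).smulRight (MonoidAlgebra.of ℚ PMat (upperOf i))
    with hΦ
  have hΦ' : ∀ ξ, Φ ξ = ξ - ∑ i ∈ leftIndex n, pairFun (charFun (leftCoset (upperOf i))) ξ •
      MonoidAlgebra.of ℚ PMat (upperOf i) := by
    intro ξ
    simp [hΦ, LinearMap.sum_apply]
  rw [← hΦ']
  have hbase : ∀ M ∈ matSet n, Φ (MonoidAlgebra.of ℚ PMat M) ∈ augSub n := by
    intro M hM
    obtain ⟨i, hi, γ, rfl⟩ := exists_left_index hn hM
    have h1 := neg_mem (sub_incl_mul_mem_augSub γ (of_mem (upperOf_mem_of_left hn hi)))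
    rw [neg_sub, ← map_mul] at h1
    rw [hΦ', Finset.sum_eq_single i]
    · rw [pairFun_of, charFun, if_pos ⟨γ, rfl⟩, one_smul]
      exact h1
    · intro j hj hji
      rw [pairFun_of, charFun, if_neg, zero_smul]
      rintro ⟨γ', h2⟩
      refine hji (left_index_unique hn hj hi (γ := γ⁻¹ * γ') ?_)
      simp only at h2
      rw [map_mul, mul_assoc, h2, incl_inv_mul_mul]
    · intro h; exact absurd hi h
  rw [← MonoidAlgebra.sum_coeff_single ξ, Finsupp.sum, map_sum]
  refine sum_mem fun M hM => ?_
  have h1 : MonoidAlgebra.single M (ξ.coeff M) = ξ.coeff M • MonoidAlgebra.of ℚ PMat M := by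
    rw [MonoidAlgebra.of_apply, MonoidAlgebra.smul_single, smul_eq_mul, mul_one]
  rw [h1, map_smul]
  exact Submodule.smul_mem _ _ (hbase M (hξ M (by simpa using hM)))

/-! ### An element with the same left coset sums as `T_n^∞` -/

theorem entries_bounded {a b c d C : ℤ} (hab : a ^ 2 + b ^ 2 ≤ C) (hcd : c ^ 2 + d ^ 2 ≤ C) :
    ∃ A, PMat.mk !![a, b; c, d] = PMat.mk A ∧ ∀ i j, |A i j| ≤ C := by
  refine ⟨_, rfl, ?_⟩
  intro i j
  fin_cases i <;> fin_cases j <;> simp only [Fin.zero_eta, Fin.mk_one] <;>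
    exact abs_le_of_sq_le (by simp; nlinarith [sq_nonneg a, sq_nonneg b, sq_nonneg c, sq_nonneg d])

theorem rows_ne_zero {a b c d : ℤ} (h : a * d - b * c ≠ 0) :
    1 ≤ a ^ 2 + b ^ 2 ∧ 1 ≤ c ^ 2 + d ^ 2 := by
  constructor
  · by_contra! hc
    have ha : a = 0 := by
      apply pow_eq_zero_iff (two_ne_zero) |>.mp; nlinarith [sq_nonneg a, sq_nonneg b]
    have hb : b = 0 := by
      apply pow_eq_zero_iff (two_ne_zero) |>.mp; nlinarith [sq_nonneg a, sq_nonneg b]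
    simp [ha, hb] at h
  · by_contra! hc
    have ha : c = 0 := by
      apply pow_eq_zero_iff (two_ne_zero) |>.mp; nlinarith [sq_nonneg c, sq_nonneg d]
    have hb : d = 0 := by
      apply pow_eq_zero_iff (two_ne_zero) |>.mp; nlinarith [sq_nonneg c, sq_nonneg d]
    simp [ha, hb] at h

/-- Few triangles `N (0, 1, ∞)` are separated from `N S (0, 1, ∞)` by the imaginary axis. -/
theorem finite_side_mul_Sg_ne {n : ℕ} (hn : 0 < n) :
    {N | N ∈ matSet n ∧ side (N * incl Sg) ≠ side N}.Finite := by
  refine (finite_of_bounded (2 * n ^ 2)).subset ?_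
  rintro N ⟨hN, hne⟩
  obtain ⟨a, b, c, d, rfl⟩ := exists_mk_entries N
  rw [mem_matSet_mk] at hN
  have hn' : (0 : ℤ) < n := by exact_mod_cast hn
  have h1 : (2 * (b * d + -a * -c) + b * -c + -a * d) *
      (2 * (a * c + b * d) + a * d + b * c) ≤ 0 := by
    by_contra hc
    refine hne ?_
    rw [mk_mul_Sg, side_mk, side_mk, sign_eq_of_not_mul_nonpos hc]
  obtain ⟨h2, h3⟩ := rows_ne_zero (a := a) (b := b) (c := c) (d := d) (by omega)
  have h4 : (a ^ 2 + b ^ 2) * (c ^ 2 + d ^ 2) = (a * c + b * d) ^ 2 + n ^ 2 := by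
    rw [← hN]; ring
  have h5 : 3 * (a * c + b * d) ^ 2 ≤ n ^ 2 := by
    rw [← hN]
    nlinarith [sq_nonneg (a * c - b * d)]
  have h6 : (a ^ 2 + b ^ 2) * (c ^ 2 + d ^ 2) ≤ 2 * n ^ 2 := by nlinarith
  apply entries_bounded
  · exact (le_mul_of_one_le_right (by positivity) h3).trans h6
  · exact (le_mul_of_one_le_left (by positivity) h2).trans h6

theorem finite_tri_ne_zero {n : ℕ} (hn : 0 < n) :
    {N | N ∈ matSet n ∧ tri N ≠ 0}.Finite := by
  refine (finite_of_bounded (9 * n ^ 4 + 3 * n ^ 2)).subset ?_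
  rintro N ⟨hN, hne⟩
  obtain ⟨a, b, c, d, rfl⟩ := exists_mk_entries N
  rw [mem_matSet_mk] at hN
  have hn' : (0 : ℤ) < n := by exact_mod_cast hn
  obtain ⟨h2, h3⟩ := rows_ne_zero (a := a) (b := b) (c := c) (d := d) (by omega)
  rw [tri_mk] at hne
  have hA : a ^ 2 + b ^ 2 ≤ 2 * (a ^ 2 + a * b + b ^ 2) := by nlinarith [sq_nonneg (a + b)]
  have hC : c ^ 2 + d ^ 2 ≤ 2 * (c ^ 2 + c * d + d ^ 2) := by nlinarith [sq_nonneg (c + d)]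
  have hid : 2 * (a ^ 2 + a * b + b ^ 2) * (2 * (c ^ 2 + c * d + d ^ 2)) =
      (2 * (a * c + b * d) + a * d + b * c) ^ 2 + 3 * n ^ 2 := by rw [← hN]; ring
  generalize 2 * (a ^ 2 + a * b + b ^ 2) = A at *
  generalize 2 * (c ^ 2 + c * d + d ^ 2) = C at *
  generalize 2 * (a * c + b * d) + a * d + b * c = B at *
  have hB : 0 ≤ B ∧ B ≤ A ∧ B ≤ C := by
    by_contra hc
    exact hne (sign_triple (by omega) (by omega) (by nlinarith) hc)
  obtain ⟨hB0, hBA, hBC⟩ := hB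
  have hB1 : B ≤ 3 * n ^ 2 := by
    have h4 : (A - B) * (C - B) + B * (A + C - 2 * B) = 3 * n ^ 2 := by linear_combination hid
    have h5 : 1 ≤ A + C - 2 * B := by
      by_contra hc
      obtain rfl : A = B := by omega
      obtain rfl : C = A := by omega
      nlinarith
    nlinarith [mul_nonneg (sub_nonneg.mpr hBA) (sub_nonneg.mpr hBC)]
  have hAC : A * C ≤ 9 * n ^ 4 + 3 * n ^ 2 := by
    rw [hid]
    have : B ^ 2 ≤ (3 * (n : ℤ) ^ 2) ^ 2 := pow_le_pow_left₀ hB0 hB1 2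
    linarith [this]
  apply entries_bounded
  · exact hA.trans ((le_mul_of_one_le_right (by omega) (by omega)).trans hAC)
  · exact hC.trans ((le_mul_of_one_le_left (by omega) (by omega)).trans hAC)

open Classical in
/-- The element with coefficients `side N - side (N S)`: the (signed) number of crossings of the
imaginary axis by the path from the triangle `N S (0, 1, ∞)` to the triangle `N (0, 1, ∞)`. -/
noncomputable def crossing (n : ℕ) (hn : 0 < n) : Alg :=
  ofFinite (fun N => if N ∈ matSet n then side N - side (N * incl Sg) else 0) (by
    refine (finite_side_mul_Sg_ne hn).subset fun N hN => ?_
    simp only [Function.mem_support, ne_eq, ite_eq_right_iff, Classical.not_imp] at hN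
    exact ⟨hN.1, fun h => hN.2 (by rw [h, sub_self])⟩)

open Classical in
/-- The element with coefficients `tri N`: the incidence of `N (0, 1, ∞)` with `(0, 1, ∞)`. -/
noncomputable def incidence (n : ℕ) (hn : 0 < n) : Alg :=
  ofFinite (fun N => if N ∈ matSet n then tri N else 0) (by
    refine (finite_tri_ne_zero hn).subset fun N hN => ?_
    simpa using hN)

open Classical in
theorem coeff_crossing {n : ℕ} (hn : 0 < n) (N : PMat) : (crossing n hn).coeff N =
    if N ∈ matSet n then side N - side (N * incl Sg) else 0 := rfl

open Classical in
theorem coeff_incidence {n : ℕ} (hn : 0 < n) (N : PMat) : (incidence n hn).coeff N =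
    if N ∈ matSet n then tri N else 0 := rfl

theorem crossing_mem {n : ℕ} (hn : 0 < n) : crossing n hn ∈ RnSub n := by
  intro N hN
  by_contra hc
  rw [coeff_crossing, if_neg hc] at hN
  exact hN rfl

theorem incidence_mem {n : ℕ} (hn : 0 < n) : incidence n hn ∈ RnSub n := by
  intro N hN
  by_contra hc
  rw [coeff_incidence, if_neg hc] at hN
  exact hN rfl

theorem alg_ext {x y : Alg} (h : ∀ N, x.coeff N = y.coeff N) : x = y :=
  MonoidAlgebra.coeff_injective (Finsupp.ext h)

theorem S_mul_crossing {n : ℕ} (hn : 0 < n) : S * crossing n hn = -crossing n hn := by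
  classical
  refine alg_ext fun N => ?_
  rw [coeff_S_mul, MonoidAlgebra.coeff_neg, Finsupp.neg_apply, coeff_crossing, coeff_crossing]
  simp only [incl_mul_mem, mul_assoc, side_Sg_mul]
  split_ifs <;> ring

theorem crossing_mul_S {n : ℕ} (hn : 0 < n) : crossing n hn * S = -crossing n hn := by
  classical
  refine alg_ext fun N => ?_
  rw [coeff_mul_S, MonoidAlgebra.coeff_neg, Finsupp.neg_apply, coeff_crossing, coeff_crossing]
  simp only [mul_incl_mem, mul_incl_Sg_sq]
  split_ifs <;> ring

theorem U_mul_incidence {n : ℕ} (hn : 0 < n) : U * incidence n hn = incidence n hn := by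
  classical
  refine alg_ext fun N => ?_
  rw [coeff_U_mul, coeff_incidence, coeff_incidence]
  simp only [incl_mul_mem, tri, incl_Ug_cube]
  split_ifs <;> ring

theorem tri_mul_Ug (N : PMat) : tri (N * incl Ug) = tri N := by
  simp only [tri, ← mul_assoc, side_mul_Ug]

theorem incidence_mul_U {n : ℕ} (hn : 0 < n) : incidence n hn * U = incidence n hn := by
  classical
  refine alg_ext fun N => ?_
  rw [U_eq, coeff_mul_of_incl, coeff_incidence, coeff_incidence]
  rw [← tri_mul_Ug (N * incl Ug⁻¹)]
  simp only [mul_incl_mem, mul_incl_inv_mul]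

theorem crossing_rotations {n : ℕ} (hn : 0 < n) :
    crossing n hn + U * crossing n hn + U * (U * crossing n hn) =
      incidence n hn - incidence n hn * S := by
  classical
  refine alg_ext fun N => ?_
  simp only [MonoidAlgebra.coeff_add, MonoidAlgebra.coeff_sub, Finsupp.add_apply,
    Finsupp.sub_apply, coeff_U_mul, coeff_mul_S, coeff_crossing, coeff_incidence, incl_mul_mem,
    mul_incl_mem, tri, mul_assoc, incl_Ug_cube]
  split_ifs <;> ring

theorem charFun_congr {𝓢 𝓢' : Set PMat} {N N' : PMat} (h : N ∈ 𝓢 ↔ N' ∈ 𝓢') :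
    charFun 𝓢 N = charFun 𝓢' N' := by
  simp only [charFun]
  split_ifs <;> tauto

theorem mul_incl_mem_leftCoset {M N : PMat} {γ : Gam} :
    N * incl γ ∈ leftCoset M ↔ N ∈ leftCoset (M * incl γ⁻¹) := by
  constructor
  · rintro ⟨γ', h⟩
    refine ⟨γ', ?_⟩
    simp only at h ⊢
    rw [← mul_assoc, h, mul_incl_mul_inv]
  · rintro ⟨γ', rfl⟩
    exact ⟨γ', by simp only; rw [mul_assoc, mul_incl_inv_mul]⟩

theorem incl_mul_mem_leftCoset {M N : PMat} {γ : Gam} :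
    incl γ * N ∈ leftCoset M ↔ N ∈ leftCoset M := by
  constructor
  · rintro ⟨γ', h⟩
    refine ⟨γ⁻¹ * γ', ?_⟩
    simp only at h ⊢
    rw [map_mul, mul_assoc, h, incl_inv_mul_mul]
  · rintro ⟨γ', rfl⟩
    exact ⟨γ * γ', by simp only; rw [map_mul, mul_assoc]⟩

theorem pairFun_crossing_leftCoset {n : ℕ} (hn : 0 < n) (M : PMat) :
    pairFun (charFun (leftCoset M)) (crossing n hn) = 0 := by
  have h := congrArg (pairFun (charFun (leftCoset M))) (S_mul_crossing hn)
  rw [S_eq, pairFun_of_mul, map_neg,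
    funext fun N => charFun_congr (incl_mul_mem_leftCoset (M := M) (N := N) (γ := Sg))] at h
  linarith

theorem pairFun_incidence_leftCoset {n : ℕ} (hn : 0 < n) {M : PMat} (hM : M ∈ matSet n) :
    pairFun (charFun (leftCoset M)) (incidence n hn) = 3 := by
  have hS : ∀ γ : Gam, side (incl (Sg * γ) * M) = 1 - side (incl γ * M) := by
    intro γ
    rw [map_mul, mul_assoc, side_Sg_mul]
  classical
  rw [← finsum_triangles hS (finite_side_ne hn hM), pairFun_eq_finsum]
  have h1 : ∀ N, (incidence n hn).coeff N * charFun (leftCoset M) N =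
      ∑ᶠ (_ : N ∈ Set.range fun γ : Gam => incl γ * M), tri N := by
    intro N
    by_cases hN : N ∈ leftCoset M
    · have hN' : N ∈ Set.range fun γ : Gam => incl γ * M := hN
      obtain ⟨γ, rfl⟩ := hN'
      rw [charFun, if_pos hN, coeff_incidence, if_pos (incl_mul_mem.mpr hM), mul_one,
        finsum_eq_if, if_pos ⟨γ, rfl⟩]
    · rw [charFun, if_neg hN, mul_zero, finsum_eq_if, if_neg (by exact hN)]
  rw [finsum_congr h1, finsum_mem_range fun _ _ h => incl_mul_left_inj hn hM h]
  refine finsum_congr fun γ => ?_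
  simp only [tri, map_mul, mul_assoc]

theorem three_mul_eq_smul (z : Alg) : 3 * z = (3 : ℚ) • z := by
  rw [Algebra.smul_def, map_ofNat]

theorem six_mul_eq_smul (z : Alg) : 6 * z = (6 : ℚ) • z := by
  rw [Algebra.smul_def, map_ofNat]

theorem sub_smul_leftSum_mem {n : ℕ} (hn : 0 < n) {c : ℚ} {δ : Alg} (hδ : δ ∈ RnSub n)
    (h : ∀ M ∈ matSet n, pairFun (charFun (leftCoset M)) δ = c) :
    δ - c • leftSum n ∈ augSub n := by
  have h1 := sub_sum_mem_augSub hn hδ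
  have h2 : ∑ i ∈ leftIndex n, pairFun (charFun (leftCoset (upperOf i))) δ •
      MonoidAlgebra.of ℚ PMat (upperOf i) = c • leftSum n := by
    rw [leftSum, Finset.smul_sum]
    exact Finset.sum_congr rfl fun i hi => by rw [h _ (upperOf_mem_of_left hn hi)]
  rwa [h2] at h1

/-- Six times the sum `T_n^∞` over the left cosets, modulo `(1 - S) 𝓡ₙ + (1 - U) 𝓡ₙ`. -/
theorem leftSum_decomposition {n : ℕ} (hn : 0 < n) : ∃ x ∈ RnSub n, ∃ y ∈ RnSub n, 6 * leftSum n =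
    3 * crossing n hn + incidence n hn * (1 + S) + 6 * ((1 - S) * x + (1 - U) * y) := by
  have h1S : 1 + S ∈ multipliers n := add_mem (one_mem _) (S_mem_multipliers n)
  have hmem : 3 * crossing n hn + incidence n hn * (1 + S) ∈ RnSub n :=
    add_mem (mul_mem_Rn (ofNat_mem _ 3) (crossing_mem hn)) (mem_Rn_mul h1S (incidence_mem hn))
  have hval : ∀ M ∈ matSet n, pairFun (charFun (leftCoset M))
      (3 * crossing n hn + incidence n hn * (1 + S)) = 6 := by
    intro M hM
    have h3 : pairFun (charFun (leftCoset M)) (incidence n hn * S) = 3 := by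
      rw [S_eq, pairFun_mul_of, funext fun N => charFun_congr
        (mul_incl_mem_leftCoset (M := M) (N := N) (γ := Sg))]
      exact pairFun_incidence_leftCoset hn (mul_incl_mem.mpr hM)
    rw [mul_add, mul_one, map_add, map_add, three_mul_eq_smul, map_smul,
      pairFun_crossing_leftCoset, pairFun_incidence_leftCoset hn hM, h3]
    norm_num
  obtain ⟨x, hx, y, hy, hxy⟩ := mem_augSub.mp (sub_smul_leftSum_mem hn hmem hval)
  refine ⟨(-1 / 6 : ℚ) • x, Submodule.smul_mem _ _ hx, (-1 / 6 : ℚ) • y,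
    Submodule.smul_mem _ _ hy, ?_⟩
  rw [six_mul_eq_smul, six_mul_eq_smul, mul_smul_comm, mul_smul_comm, ← smul_add, smul_smul,
    ← hxy]
  generalize 3 * crossing n hn + incidence n hn * (1 + S) = δ
  module

/-! ### The pairing of a solution with conjugacy classes and right cosets -/

/-- The two conditions of the theorem, with the standard choice of `T_n^∞`. -/
structure IsSolution (n : ℕ) (ξ : Alg) : Prop where
  mem : ξ ∈ RnSub n
  condA : ∃ ρ ∈ RnSub n, (1 - S) * ξ - leftSum n * (1 - S) = (1 - T) * ρ
  condB : CondB n ξ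

theorem isSolution_of_cond {n : ℕ} (hn : 0 < n) {R : Finset PMat} (hR : IsReprSet n R) {ξ : Alg}
    (hξ : ξ ∈ Rn n) (hA : CondA n R ξ) (hB : CondB n ξ) : IsSolution n ξ := by
  refine ⟨hξ, ?_, hB⟩
  obtain ⟨ρ, hρ, h1⟩ := hA
  obtain ⟨z, hz, h2⟩ := exists_Tinf_sub_leftSum hn hR
  refine ⟨ρ + z * (1 - S), add_mem hρ
    (mem_Rn_mul (sub_mem (one_mem _) (S_mem_multipliers n)) hz), ?_⟩
  linear_combination (norm := noncomm_ring) h1 + h2 * (1 - S)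

/-- The identities for `ρ` that are left after the factor `1 - T` has been cancelled. -/
theorem IsSolution.exists_rho {n : ℕ} (hn : 0 < n) {ξ : Alg} (h : IsSolution n ξ) :
    ∃ ρ ∈ RnSub n, (1 - S) * ξ - leftSum n * (1 - S) = (1 - U * S) * ρ ∧
      ρ * (1 + S) = -(S * ξ * (1 + S)) ∧
      ρ * (1 + U + U ^ 2) = rightSum n * S * (1 + U + U ^ 2) := by
  obtain ⟨ρ, hρ, h1⟩ := h.condA
  obtain ⟨⟨ρ₁, -, h2⟩, ⟨ρ₂, -, h3⟩⟩ := h.condB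
  have hC := leftSum_mul_one_sub_T n
  rw [T_eq_U_mul_S] at h1 hC
  have hS := S_mem_multipliers n
  have hU := U_mem_multipliers n
  have h1S : 1 + S ∈ multipliers n := add_mem (one_mem _) hS
  have h1U : 1 + U + U ^ 2 ∈ multipliers n := add_mem (add_mem (one_mem _) hU) (pow_mem hU 2)
  refine ⟨ρ, hρ, h1, ?_, ?_⟩
  · refine eq_neg_of_add_eq_zero_left (eq_zero_of_one_sub_T_mul hn ?_ ?_)
    · exact add_mem (mem_Rn_mul h1S hρ) (mem_Rn_mul h1S (mul_mem_Rn hS h.mem))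
    · rw [T_eq_U_mul_S]
      exact cancel_S S_mul_S U_mul_U_mul_U h1 h2
  · refine sub_eq_zero.mp (eq_zero_of_one_sub_T_mul hn ?_ ?_)
    · exact sub_mem (mem_Rn_mul h1U hρ) (mem_Rn_mul h1U (mem_Rn_mul hS (rightSum_mem hn)))
    · rw [T_eq_U_mul_S]
      exact cancel_U S_mul_S U_mul_U_mul_U h1 h3 hC

/-- The value of a trace on a solution: contributions of the cusps, the edges and the triangles of
the Farey tessellation. -/
theorem IsSolution.pairFun_conj {n : ℕ} (hn : 0 < n) {ξ : Alg} (h : IsSolution n ξ)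
    {φ : PMat → ℚ} (hφ : ∀ γ N, φ (incl γ * N) = φ (N * incl γ)) :
    pairFun φ ξ = pairFun φ (leftSum n) - pairFun φ (rightSum n) +
      pairFun φ (crossing n hn) / 2 - pairFun φ (incidence n hn) / 3 := by
  obtain ⟨ρ, hρ, hA, hρS, hρU⟩ := h.exists_rho hn
  obtain ⟨x, hx, y, -, hD⟩ := leftSum_decomposition hn
  have hC := leftSum_mul_one_sub_T n
  rw [T_eq_U_mul_S] at hC
  have hS := S_mem_multipliers n
  have hU := U_mem_multipliers n
  have hnum : ∀ k : ℕ, [k.AtLeastTwo] → (OfNat.ofNat k : Alg) ∈ multipliers n :=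
    fun k _ => ofNat_mem _ k
  refine trace_formula (pairFun φ) S_mul_S hA hC hD (S_mul_crossing hn) (crossing_mul_S hn)
    U_mul_U_mul_U (crossing_rotations hn) (U_mul_incidence hn) (incidence_mul_U hn) hρS hρU
    (one_sub_S_direct hn ?_) (one_sub_S_direct hn ?_) ?_ ?_
  · exact sub_mem (sub_mem (sub_mem (mul_mem_Rn (hnum 6) h.mem) (mul_mem_Rn (hnum 6) hρ))
      (mul_mem_Rn (hnum 3) (crossing_mem hn)))
      (mem_Rn_mul (sub_mem (one_mem _) hS) (mul_mem_Rn (hnum 6) hx))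
  · exact mul_mem_Rn (hnum 18) (sub_mem (add_mem (sub_mem h.mem hρ)
      (mem_Rn_mul hS (rightSum_mem hn))) (mem_Rn_mul (sub_mem (one_mem _) hU) hx))
  · intro z
    rw [S_eq, pairFun_of_mul, pairFun_mul_of]
    simp only [hφ]
  · intro z
    rw [U_eq, pairFun_of_mul, pairFun_mul_of]
    simp only [hφ]

theorem IsSolution.pairing_rightCoset {n : ℕ} (hn : 0 < n) {ξ : Alg} (h : IsSolution n ξ)
    {M : PMat} (hM : M ∈ matSet n) : pairing ξ (rightCoset M) = -1 := by
  obtain ⟨ρ, hρ, hA, hρS, hρU⟩ := h.exists_rho hn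
  have hmem : ∀ {K N : PMat} {γ : Gam}, N * incl γ ∈ rightCoset K ↔ N ∈ rightCoset K := by
    intro K N γ
    constructor
    · rintro ⟨γ', h⟩
      exact ⟨γ' * γ⁻¹, by rw [map_mul, ← mul_assoc, ← h, mul_incl_mul_inv]⟩
    · rintro ⟨γ', rfl⟩
      exact ⟨γ' * γ, by rw [map_mul, mul_assoc]⟩
  have hmemS : ∀ {N : PMat}, incl Sg * N ∈ rightCoset (incl Sg * M) ↔ N ∈ rightCoset M := by
    intro N
    constructor
    · rintro ⟨γ, h⟩
      refine ⟨γ, ?_⟩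
      rw [← incl_Sg_sq N, h, mul_assoc, incl_Sg_sq]
    · rintro ⟨γ, rfl⟩
      exact ⟨γ, by rw [mul_assoc]⟩
  have h1 := invariant_formula (pairFun (charFun (rightCoset (incl Sg * M)))) hρS hρU
    (fun z => by rw [S_eq, pairFun_mul_of, funext fun N => charFun_congr hmem])
    (fun z => by rw [U_eq, pairFun_mul_of, funext fun N => charFun_congr hmem])
  rw [S_eq, pairFun_of_mul, funext fun N => charFun_congr hmemS] at h1
  rw [pairing_eq_pairFun]
  refine h1.trans ?_
  obtain ⟨i, hi, γ, hγ⟩ := exists_right_index hn (incl_mul_mem.mpr hM : incl Sg * M ∈ matSet n)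
  rw [rightSum, map_sum, Finset.sum_eq_single i]
  · rw [pairFun_of, charFun, if_pos ⟨γ, hγ⟩]
  · intro j hj hji
    rw [pairFun_of, charFun, if_neg]
    rintro ⟨γ', h2⟩
    refine hji (right_index_unique hn hj hi (γ := γ'⁻¹ * γ) ?_)
    rw [map_mul, ← mul_assoc, h2, mul_incl_mul_inv, hγ]
  · intro h; exact absurd hi h

/-! ### Upper triangular matrices in a conjugacy class -/

theorem conj_mem_conjClass {M N : PMat} {γ : Gam} :
    incl γ * N * incl γ⁻¹ ∈ conjClass M ↔ N ∈ conjClass M := by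
  constructor
  · rintro ⟨γ', h⟩
    refine ⟨γ' * γ, ?_⟩
    rw [_root_.mul_inv_rev, map_mul, map_mul, mul_assoc, mul_assoc, ← mul_assoc M,
      ← mul_assoc (incl γ'⁻¹), ← mul_assoc (incl γ'⁻¹), ← h, mul_incl_inv_mul, incl_inv_mul_mul]
  · rintro ⟨γ', rfl⟩
    refine ⟨γ' * γ⁻¹, ?_⟩
    rw [_root_.mul_inv_rev, inv_inv, map_mul, map_mul]
    simp only [mul_assoc]

theorem self_mem_conjClass (M : PMat) : M ∈ conjClass M := ⟨1, by simp⟩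

theorem mul_mem_conjClass_comm {M N : PMat} {γ : Gam} :
    incl γ * N ∈ conjClass M ↔ N * incl γ ∈ conjClass M := by
  rw [← conj_mem_conjClass (N := N * incl γ) (γ := γ), mul_assoc, mul_assoc, incl_mul_inv, mul_one]

theorem conjClass_subset {n : ℕ} {M N : PMat} (hM : M ∈ matSet n) (hN : N ∈ conjClass M) :
    N ∈ matSet n := by
  obtain ⟨γ, rfl⟩ := hN
  exact mul_incl_mem.mpr (incl_mul_mem.mpr hM)

theorem exists_eigenvector {a b c d l : ℤ} (h : (l - a) * (l - d) = b * c) :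
    ∃ x y : ℤ, (x ≠ 0 ∨ y ≠ 0) ∧ a * x + b * y = l * x ∧ c * x + d * y = l * y := by
  by_cases h1 : b ≠ 0 ∨ l - a ≠ 0
  · exact ⟨b, l - a, h1, by ring, by linear_combination -h⟩
  · push Not at h1
    obtain ⟨rfl, h1⟩ := h1
    by_cases h2 : l - d ≠ 0 ∨ c ≠ 0
    · exact ⟨l - d, c, h2, by linear_combination -h1 * (l - d), by ring⟩
    · push Not at h2
      exact ⟨1, 0, Or.inl one_ne_zero, by linear_combination -h1, by linear_combination h2.2⟩

/-- A matrix with a rational eigenvalue is conjugate to an upper triangular matrix whose upper left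
entry is that eigenvalue. -/
theorem exists_upper_mem_conjClass {a b c d l : ℤ} (h : (l - a) * (l - d) = b * c) :
    ∃ b', upper l (a + d - l) b' ∈ conjClass (PMat.mk !![a, b; c, d]) := by
  obtain ⟨x, y, hxy, h1, h2⟩ := exists_eigenvector h
  obtain ⟨g, p, r, hg, rfl, rfl, q, s, hps⟩ := exists_primitive hxy
  have h3 : a * p + b * r = l * p := mul_left_cancel₀ hg (by linear_combination h1)
  have h4 : c * p + d * r = l * r := mul_left_cancel₀ hg (by linear_combination h2)
  refine ⟨s * (a * q + b * s) - q * (c * q + d * s), gamMk p q r s hps, ?_⟩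
  rw [incl_gamMk_inv, incl_gamMk, mk_mul_mk, mk_mul_mk, upper, mk_entries_eq_iff]
  left
  refine ⟨?_, ?_, ?_, ?_⟩
  · linear_combination -s * h3 + q * h4 - l * hps
  · ring
  · linear_combination r * h3 - p * h4
  · linear_combination s * h3 - q * h4 - (a + d - l) * hps

theorem upper_conj_Tpow (k a d b : ℤ) :
    incl (Tpow k) * upper a d b * incl (Tpow k)⁻¹ = upper a d (b + k * (d - a)) := by
  have : (Tpow k)⁻¹ = Tpow (-k) := by
    rw [inv_eq_iff_mul_eq_one, ← Tpow_add]
    simp [Tpow, gamMk_one]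
  rw [this, Tpow_mul_upper, upper_mul_Tpow]
  congr 1
  ring

theorem dvd_of_upper_conj {a d b b' : ℤ} (ha : 0 < a) (hd : 0 < d) (had : a ≠ d) {γ : Gam}
    (h : incl γ * upper a d b = upper a d b' * incl γ) : d - a ∣ b' - b := by
  obtain ⟨p, q, r, s, hps, rfl⟩ := exists_gamMk γ
  rw [incl_gamMk, upper, upper, mk_mul_mk, mk_mul_mk, mk_entries_eq_iff] at h
  rcases h with ⟨h1, h2, h3, h4⟩ | ⟨h1, h2, h3, h4⟩
  · have hr : r = 0 := by
      have : r * (a - d) = 0 := by linear_combination h3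
      exact (mul_eq_zero.mp this).resolve_right (sub_ne_zero.mpr had)
    subst hr
    refine ⟨p * q, ?_⟩
    have hs : s = p := by
      rcases Int.eq_one_or_neg_one_of_mul_eq_one (show p * s = 1 by linarith) with rfl | rfl <;>
        linarith
    subst hs
    linear_combination -s * h2 + (b - b') * hps
  · have hr : r = 0 := by
      have : r * (a + d) = 0 := by linear_combination h3
      exact (mul_eq_zero.mp this).resolve_right (by omega)
    subst hr
    have hp : p * (2 * a) = 0 := by linear_combination h1
    have hp : p = 0 := (mul_eq_zero.mp hp).resolve_right (by omega)
    subst hp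
    simp at hps

/-- For `a ≠ d`, every window of length `|a - d|` contains exactly one `b` for which `(a b; 0 d)`
lies in a given conjugacy class that contains some such matrix. -/
theorem existsUnique_upper_mem {M : PMat} {a d b₀ : ℤ} (ha : 0 < a) (hd : 0 < d) (had : a ≠ d)
    (h : upper a d b₀ ∈ conjClass M) (m : ℤ) :
    ∃! b, (m ≤ b ∧ b < m + |d - a|) ∧ upper a d b ∈ conjClass M := by
  have hne : d - a ≠ 0 := sub_ne_zero.mpr had.symm
  refine ⟨m + (b₀ - m) % (d - a), ⟨⟨?_, ?_⟩, ?_⟩, ?_⟩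
  · linarith [Int.emod_nonneg (b₀ - m) hne]
  · linarith [Int.emod_lt_abs (b₀ - m) hne]
  · rw [← conj_mem_conjClass (γ := Tpow (-((b₀ - m) / (d - a)))), upper_conj_Tpow] at h
    convert h using 2
    linear_combination Int.emod_add_mul_ediv (b₀ - m) (d - a)
  · rintro b ⟨⟨h1, h2⟩, γ₁, hb⟩
    obtain ⟨γ₀, h⟩ := h
    have hconj : d - a ∣ b - b₀ := by
      refine dvd_of_upper_conj ha hd had (γ := γ₁⁻¹ * γ₀) ?_
      rw [h, hb, map_mul]
      simp only [mul_assoc, incl_mul_inv_mul]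
    have h3 : (b₀ - m) % (d - a) = (b - m) % (d - a) :=
      Int.modEq_iff_dvd.mpr (by simpa using hconj)
    have h4 : (b - m) % (d - a) = b - m := by
      rw [← Int.emod_abs]
      exact Int.emod_eq_of_lt (by omega) (by omega)
    omega

open Classical in
theorem sum_upper_window {M : PMat} {a d : ℤ} (ha : 0 < a) (hd : 0 < d) {l k : ℕ}
    (hlk : l < k) (hwin : (k : ℤ) - l = |d - a|) :
    ∑ b ∈ Finset.Ico l k, charFun (conjClass M) (upper a d b) =
      if ∃ b, upper a d b ∈ conjClass M then 1 else 0 := by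
  have had : a ≠ d := by
    rintro rfl
    simp at hwin
    omega
  split_ifs with h
  · obtain ⟨b₀, hb₀⟩ := h
    obtain ⟨b, ⟨⟨h1, h2⟩, h3⟩, h4⟩ := existsUnique_upper_mem ha hd had hb₀ l
    lift b to ℕ using by omega
    rw [Finset.sum_eq_single b, charFun, if_pos h3]
    · intro b' hb' hne
      rw [charFun, if_neg]
      intro h5
      rw [Finset.mem_Ico] at hb'
      have := h4 b' ⟨⟨by omega, by omega⟩, h5⟩
      omega
    · intro hb
      rw [Finset.mem_Ico] at hb
      omega
  · refine Finset.sum_eq_zero fun b _ => ?_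
    rw [charFun, if_neg fun hb => h ⟨b, hb⟩]

theorem exists_upper_swap {M : PMat} {a d : ℤ} (h : ∃ b, upper a d b ∈ conjClass M) :
    ∃ b, upper d a b ∈ conjClass M := by
  obtain ⟨b, γ, hb⟩ := h
  obtain ⟨b', γ', hb'⟩ := exists_upper_mem_conjClass (a := a) (b := b) (c := 0) (d := d) (l := d)
    (by ring)
  rw [add_sub_cancel_right] at hb'
  change _ = incl γ'⁻¹ * upper a d b * incl γ' at hb'
  refine ⟨b', γ * γ', ?_⟩
  rw [hb', hb, map_mul, _root_.mul_inv_rev, map_mul]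
  simp only [mul_assoc]

theorem sum_range_sub_swap (M : PMat) {a d : ℕ} (ha : 0 < a) (hd : 0 < d) (h : a ≤ d) :
    ∑ b ∈ Finset.range d, charFun (conjClass M) (upper a d b) -
        ∑ b ∈ Finset.range a, charFun (conjClass M) (upper a d b) +
      (∑ b ∈ Finset.range a, charFun (conjClass M) (upper d a b) -
        ∑ b ∈ Finset.range d, charFun (conjClass M) (upper d a b)) = 0 := by
  classical
  rcases h.eq_or_lt with rfl | h
  · simp
  · have h1 := sum_upper_window (M := M) (a := a) (d := d) (by omega) (by omega) h
      (by rw [abs_of_pos (by omega)])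
    have h2 := sum_upper_window (M := M) (a := d) (d := a) (by omega) (by omega) h
      (by rw [abs_of_neg (by omega)]; ring)
    rw [Finset.sum_Ico_eq_sub _ h.le] at h1 h2
    rw [if_congr (Iff.intro exists_upper_swap exists_upper_swap) rfl rfl, ← h1] at h2
    linear_combination -h2

theorem pairFun_leftSum_conjClass {n : ℕ} (hn : 0 < n) (M : PMat) :
    pairFun (charFun (conjClass M)) (leftSum n) =
      pairFun (charFun (conjClass M)) (rightSum n) := by
  rw [leftSum_eq, rightSum_eq, ← sub_eq_zero]
  simp only [map_sum, pairFun_of]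
  rw [← Finset.sum_sub_distrib]
  set c : ℕ × ℕ → ℚ := fun x =>
    ∑ b ∈ Finset.range x.2, charFun (conjClass M) (upper x.1 x.2 b) -
      ∑ b ∈ Finset.range x.1, charFun (conjClass M) (upper x.1 x.2 b) with hc
  have hswap : ∑ x ∈ n.divisorsAntidiagonal, c x = ∑ x ∈ n.divisorsAntidiagonal, c x.swap :=
    Finset.sum_nbij' Prod.swap Prod.swap (fun x hx => Nat.swap_mem_divisorsAntidiagonal.mpr hx)
      (fun x hx => Nat.swap_mem_divisorsAntidiagonal.mpr hx) (fun _ _ => rfl) (fun _ _ => rfl)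
      (fun _ _ => rfl)
  have hzero : ∑ x ∈ n.divisorsAntidiagonal, (c x + c x.swap) = 0 := by
    refine Finset.sum_eq_zero fun x hx => ?_
    obtain ⟨a, d⟩ := x
    have had := (Nat.mem_divisorsAntidiagonal.mp hx).1
    simp only at had
    have ha : 0 < a := Nat.pos_of_mul_pos_right (had ▸ hn)
    have hd : 0 < d := Nat.pos_of_mul_pos_left (had ▸ hn)
    rcases le_total a d with h | h
    · exact sum_range_sub_swap M ha hd h
    · rw [add_comm]
      exact sum_range_sub_swap M hd ha h
  rw [Finset.sum_add_distrib, ← hswap] at hzero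
  change ∑ x ∈ n.divisorsAntidiagonal, c x = 0
  linarith

/-! ### The fixed points of a matrix and the imaginary axis -/

/-- For `α = c`, `β = -b`, `η = c + d - a - b` and `t = a + d`, the sign that tells on which side of
the geodesic from `0` to `∞` the matrix `(a b; c d)` has its fixed points. If `b c < 0`, the real
parts of the fixed points have one sign, that of `(a - d) c`. If `b c > 0`, there are two real fixed
points of opposite signs, and the attracting one decides. The choice for `b c = 0` extends this in
such a way that `fixSign_swap` holds. -/
def fixSign (α β η t : ℤ) : ℤ :=
  if 0 < α * β then ((α + β - η) * α).sign
  else if α = 0 ∧ β = 0 then (-η * t).sign else (t * (α - β)).sign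

theorem fixSign_neg (α β η t : ℤ) : fixSign (-α) (-β) (-η) (-t) = fixSign α β η t := by
  simp only [fixSign, neg_eq_zero]
  ring_nf

/-- Conjugation by `S` exchanges the two sides. -/
theorem fixSign_swap (α β η t : ℤ) :
    fixSign β α (2 * (α + β) - η) t = -fixSign α β η t := by
  simp only [fixSign, mul_comm β α, and_comm (a := β = 0)]
  split_ifs with h1 h2
  · rw [← Int.sign_neg]
    rcases pos_and_pos_or_neg_and_neg_of_mul_pos h1 with ⟨ha, hb⟩ | ⟨ha, hb⟩
    · rw [Int.sign_mul, ← neg_mul, Int.sign_mul, Int.sign_eq_one_of_pos ha,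
        Int.sign_eq_one_of_pos hb]
      ring_nf
    · rw [Int.sign_mul, ← neg_mul, Int.sign_mul, Int.sign_eq_neg_one_of_neg ha,
        Int.sign_eq_neg_one_of_neg hb]
      ring_nf
  · rw [← Int.sign_neg, h2.1, h2.2]
    ring_nf
  · rw [← Int.sign_neg]
    ring_nf

/-- `1` if the fixed points of a matrix lie on the right of the geodesic from `0` to `∞`, `0` if
they lie on the left, and `1/2` if they lie on it, with the conventions of `fixSign`. -/
def fixSide (N : PMat) : ℚ :=
  Quotient.lift (fun A : Matrix (Fin 2) (Fin 2) ℤ =>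
    (1 + (fixSign (A 1 0) (-A 0 1) (A 1 0 + A 1 1 - A 0 0 - A 0 1) (A 0 0 + A 1 1) : ℚ)) / 2) (by
    rintro A B (rfl | rfl)
    · rfl
    · rw [← fixSign_neg]
      simp only [Matrix.neg_apply]
      ring_nf) N

theorem fixSide_mk (a b c d : ℤ) : fixSide (PMat.mk !![a, b; c, d]) =
    (1 + (fixSign c (-b) (c + d - a - b) (a + d) : ℚ)) / 2 := rfl

theorem Sg_conj_mk (a b c d : ℤ) : incl Sg * PMat.mk !![a, b; c, d] * incl Sg⁻¹ =
    PMat.mk !![d, -c; -b, a] := by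
  rw [Sg_inv, Sg_mul_mk, mk_mul_Sg, mk_entries_eq_iff]
  right
  simp

theorem Ug_conj_mk (a b c d : ℤ) : incl Ug * PMat.mk !![a, b; c, d] * incl Ug⁻¹ =
    PMat.mk !![d - b, a + b - c - d; -b, a + b] := by
  rw [Ug_mul_mk, mk_mul_Ug_inv]
  congr 3
  ring_nf

theorem fixSide_Sg_conj (N : PMat) :
    fixSide (incl Sg * N * incl Sg⁻¹) = 1 - fixSide N := by
  obtain ⟨a, b, c, d, rfl⟩ := exists_mk_entries N
  have := fixSign_swap c (-b) (c + d - a - b) (a + d)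
  rw [Sg_conj_mk, fixSide_mk, fixSide_mk, neg_neg, add_comm d a,
    show -b + a - d - -c = 2 * (c + -b) - (c + d - a - b) by ring, this]
  push_cast
  ring

/-- The conjugate of `N` by `U`. -/
def rot (N : PMat) : PMat := incl Ug * N * incl Ug⁻¹

theorem rot_mk (a b c d : ℤ) :
    rot (PMat.mk !![a, b; c, d]) = PMat.mk !![d - b, a + b - c - d; -b, a + b] :=
  Ug_conj_mk a b c d

/-- The number of sides of the triangle `0, 1, ∞` that have the fixed points of `N` on the side of
the triangle, minus two. -/
def fixTri (N : PMat) : ℚ := fixSide N + fixSide (rot N) + fixSide (rot (rot N)) - 2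

theorem fixTri_mk (a b c d : ℤ) : fixTri (PMat.mk !![a, b; c, d]) =
    ((fixSign c (-b) (c + d - a - b) (a + d) + fixSign (-b) (c + d - a - b) c (a + d) +
      fixSign (c + d - a - b) c (-b) (a + d) - 1 : ℤ) : ℚ) / 2 := by
  rw [fixTri, rot_mk, rot_mk, fixSide_mk, fixSide_mk, fixSide_mk]
  push_cast
  ring_nf

/-- `1` for a matrix that fixes `∞` as attracting point and has its other fixed point in `(0, 1]`,
and `0` for all others, in the parameters of `fixSign`. -/
def corner (α β η t : ℤ) : ℤ := if α = 0 ∧ 0 < t * β ∧ t * η ≤ 0 then 1 else 0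

theorem corner_neg (α β η t : ℤ) : corner (-α) (-β) (-η) (-t) = corner α β η t := by
  simp only [corner, neg_eq_zero, neg_mul_neg]

theorem fixSign_cases (α β η : ℤ) {t : ℤ} (ht : 0 < t) :
    (0 < α ∧ 0 < β ∧ fixSign α β η t = (α + β - η).sign) ∨
    (α < 0 ∧ β < 0 ∧ fixSign α β η t = -(α + β - η).sign) ∨
    (α = 0 ∧ β = 0 ∧ fixSign α β η t = -η.sign) ∨
    (0 ≤ α ∧ β ≤ 0 ∧ β < α ∧ fixSign α β η t = 1) ∨
    (α ≤ 0 ∧ 0 ≤ β ∧ α < β ∧ fixSign α β η t = -1) := by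
  by_cases h : 0 < α * β
  · rw [fixSign, if_pos h, Int.sign_mul]
    rcases pos_and_pos_or_neg_and_neg_of_mul_pos h with ⟨h1, h2⟩ | ⟨h1, h2⟩
    · exact Or.inl ⟨h1, h2, by rw [Int.sign_eq_one_of_pos h1, mul_one]⟩
    · exact Or.inr (Or.inl ⟨h1, h2, by rw [Int.sign_eq_neg_one_of_neg h1, mul_neg_one]⟩)
  · rw [fixSign, if_neg h]
    split_ifs with h0
    · refine Or.inr (Or.inr (Or.inl ⟨h0.1, h0.2, ?_⟩))
      rw [Int.sign_mul, Int.sign_eq_one_of_pos ht, mul_one, Int.sign_neg]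
    · rw [Int.sign_mul, Int.sign_eq_one_of_pos ht, one_mul]
      rcases mul_nonpos_iff.mp (not_lt.mp h) with ⟨h1, h2⟩ | ⟨h1, h2⟩
      · have h3 : β < α := by omega
        exact Or.inr (Or.inr (Or.inr (Or.inl ⟨h1, h2, h3, Int.sign_eq_one_of_pos (by omega)⟩)))
      · have h3 : α < β := by omega
        exact Or.inr (Or.inr (Or.inr (Or.inr ⟨h1, h2, h3,
          Int.sign_eq_neg_one_of_neg (by omega)⟩)))

theorem corner_cases (α β η : ℤ) {t : ℤ} (ht : 0 < t) :
    (α = 0 ∧ 0 < β ∧ η ≤ 0 ∧ corner α β η t = 1) ∨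
      (¬ (α = 0 ∧ 0 < β ∧ η ≤ 0) ∧ corner α β η t = 0) := by
  have h1 : t * η ≤ 0 ↔ η ≤ 0 := by rw [← not_lt, mul_pos_iff_of_pos_left ht, not_lt]
  simp only [corner, mul_pos_iff_of_pos_left ht, h1]
  split_ifs with h
  · exact Or.inl ⟨h.1, h.2.1, h.2.2, rfl⟩
  · exact Or.inr ⟨h, rfl⟩

theorem sign_cases (x : ℤ) :
    (0 < x ∧ x.sign = 1) ∨ (x = 0 ∧ x.sign = 0) ∨ (x < 0 ∧ x.sign = -1) := by
  rcases lt_trichotomy x 0 with h | h | h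
  · exact Or.inr (Or.inr ⟨h, Int.sign_eq_neg_one_of_neg h⟩)
  · exact Or.inr (Or.inl ⟨h, by simp [h]⟩)
  · exact Or.inl ⟨h, Int.sign_eq_one_of_pos h⟩

/-- If the discriminant is not negative then exactly one of the three differences is negative. -/
theorem obtuse {α β η : ℤ} (hα : 0 < α) (hβ : 0 < β) (hη : 0 < η)
    (hd : 0 ≤ (α + β - η) ^ 2 - 4 * (α * β)) :
    (α + β - η < 0 ∧ 0 < β + η - α ∧ 0 < η + α - β) ∨
    (0 < α + β - η ∧ β + η - α < 0 ∧ 0 < η + α - β) ∨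
    (0 < α + β - η ∧ 0 < β + η - α ∧ η + α - β < 0) := by
  have h : (α + β - η) * (β + η - α) + (β + η - α) * (η + α - β) +
      (η + α - β) * (α + β - η) ≤ 0 := by linarith
  rcases lt_or_ge (α + β - η) 0 with h1 | h1
  · exact Or.inl ⟨h1, by omega, by omega⟩
  rcases lt_or_ge (β + η - α) 0 with h2 | h2
  · exact Or.inr (Or.inl ⟨by omega, h2, by omega⟩)
  rcases lt_or_ge (η + α - β) 0 with h3 | h3
  · exact Or.inr (Or.inr ⟨by omega, by omega, h3⟩)
  nlinarith [mul_nonneg h1 h2, mul_nonneg h2 h3, mul_nonneg h3 h1]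

/-- The parameters of the conjugates by `U` and `U²` arise by rotation of `α`, `β`, `η`. -/
theorem fixSign_sum_of_pos {α β η t : ℤ} (ht : 0 < t) (h0 : α ≠ 0 ∨ β ≠ 0 ∨ η ≠ 0)
    (hd : 0 ≤ (α + β - η) ^ 2 - 4 * (α * β)) :
    fixSign α β η t + fixSign β η α t + fixSign η α β t - 1 =
      -2 * (corner α β η t + corner β η α t + corner η α β t) := by
  have f1 := fixSign_cases α β η ht
  have f2 := fixSign_cases β η α ht
  have f3 := fixSign_cases η α β ht
  have c1 := corner_cases α β η ht
  have c2 := corner_cases β η α ht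
  have c3 := corner_cases η α β ht
  have s1 := sign_cases (α + β - η)
  have s2 := sign_cases (β + η - α)
  have s3 := sign_cases (η + α - β)
  have s4 := sign_cases α
  have s5 := sign_cases β
  have s6 := sign_cases η
  have o : (α ≤ 0 ∨ β ≤ 0 ∨ η ≤ 0 ∨ (α + β - η < 0 ∧ 0 < β + η - α ∧ 0 < η + α - β) ∨
      (0 < α + β - η ∧ β + η - α < 0 ∧ 0 < η + α - β) ∨
      (0 < α + β - η ∧ 0 < β + η - α ∧ η + α - β < 0)) ∧
      (0 ≤ α ∨ 0 ≤ β ∨ 0 ≤ η ∨ (0 < α + β - η ∧ β + η - α < 0 ∧ η + α - β < 0) ∨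
      (α + β - η < 0 ∧ 0 < β + η - α ∧ η + α - β < 0) ∨
      (α + β - η < 0 ∧ β + η - α < 0 ∧ 0 < η + α - β)) := by
    constructor
    · by_contra hc
      have := obtuse (α := α) (β := β) (η := η) (by omega) (by omega) (by omega) hd
      omega
    · by_contra hc
      have := obtuse (α := -α) (β := -β) (η := -η) (by omega) (by omega) (by omega) (by linarith)
      omega
  clear hd
  rcases f1 with f1 | f1 | f1 | f1 | f1 <;> rcases f2 with f2 | f2 | f2 | f2 | f2 <;>
    try (exfalso; clear f3 c1 c2 c3 s1 s2 s3 s4 s5 s6 o; omega)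
  all_goals
    rcases f3 with f3 | f3 | f3 | f3 | f3 <;>
      first
      | (exfalso; clear c1 c2 c3 s1 s2 s3 s4 s5 s6 o; omega)
      | (clear o; omega)
      | omega

theorem fixSign_sum {α β η t : ℤ} (ht : t ≠ 0) (h0 : α ≠ 0 ∨ β ≠ 0 ∨ η ≠ 0)
    (hd : 0 ≤ (α + β - η) ^ 2 - 4 * (α * β)) :
    fixSign α β η t + fixSign β η α t + fixSign η α β t - 1 =
      -2 * (corner α β η t + corner β η α t + corner η α β t) := by
  rcases ht.lt_or_gt with ht | ht
  · rw [← fixSign_neg α, ← fixSign_neg β, ← fixSign_neg η, ← corner_neg α, ← corner_neg β,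
      ← corner_neg η]
    exact fixSign_sum_of_pos (by omega) (by omega) (by linarith)
  · exact fixSign_sum_of_pos ht h0 hd

theorem abs_le_abs_mul {b c : ℤ} (hc : c ≠ 0) : |b| ≤ |b * c| := by
  rw [abs_mul]
  exact le_mul_of_one_le_right (abs_nonneg b) (Int.one_le_abs hc)

/-- For the matrices with a vanishing entry off the diagonal. -/
theorem sign_two_mul_add {b d n : ℤ} (hd : d ≠ 0) (hn : 0 < n) (hb : n < |b|) :
    (2 * (b * d) + n).sign = (b * d).sign := by
  have h := hb.trans_le (abs_le_abs_mul hd)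
  rcases lt_abs.mp h with h | h
  · rw [Int.sign_eq_one_of_pos (by omega), Int.sign_eq_one_of_pos (by omega)]
  · rw [Int.sign_eq_neg_one_of_neg (by omega), Int.sign_eq_neg_one_of_neg (by omega)]

/-- For the matrices with `a d < 0`, `b c < 0`: the three summands of `rhoForm` agree in sign unless
the entries are bounded by the determinant. -/
theorem le_of_crossed {a b c d n : ℤ} (ha : 0 < a) (hb : 0 < b) (hc : 0 < c) (hd : 0 < d)
    (hn : 0 < n) (h : b * c - a * d = n) (h1 : (a - b) * (c - d) < 0) :
    a ≤ n ∧ b ≤ n ∧ c ≤ n ∧ d ≤ n := by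
  have h2 : a < b ∧ d < c := by
    rcases mul_neg_iff.mp h1 with h2 | h2
    · nlinarith
    · omega
  obtain ⟨x, rfl⟩ : ∃ x, b = a + x := ⟨b - a, by ring⟩
  obtain ⟨y, rfl⟩ : ∃ y, c = d + y := ⟨c - d, by ring⟩
  have hx : 0 < x := by omega
  have hy : 0 < y := by omega
  have h3 := mul_pos hx hy
  have h4 : a ≤ a * y := le_mul_of_one_le_right ha.le hy
  have h5 : d ≤ d * x := le_mul_of_one_le_right hd.le hx
  have h6 : x ≤ d * x := le_mul_of_one_le_left hx.le hd
  have h7 : y ≤ a * y := le_mul_of_one_le_left hy.le ha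
  have h8 : a * y + d * x + x * y = n := by linear_combination h
  omega

/-- A matrix whose triangle `N (0, 1, ∞)` and fixed points lie on different sides of the geodesic
from `0` to `∞` has entries bounded in terms of its determinant and its trace. -/
theorem abs_entries_le {a b c d n s : ℤ} (h : a * d - b * c = n) (hn : 0 < n)
    (hs : (a + d) ^ 2 = s) (hne : (2 * (a * c + b * d) + a * d + b * c).sign ≠
      fixSign c (-b) (c + d - a - b) (a + d)) :
    |a| ≤ s + 2 * n ∧ |b| ≤ s + 2 * n ∧ |c| ≤ s + 2 * n ∧ |d| ≤ s + 2 * n := by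
  have hs0 : 0 ≤ s := hs ▸ sq_nonneg _
  rcases le_or_gt 0 (a * d) with had | had
  · have ha : |a| ≤ s + 2 * n := abs_le_of_sq_le (by nlinarith)
    have hd : |d| ≤ s + 2 * n := abs_le_of_sq_le (by nlinarith)
    by_cases hb0 : b = 0
    · subst hb0
      have ha0 : a ≠ 0 := by rintro rfl; simp at h; omega
      refine ⟨ha, by simp; omega, ?_, hd⟩
      by_contra hc
      refine hne ?_
      have hc0 : c ≠ 0 := by rintro rfl; simp at hc; omega
      have h1 : (a + d).sign = a.sign := sign_eq_of_mul_pos (by nlinarith [sq_nonneg a])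
      rw [fixSign, if_neg (by simp), if_neg (by simp [hc0]), Int.sign_mul, h1, neg_zero, sub_zero,
        ← Int.sign_mul, mul_comm a c, ← sign_two_mul_add ha0 hn (by omega : n < |c|)]
      congr 1
      linear_combination h
    by_cases hc0 : c = 0
    · subst hc0
      have hd0 : d ≠ 0 := by rintro rfl; simp at h; omega
      refine ⟨ha, ?_, by simp; omega, hd⟩
      by_contra hb
      refine hne ?_
      have h1 : (a + d).sign = d.sign := sign_eq_of_mul_pos (by nlinarith [sq_nonneg d])
      rw [fixSign, if_neg (by simp), if_neg (by simp [hb0]), Int.sign_mul, h1, zero_sub, neg_neg,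
        ← Int.sign_mul, mul_comm d b, ← sign_two_mul_add hd0 hn (by omega : n < |b|)]
      congr 1
      linear_combination h
    have hbc : |b * c| ≤ s + 2 * n := by
      rw [abs_le]
      constructor <;> nlinarith [sq_nonneg (a - d)]
    exact ⟨ha, (abs_le_abs_mul hc0).trans hbc,
      (abs_le_abs_mul hb0).trans (by rwa [mul_comm c b]), hd⟩
  · have hbc : b * c < 0 := by omega
    rw [fixSign, if_pos (by linarith : 0 < c * -b),
      show (c + -b - (c + d - a - b)) * c = (a - d) * c by ring] at hne
    have hQ : 2 * (a * c + b * d) + a * d + b * c = a * c + b * d + (a + b) * (c + d) := by ring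
    rw [hQ] at hne
    rcases mul_neg_iff.mp had with ⟨ha, hd⟩ | ⟨ha, hd⟩ <;>
      rcases mul_neg_iff.mp hbc with ⟨hb, hc⟩ | ⟨hb, hc⟩
    · refine absurd ?_ hne
      rw [Int.sign_eq_neg_one_of_neg, Int.sign_eq_neg_one_of_neg]
      · exact mul_neg_of_pos_of_neg (by omega) hc
      · have h1 := mul_neg_of_pos_of_neg ha hc
        have h2 := mul_neg_of_pos_of_neg hb hd
        have h3 := mul_neg_of_pos_of_neg (by omega : 0 < a + b) (by omega : c + d < 0)
        omega
    · have h1 := mul_pos ha hc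
      have h2 := mul_pos_of_neg_of_neg hb hd
      have h3 : (a - -b) * (c - -d) < 0 := by
        rw [sub_neg_eq_add, sub_neg_eq_add]
        by_contra hc'
        refine hne ?_
        rw [Int.sign_eq_one_of_pos, Int.sign_eq_one_of_pos]
        · exact mul_pos (by omega) hc
        · omega
      have h4 := le_of_crossed ha (neg_pos.mpr hb) hc (neg_pos.mpr hd) hn (by linarith) h3
      simp only [abs_le]
      omega
    · have h1 := mul_pos_of_neg_of_neg ha hc
      have h2 := mul_pos hb hd
      have h3 : (-a - b) * (-c - d) < 0 := by
        by_contra hc'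
        refine hne ?_
        rw [Int.sign_eq_one_of_pos, Int.sign_eq_one_of_pos]
        · exact mul_pos_of_neg_of_neg (by omega) hc
        · have : (-a - b) * (-c - d) = (a + b) * (c + d) := by ring
          omega
      have h4 := le_of_crossed (neg_pos.mpr ha) hb (neg_pos.mpr hc) hd hn (by linarith) h3
      simp only [abs_le]
      omega
    · refine absurd ?_ hne
      rw [Int.sign_eq_neg_one_of_neg, Int.sign_eq_neg_one_of_neg]
      · exact mul_neg_of_neg_of_pos (by omega) hc
      · have h1 := mul_neg_of_neg_of_pos ha hc
        have h2 := mul_neg_of_neg_of_pos hb hd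
        have h3 := mul_neg_of_neg_of_pos (by omega : a + b < 0) (by omega : 0 < c + d)
        omega

theorem trSq_mk_entries (a b c d : ℤ) : (PMat.mk !![a, b; c, d]).trSq = (a + d) ^ 2 := by
  rw [trSq_mk, Matrix.trace_fin_two_of]

theorem trSq_conj (γ : Gam) (N : PMat) : (incl γ * N * incl γ⁻¹).trSq = N.trSq := by
  obtain ⟨p, q, r, s, h, rfl⟩ := exists_gamMk γ
  obtain ⟨a, b, c, d, rfl⟩ := exists_mk_entries N
  rw [incl_gamMk, incl_gamMk_inv, mk_mul_mk, mk_mul_mk, trSq_mk_entries, trSq_mk_entries]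
  congr 1
  linear_combination (a + d) * h

theorem trSq_of_mem_conjClass {M N : PMat} (h : N ∈ conjClass M) : N.trSq = M.trSq := by
  obtain ⟨γ, rfl⟩ := h
  rw [← trSq_conj γ⁻¹ M, inv_inv]

theorem finite_side_ne_fixSide {n : ℕ} (hn : 0 < n) {M : PMat} (hM : M ∈ matSet n) :
    {N | N ∈ conjClass M ∧ side N ≠ fixSide N}.Finite := by
  refine (finite_of_bounded (M.trSq + 2 * n)).subset ?_
  rintro N ⟨hN, hne⟩
  have hdet := conjClass_subset hM hN
  have htr := trSq_of_mem_conjClass hN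
  obtain ⟨a, b, c, d, rfl⟩ := exists_mk_entries N
  rw [mem_matSet_mk] at hdet
  rw [trSq_mk_entries] at htr
  obtain ⟨h1, h2, h3, h4⟩ := abs_entries_le hdet (by exact_mod_cast hn) htr (fun h => hne (by
    rw [side_mk, fixSide_mk, h]))
  refine ⟨_, rfl, ?_⟩
  intro i j
  fin_cases i <;> fin_cases j
  · exact h1
  · exact h2
  · exact h3
  · exact h4

/-! ### The contribution of the triangles as a sum over fixed points -/

/-- Conjugation by an element of `Γ`. -/
def conjEquiv (γ : Gam) : PMat ≃ PMat where
  toFun N := incl γ * N * incl γ⁻¹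
  invFun N := incl γ⁻¹ * N * incl γ
  left_inv N := by simp only [mul_assoc, incl_inv_mul_mul, incl_inv_mul, mul_one]
  right_inv N := by simp only [mul_assoc, incl_mul_inv_mul, incl_mul_inv, mul_one]

/-- The sum of a function over a conjugacy class. -/
noncomputable def classSum (M : PMat) (f : PMat → ℚ) : ℚ := ∑ᶠ N, charFun (conjClass M) N * f N

theorem classSum_conj (M : PMat) (γ : Gam) (f : PMat → ℚ) :
    classSum M (fun N => f (incl γ * N * incl γ⁻¹)) = classSum M f := by
  refine (finsum_congr fun N => ?_).trans
    (finsum_comp_equiv (f := fun N => charFun (conjClass M) N * f N) (conjEquiv γ))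
  change _ = charFun (conjClass M) (incl γ * N * incl γ⁻¹) * f (incl γ * N * incl γ⁻¹)
  rw [charFun_congr (conj_mem_conjClass (M := M) (N := N) (γ := γ))]

/-- `f` is nonzero at finitely many elements of the class of `M` only. -/
def FinOn (M : PMat) (f : PMat → ℚ) : Prop :=
  (Function.support fun N => charFun (conjClass M) N * f N).Finite

theorem finOn_of_subset {M : PMat} {f : PMat → ℚ} (h : {N | N ∈ conjClass M ∧ f N ≠ 0}.Finite) :
    FinOn M f := by
  refine h.subset fun N hN => ?_
  rw [Function.mem_support, charFun] at hN
  by_cases h1 : N ∈ conjClass M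
  · rw [if_pos h1, one_mul] at hN
    exact ⟨h1, hN⟩
  · simp [h1] at hN

theorem FinOn.conj {M : PMat} {f : PMat → ℚ} (h : FinOn M f) (γ : Gam) :
    FinOn M fun N => f (incl γ * N * incl γ⁻¹) := by
  refine (h.preimage (conjEquiv γ).injective.injOn).subset fun N hN => ?_
  change charFun (conjClass M) (incl γ * N * incl γ⁻¹) * f (incl γ * N * incl γ⁻¹) ≠ 0
  rwa [charFun_congr (conj_mem_conjClass (M := M) (N := N) (γ := γ))]

theorem FinOn.add {M : PMat} {f g : PMat → ℚ} (hf : FinOn M f) (hg : FinOn M g) :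
    FinOn M fun N => f N + g N := by
  refine (hf.union hg).subset fun N hN => ?_
  rw [Function.mem_support, mul_add] at hN
  by_contra hc
  simp only [Set.mem_union, Function.mem_support, not_or, not_not] at hc
  exact hN (by rw [hc.1, hc.2, add_zero])

theorem FinOn.neg {M : PMat} {f : PMat → ℚ} (hf : FinOn M f) : FinOn M fun N => -f N := by
  refine hf.subset fun N hN => ?_
  rw [Function.mem_support, mul_neg, neg_ne_zero] at hN
  exact hN

theorem classSum_add {M : PMat} {f g : PMat → ℚ} (hf : FinOn M f) (hg : FinOn M g) :
    classSum M (fun N => f N + g N) = classSum M f + classSum M g := by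
  rw [classSum, classSum, classSum, ← finsum_add_distrib hf hg]
  exact finsum_congr fun N => mul_add _ _ _

theorem classSum_congr {M : PMat} {f g : PMat → ℚ} (h : ∀ N ∈ conjClass M, f N = g N) :
    classSum M f = classSum M g := by
  refine finsum_congr fun N => ?_
  rw [charFun]
  split_ifs with hN
  · rw [h N hN]
  · rw [zero_mul, zero_mul]

theorem pairFun_conjClass {M : PMat} {ξ : Alg} {f : PMat → ℚ}
    (h : ∀ N ∈ conjClass M, ξ.coeff N = f N) :
    pairFun (charFun (conjClass M)) ξ = classSum M f := by
  rw [pairFun_eq_finsum]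
  refine (finsum_congr fun N => mul_comm _ _).trans (classSum_congr h)

theorem side_mul_Sg (N : PMat) : side (N * incl Sg) = 1 - side (incl Sg * N * incl Sg⁻¹) := by
  rw [Sg_inv, mul_assoc, side_Sg_mul]
  ring

theorem side_mul_Ug_inv (N : PMat) : side (N * incl Ug⁻¹) = side N := by
  rw [← side_mul_Ug (N * incl Ug⁻¹), mul_incl_inv_mul]

theorem tri_eq_rot (N : PMat) : tri N = side N + side (rot N) + side (rot (rot N)) - 2 := by
  have : incl Ug * (incl Ug * N * incl Ug⁻¹) = incl Ug * (incl Ug * N) * incl Ug⁻¹ := by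
    simp only [mul_assoc]
  rw [rot, rot, side_mul_Ug_inv, side_mul_Ug_inv, this, side_mul_Ug_inv, tri]

/-- The difference `side - fixSide` contributes twice its sum over the class to the first term,
three times that sum to the second, and hence nothing in total. -/
theorem crossing_sub_incidence {n : ℕ} (hn : 0 < n) {M : PMat} (hM : M ∈ matSet n) :
    pairFun (charFun (conjClass M)) (crossing n hn) / 2 -
      pairFun (charFun (conjClass M)) (incidence n hn) / 3 = -classSum M fixTri / 3 := by
  classical
  set f : PMat → ℚ := fun N => side N - fixSide N with hf
  have hfin : FinOn M f := finOn_of_subset <| (finite_side_ne_fixSide hn hM).subset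
    fun N hN => ⟨hN.1, fun h => hN.2 (by rw [hf]; simp only [h, sub_self])⟩
  have hfS := hfin.conj Sg
  have hfU : FinOn M fun N => f (rot N) := hfin.conj Ug
  have hfUU : FinOn M fun N => f (rot (rot N)) := hfU.conj Ug
  have hsU : classSum M (fun N => f (rot N)) = classSum M f := classSum_conj M Ug f
  have hsUU : classSum M (fun N => f (rot (rot N))) = classSum M f :=
    (classSum_conj M Ug fun N => f (rot N)).trans hsU
  have h1 : pairFun (charFun (conjClass M)) (crossing n hn) = 2 * classSum M f := by
    rw [pairFun_conjClass (f := fun N => f N + f (incl Sg * N * incl Sg⁻¹)),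
      classSum_add hfin hfS, classSum_conj, two_mul]
    intro N hN
    rw [coeff_crossing, if_pos (conjClass_subset hM hN), side_mul_Sg]
    simp only [hf, fixSide_Sg_conj]
    ring
  have htri : FinOn M tri := by
    refine finOn_of_subset <| (finite_tri_ne_zero hn).subset fun N hN =>
      ⟨conjClass_subset hM hN.1, hN.2⟩
  have h3 : FinOn M fun N => f N + f (rot N) + f (rot (rot N)) := (hfin.add hfU).add hfUU
  have h2 : pairFun (charFun (conjClass M)) (incidence n hn) =
      3 * classSum M f + classSum M fixTri := by
    have h4 : FinOn M fixTri := by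
      have := htri.add h3.neg
      convert this using 2 with N
      rw [tri_eq_rot, fixTri]
      simp only [hf]
      ring
    rw [pairFun_conjClass (f := fun N => (f N + f (rot N) + f (rot (rot N))) + fixTri N),
      classSum_add h3 h4, classSum_add (hfin.add hfU) hfUU, classSum_add hfin hfU, hsU, hsUU]
    · ring
    · intro N hN
      rw [coeff_incidence, if_pos (conjClass_subset hM hN), tri_eq_rot, fixTri]
      simp only [hf]
      ring
  rw [h1, h2]
  ring

theorem IsSolution.pairing_conjClass {n : ℕ} (hn : 0 < n) {ξ : Alg} (h : IsSolution n ξ)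
    {M : PMat} (hM : M ∈ matSet n) :
    pairing ξ (conjClass M) = -classSum M fixTri / 3 := by
  rw [pairing_eq_pairFun, h.pairFun_conj hn fun γ N => charFun_congr mul_mem_conjClass_comm,
    pairFun_leftSum_conjClass hn, sub_self, zero_add, crossing_sub_incidence hn hM]

/-! ### Scalar classes -/

theorem isScalar_mk {a b c d : ℤ} :
    IsScalar (PMat.mk !![a, b; c, d]) ↔ b = 0 ∧ c = 0 ∧ a = d := by
  have h : ∀ l : ℤ, (Matrix.scalar (Fin 2) l : Matrix (Fin 2) (Fin 2) ℤ) = !![l, 0; 0, l] := by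
    intro l
    ext i j
    rw [Matrix.scalar_apply]
    fin_cases i <;> fin_cases j <;> rfl
  constructor
  · rintro ⟨l, hl⟩
    rw [h, mk_entries_eq_iff] at hl
    omega
  · rintro ⟨rfl, rfl, rfl⟩
    exact ⟨a, by rw [h]⟩

theorem IsScalar.incl_mul {M : PMat} (h : IsScalar M) (γ : Gam) : incl γ * M = M * incl γ := by
  obtain ⟨a, b, c, d, rfl⟩ := exists_mk_entries M
  obtain ⟨rfl, rfl, rfl⟩ := isScalar_mk.mp h
  obtain ⟨p, q, r, s, h, rfl⟩ := exists_gamMk γ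
  rw [incl_gamMk, mk_mul_mk, mk_mul_mk]
  congr 3 <;> ring_nf

theorem IsScalar.of_mem_conjClass {M N : PMat} (h : IsScalar N) (hN : N ∈ conjClass M) :
    M = N := by
  obtain ⟨γ, hγ⟩ := hN
  rw [← mul_incl_mul_inv γ N, ← h.incl_mul, hγ]
  simp only [mul_assoc, incl_mul_inv_mul, incl_mul_inv, mul_one]

theorem classSum_fixTri_of_isScalar {M : PMat} (h : IsScalar M) : classSum M fixTri = -1 / 2 := by
  rw [classSum, finsum_eq_single _ M]
  · rw [charFun, if_pos (self_mem_conjClass M), one_mul]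
    obtain ⟨a, b, c, d, rfl⟩ := exists_mk_entries M
    obtain ⟨rfl, rfl, rfl⟩ := isScalar_mk.mp h
    rw [fixTri_mk]
    simp [fixSign]
  · intro N hN
    rw [charFun, if_neg, zero_mul]
    rintro ⟨γ, hγ⟩
    refine hN ?_
    rw [hγ, mul_assoc, ← h.incl_mul, incl_inv_mul_mul]

/-! ### Classes with real fixed points -/

theorem disc_mk (a b c d : ℤ) :
    (PMat.mk !![a, b; c, d]).disc = (a - d) ^ 2 + 4 * (b * c) := by
  rw [PMat.disc, trSq_mk_entries, det_mk_entries]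
  ring

theorem disc_of_mem_conjClass {n : ℕ} {M N : PMat} (hM : M ∈ matSet n) (hN : N ∈ conjClass M) :
    N.disc = M.disc := by
  have h1 : N.det = n := conjClass_subset hM hN
  have h2 : M.det = n := hM
  rw [PMat.disc, PMat.disc, trSq_of_mem_conjClass hN, h1, h2]

/-- The matrices that fix `∞` as attracting point and have their other fixed point in `(0, 1]`. -/
def cornerSet : Set PMat :=
  {N | ∃ a d b : ℤ, 0 < a ∧ 0 < d ∧ d - a ≤ b ∧ b < 0 ∧ N = upper a d b}

theorem corner_eq_charFun {n : ℕ} (hn : 0 < n) {a b c d : ℤ}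
    (h : PMat.mk !![a, b; c, d] ∈ matSet n) :
    (corner c (-b) (c + d - a - b) (a + d) : ℚ) = charFun cornerSet (PMat.mk !![a, b; c, d]) := by
  rw [mem_matSet_mk] at h
  have hn' : (0 : ℤ) < n := by exact_mod_cast hn
  have key : (c = 0 ∧ 0 < (a + d) * -b ∧ (a + d) * (c + d - a - b) ≤ 0) ↔
      PMat.mk !![a, b; c, d] ∈ cornerSet := by
    constructor
    · rintro ⟨rfl, h1, h2⟩
      have had : 0 < a * d := by linarith
      rcases pos_and_pos_or_neg_and_neg_of_mul_pos had with ⟨ha, hd⟩ | ⟨ha, hd⟩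
      · have h3 := pos_of_mul_pos_right h1 (by omega)
        have h4 : 0 + d - a - b ≤ 0 := by
          by_contra! hc
          linarith [mul_pos (by omega : 0 < a + d) hc]
        exact ⟨a, d, b, ha, hd, by omega, by omega, rfl⟩
      · have h3 : -b < 0 := by
          by_contra! hc
          linarith [mul_nonpos_of_nonpos_of_nonneg (by omega : a + d ≤ 0) hc]
        have h4 : 0 ≤ 0 + d - a - b := by
          by_contra! hc
          linarith [mul_pos_of_neg_of_neg (by omega : a + d < 0) hc]
        refine ⟨-a, -d, -b, by omega, by omega, by omega, by omega, ?_⟩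
        rw [upper, mk_entries_eq_iff]
        right
        simp
    · rintro ⟨a', d', b', h1, h2, h3, h4, h5⟩
      rcases mk_entries_eq_iff.mp h5 with ⟨rfl, rfl, rfl, rfl⟩ | ⟨rfl, rfl, rfl, rfl⟩
      · exact ⟨rfl, mul_pos (by omega) (by omega),
          mul_nonpos_of_nonneg_of_nonpos (by omega) (by omega)⟩
      · exact ⟨rfl, mul_pos_of_neg_of_neg (by omega) (by omega),
          mul_nonpos_of_nonpos_of_nonneg (by omega) (by omega)⟩
  rw [corner, charFun]
  by_cases hc : PMat.mk !![a, b; c, d] ∈ cornerSet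
  · rw [if_pos hc, if_pos (key.mpr hc)]
    norm_num
  · rw [if_neg hc, if_neg fun h => hc (key.mp h)]
    norm_num

theorem rot_mem_matSet {n : ℕ} {N : PMat} (h : N ∈ matSet n) : rot N ∈ matSet n :=
  mul_incl_mem.mpr (incl_mul_mem.mpr h)

theorem fixTri_eq_corner {n : ℕ} (hn : 0 < n) {N : PMat} (hN : N ∈ matSet n)
    (hs : ¬ IsScalar N) (hd : 0 ≤ N.disc) : fixTri N =
      -(charFun cornerSet N + charFun cornerSet (rot N) + charFun cornerSet (rot (rot N))) := by
  obtain ⟨a, b, c, d, rfl⟩ := exists_mk_entries N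
  have hN1 := rot_mem_matSet hN
  have hN2 := rot_mem_matSet hN1
  rw [rot_mk] at hN1
  rw [rot_mk, rot_mk] at hN2
  rw [rot_mk, rot_mk, ← corner_eq_charFun hn hN, ← corner_eq_charFun hn hN1,
    ← corner_eq_charFun hn hN2, fixTri_mk, fixSign_sum]
  · push_cast
    ring_nf
  -- the trace does not vanish, as its square is at least `4 n`
  · rintro ht
    rw [mem_matSet_mk] at hN
    rw [disc_mk] at hd
    have : d = -a := by omega
    subst this
    have hn' : (0 : ℤ) < n := by exact_mod_cast hn
    nlinarith
  · rw [isScalar_mk] at hs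
    omega
  · rw [disc_mk] at hd
    linarith

theorem disc_upper (a d b : ℤ) : (upper a d b).disc = (a - d) ^ 2 := by
  rw [upper, disc_mk]
  ring

/-- A class contains at most one element of `cornerSet`. -/
theorem cornerSet_unique {n : ℕ} {M N N' : PMat} (hM : M ∈ matSet n)
    (hN : N ∈ conjClass M) (hN' : N' ∈ conjClass M) (h : N ∈ cornerSet) (h' : N' ∈ cornerSet) :
    N = N' := by
  obtain ⟨a, d, b, ha, hd, hb, hb0, rfl⟩ := h
  obtain ⟨a', d', b', ha', hd', hb', hb0', rfl⟩ := h'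
  have h1 := trSq_of_mem_conjClass hN
  have h2 := disc_of_mem_conjClass hM hN
  rw [← trSq_of_mem_conjClass hN', upper, upper, trSq_mk_entries, trSq_mk_entries] at h1
  rw [← disc_of_mem_conjClass hM hN', disc_upper, disc_upper] at h2
  have h3 := (pow_left_inj₀ (by omega) (by omega) two_ne_zero).mp h1
  have h4 := (pow_left_inj₀ (by omega) (by omega) two_ne_zero).mp h2
  obtain rfl : a = a' := by omega
  obtain rfl : d = d' := by omega
  obtain ⟨b₀, -, h5⟩ := existsUnique_upper_mem ha hd (by omega) hN (d - a)
  have habs : |d - a| = a - d := by rw [abs_of_neg (by omega)]; ring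
  rw [h5 b ⟨⟨hb, by omega⟩, hN⟩, h5 b' ⟨⟨hb', by omega⟩, hN'⟩]

theorem isSplitHyperbolic_of_cornerSet {n : ℕ} {M N : PMat} (hM : M ∈ matSet n)
    (hN : N ∈ conjClass M) (h : N ∈ cornerSet) : IsSplitHyperbolic M := by
  obtain ⟨a, d, b, ha, hd, hb, hb0, rfl⟩ := h
  rw [IsSplitHyperbolic, ← disc_of_mem_conjClass hM hN, disc_upper]
  have : 0 < a - d := by omega
  exact ⟨by positivity, a - d, sq _⟩

theorem exists_mk_entries_trace_pos {M : PMat} (h : M.trSq ≠ 0) :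
    ∃ a b c d, M = PMat.mk !![a, b; c, d] ∧ 0 < a + d := by
  obtain ⟨a, b, c, d, rfl⟩ := exists_mk_entries M
  rw [trSq_mk_entries] at h
  have h1 : a + d ≠ 0 := by
    intro h2
    simp [h2] at h
  rcases h1.lt_or_gt with h2 | h2
  · refine ⟨-a, -b, -c, -d, ?_, by omega⟩
    rw [mk_entries_eq_iff]
    right
    simp
  · exact ⟨a, b, c, d, rfl, h2⟩

/-- The eigenvalues are rational, and the larger one in absolute value can be put in front. -/
theorem exists_mem_cornerSet {n : ℕ} (hn : 0 < n) {M : PMat} (hM : M ∈ matSet n)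
    (h : IsSplitHyperbolic M) : ∃ N ∈ conjClass M, N ∈ cornerSet := by
  obtain ⟨h0, k, hk⟩ := h
  have hn' : (0 : ℤ) < n := by exact_mod_cast hn
  have hdet : M.det = n := hM
  obtain ⟨a, b, c, d, rfl, ht⟩ := exists_mk_entries_trace_pos (M := M) (by
    rw [PMat.disc, hdet] at h0
    omega)
  rw [mem_matSet_mk] at hM
  rw [disc_mk] at h0 hk
  obtain ⟨k, hk0, hk⟩ : ∃ k, 0 < k ∧ (a - d) ^ 2 + 4 * (b * c) = k * k :=
    ⟨|k|, abs_pos.mpr (by rintro rfl; omega), by rw [hk, abs_mul_abs_self]⟩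
  -- `k` has the parity of the trace
  obtain ⟨l, hl⟩ : ∃ l, a + d + k = 2 * l := by
    have h1 : Even ((a + d) ^ 2 - k * k) := ⟨2 * (n : ℤ), by rw [← hk, ← hM]; ring⟩
    have h2 : Even (a + d) ↔ Even k := by
      rw [Int.even_sub, Int.even_pow' two_ne_zero, Int.even_mul, or_self] at h1
      exact h1
    obtain ⟨l, hl⟩ := Int.even_add.mpr h2
    exact ⟨l, by omega⟩
  obtain rfl : k = 2 * l - (a + d) := by omega
  have hl0 : (l - a) * (l - d) = b * c := by linarith
  obtain ⟨b₀, hb₀⟩ := exists_upper_mem_conjClass hl0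
  have hl1 : 0 < l := by omega
  have hl2 : 0 < a + d - l := by
    have : l * (a + d - l) = n := by linarith
    exact pos_of_mul_pos_right (this ▸ hn') hl1.le
  obtain ⟨b', ⟨⟨h1, h2⟩, h3⟩, -⟩ := existsUnique_upper_mem hl1 hl2 (by omega) hb₀ (a + d - l - l)
  rw [abs_of_neg (by omega)] at h2
  exact ⟨_, h3, l, a + d - l, b', hl1, hl2, h1, by omega, rfl⟩

open Classical in
theorem classSum_cornerSet {n : ℕ} (hn : 0 < n) {M : PMat} (hM : M ∈ matSet n) :
    classSum M (charFun cornerSet) = if IsSplitHyperbolic M then 1 else 0 := by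
  have hval : ∀ N, charFun (conjClass M) N * charFun cornerSet N ≠ 0 →
      N ∈ conjClass M ∧ N ∈ cornerSet := by
    intro N hN
    simp only [charFun] at hN
    by_contra hc
    rcases not_and_or.mp hc with h | h <;> simp [h] at hN
  split_ifs with h
  · obtain ⟨N, hN, hN'⟩ := exists_mem_cornerSet hn hM h
    rw [classSum, finsum_eq_single _ N, charFun, charFun, if_pos hN, if_pos hN', one_mul]
    intro N₁ hne
    by_contra hc
    obtain ⟨h1, h2⟩ := hval N₁ hc
    exact hne (cornerSet_unique hM h1 hN h2 hN')
  · refine finsum_eq_zero_of_forall_eq_zero fun N => ?_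
    by_contra hc
    obtain ⟨h1, h2⟩ := hval N hc
    exact h (isSplitHyperbolic_of_cornerSet hM h1 h2)

open Classical in
theorem classSum_fixTri_of_disc_nonneg {n : ℕ} (hn : 0 < n) {M : PMat} (hM : M ∈ matSet n)
    (hs : ¬ IsScalar M) (hd : 0 ≤ M.disc) :
    classSum M fixTri = if IsSplitHyperbolic M then -3 else 0 := by
  set f : PMat → ℚ := charFun cornerSet with hf
  have hfin : FinOn M f := by
    refine finOn_of_subset (Set.Subsingleton.finite fun N hN N' hN' => ?_)
    have hmem : ∀ N, f N ≠ 0 → N ∈ cornerSet := by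
      intro N hN
      by_contra hc
      exact hN (by rw [hf, charFun, if_neg hc])
    exact cornerSet_unique hM hN.1 hN'.1 (hmem _ hN.2) (hmem _ hN'.2)
  have hfU : FinOn M fun N => f (rot N) := hfin.conj Ug
  have hfUU : FinOn M fun N => f (rot (rot N)) := hfU.conj Ug
  have hsU : classSum M (fun N => f (rot N)) = classSum M f := classSum_conj M Ug f
  have hsUU : classSum M (fun N => f (rot (rot N))) = classSum M f :=
    (classSum_conj M Ug fun N => f (rot N)).trans hsU
  have h1 : classSum M fixTri = -(classSum M f + classSum M f + classSum M f) := by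
    have h2 : classSum M f + classSum M f + classSum M f =
        classSum M fun N => f N + f (rot N) + f (rot (rot N)) := by
      rw [classSum_add (hfin.add hfU) hfUU, classSum_add hfin hfU, hsU, hsUU]
    rw [h2, classSum, classSum, ← finsum_neg_distrib]
    refine (classSum_congr (M := M) fun N hN => fixTri_eq_corner hn (conjClass_subset hM hN)
      (fun h => hs (h.of_mem_conjClass hN ▸ h)) (by rwa [disc_of_mem_conjClass hM hN])).trans ?_
    exact finsum_congr fun N => mul_neg _ _
  rw [h1, classSum_cornerSet hn hM]
  split_ifs <;> norm_num

/-! ### Elliptic classes -/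

theorem exists_mk_entries_of_isElliptic {M : PMat} (h : IsElliptic M) :
    ∃ a b c d, M = PMat.mk !![a, b; c, d] ∧ 0 < c ∧ b < 0 ∧ (a - d) ^ 2 + 4 * (b * c) < 0 := by
  obtain ⟨a, b, c, d, rfl⟩ := exists_mk_entries M
  rw [IsElliptic, disc_mk] at h
  have hbc : b * c < 0 := by nlinarith [sq_nonneg (a - d)]
  rcases mul_neg_iff.mp hbc with ⟨hb, hc⟩ | ⟨hb, hc⟩
  · refine ⟨-a, -b, -c, -d, ?_, by omega, by omega, by linarith⟩
    rw [mk_entries_eq_iff]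
    right
    simp
  · exact ⟨a, b, c, d, rfl, hc, hb, h⟩

theorem fixSide_of_disc_neg {a b c d : ℤ} (hc : 0 < c) (hd : (a - d) ^ 2 + 4 * (b * c) < 0) :
    fixSide (PMat.mk !![a, b; c, d]) = (1 + ((a - d).sign : ℚ)) / 2 := by
  have hbc : 0 < c * -b := by nlinarith [sq_nonneg (a - d)]
  rw [fixSide_mk, fixSign, if_pos hbc, Int.sign_mul, Int.sign_eq_one_of_pos hc, mul_one]
  congr 4
  ring

/-- The form `2 (-b x² + (a - d) x y + c y²)` is attached to the fixed point of `(a b; c d)`. -/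
theorem finite_fixSide_conj_ne {M : PMat} (h : IsElliptic M) :
    {γ : Gam | fixSide (incl γ * M * incl γ⁻¹) ≠ side (incl γ)}.Finite := by
  obtain ⟨a, b, c, d, rfl, hc, hb, hd⟩ := exists_mk_entries_of_isElliptic h
  refine (finite_opposite (x := -2 * b) (y := a - d) (z := 2 * c) (x' := 2) (y' := 1) (z' := 2)
    (by omega) (by omega) (by linarith) (by norm_num) (by norm_num)).subset ?_
  intro γ hγ
  obtain ⟨p, q, r, s, hps, rfl⟩ := exists_gamMk γ
  refine ⟨p, q, r, s, hps, rfl, ?_⟩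
  by_contra hne
  refine hγ ?_
  have hsign := sign_eq_of_not_mul_nonpos hne
  rw [incl_gamMk_inv, incl_gamMk, mk_mul_mk, mk_mul_mk, fixSide_of_disc_neg, side_mk]
  · congr 3
    convert hsign using 2 <;> ring
  · have h1 : 0 < 4 * c * (c * s ^ 2 + (a - d) * (r * s) - b * r ^ 2) := by
      have h2 : 4 * c * (c * s ^ 2 + (a - d) * (r * s) - b * r ^ 2) =
          (2 * c * s + (a - d) * r) ^ 2 + -((a - d) ^ 2 + 4 * (b * c)) * r ^ 2 := by ring
      rw [h2]
      by_cases hr : r = 0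
      · subst hr
        have hs : s ≠ 0 := by rintro rfl; simp at hps
        have : 2 * c * s ≠ 0 := by simp [hc.ne', hs]
        linarith [sq_pos_of_ne_zero this]
      · have := mul_pos (neg_pos.mpr hd) (sq_pos_of_ne_zero hr)
        linarith [sq_nonneg (2 * c * s + (a - d) * r)]
    have h3 := pos_of_mul_pos_right h1 (by omega)
    linarith
  · have h4 : ((p * a + q * c) * s + (p * b + q * d) * -r -
        ((r * a + s * c) * -q + (r * b + s * d) * p)) ^ 2 +
        4 * (((p * a + q * c) * -q + (p * b + q * d) * p) *
          ((r * a + s * c) * s + (r * b + s * d) * -r)) =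
        (p * s - q * r) ^ 2 * ((a - d) ^ 2 + 4 * (b * c)) := by ring
    rw [h4, hps]
    linarith

/-- The elements that conjugate `M` to `N` form a coset of the centralizer of `M`. -/
theorem card_conj_eq {M N : PMat} {γ₀ : Gam} (h : incl γ₀ * M * incl γ₀⁻¹ = N) :
    Nat.card {γ : Gam // incl γ * M * incl γ⁻¹ = N} = Nat.card (centralizer M) := by
  have key : ∀ γ : Gam, incl (γ₀ * γ) * M * incl (γ₀ * γ)⁻¹ = N ↔ γ ∈ centralizer M := by
    intro γ
    have h1 : incl (γ₀ * γ) * M * incl (γ₀ * γ)⁻¹ =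
        incl γ₀ * (incl γ * M * incl γ⁻¹) * incl γ₀⁻¹ := by
      rw [_root_.mul_inv_rev, map_mul, map_mul]
      simp only [mul_assoc]
    rw [h1, ← h]
    change (conjEquiv γ₀) (incl γ * M * incl γ⁻¹) = (conjEquiv γ₀) M ↔ incl γ * M = M * incl γ
    rw [(conjEquiv γ₀).apply_eq_iff_eq]
    constructor
    · intro h2
      nth_rewrite 2 [← h2]
      simp only [mul_assoc, incl_inv_mul, mul_one]
    · intro h2
      rw [h2, mul_incl_mul_inv]
  refine Nat.card_congr ⟨fun γ => ⟨γ₀⁻¹ * γ.1, (key _).mp ?_⟩, fun γ => ⟨γ₀ * γ.1, (key _).mpr γ.2⟩,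
    fun γ => ?_, fun γ => ?_⟩
  · rw [mul_inv_cancel_left]
    exact γ.2
  · simp
  · simp

/-- Sums over a class, as sums over the conjugating elements. -/
theorem card_mul_classSum {M : PMat} {F : PMat → ℚ}
    (hfin : (Function.support fun γ : Gam => F (incl γ * M * incl γ⁻¹)).Finite) :
    ∑ᶠ γ : Gam, F (incl γ * M * incl γ⁻¹) = Nat.card (centralizer M) * classSum M F := by
  classical
  set g : Gam → PMat := fun γ => incl γ * M * incl γ⁻¹ with hg
  have hX : ∀ N, N ∈ conjClass M ↔ ∃ γ, g γ = N := by
    intro N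
    constructor
    · rintro ⟨γ, rfl⟩
      exact ⟨γ⁻¹, by rw [hg]; simp only [inv_inv]⟩
    · rintro ⟨γ, rfl⟩
      exact ⟨γ⁻¹, by rw [hg]; simp only [inv_inv]⟩
  have h1 : classSum M F = ∑ N ∈ hfin.toFinset.image g, F N := by
    rw [classSum, finsum_eq_sum_of_support_subset (s := hfin.toFinset.image g)]
    · refine Finset.sum_congr rfl fun N hN => ?_
      obtain ⟨γ, -, rfl⟩ := Finset.mem_image.mp hN
      rw [charFun, if_pos ((hX _).mpr ⟨γ, rfl⟩), one_mul]
    · intro N hN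
      rw [Function.mem_support, charFun] at hN
      by_cases hNX : N ∈ conjClass M
      · rw [if_pos hNX, one_mul] at hN
        obtain ⟨γ, rfl⟩ := (hX N).mp hNX
        exact Finset.mem_image_of_mem g (by simpa using hN)
      · simp [hNX] at hN
  rw [h1, finsum_eq_sum_of_support_subset (s := hfin.toFinset) _ (by simp),
    Finset.sum_comp F g, Finset.mul_sum]
  refine Finset.sum_congr rfl fun N hN => ?_
  obtain ⟨γ₀, hγ₀, rfl⟩ := Finset.mem_image.mp hN
  have h2 : {γ : Gam | g γ = g γ₀} = ({γ ∈ hfin.toFinset | g γ = g γ₀} : Finset Gam) := by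
    ext γ
    simp only [Set.mem_ofPred_eq, Finset.coe_filter, Set.Finite.mem_toFinset,
      Function.mem_support, iff_and_self]
    intro h
    have h3 : F (g γ₀) ≠ 0 := by simpa using hγ₀
    rwa [← h] at h3
  have h3 := congrArg Set.ncard h2
  rw [Set.ncard_coe_finset] at h3
  rw [nsmul_eq_mul, ← h3, ← card_conj_eq (M := M) (γ₀ := γ₀) rfl]
  rfl

theorem classSum_fixTri_of_isElliptic {M : PMat} (h : IsElliptic M) :
    classSum M fixTri = 3 / Nat.card (centralizer M) := by
  have hS : ∀ γ : Gam, fixSide (incl (Sg * γ) * M * incl (Sg * γ)⁻¹) =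
      1 - fixSide (incl γ * M * incl γ⁻¹) := by
    intro γ
    rw [← fixSide_Sg_conj, _root_.mul_inv_rev, map_mul, map_mul]
    simp only [mul_assoc]
  have hU : ∀ γ : Gam, incl (Ug * γ) * M * incl (Ug * γ)⁻¹ =
      rot (incl γ * M * incl γ⁻¹) := by
    intro γ
    rw [rot, _root_.mul_inv_rev, map_mul, map_mul]
    simp only [mul_assoc]
  have h3 := finsum_triangles hS (finite_fixSide_conj_ne h)
  simp only [hU] at h3
  change ∑ᶠ γ : Gam, fixTri (incl γ * M * incl γ⁻¹) = 3 at h3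
  rw [card_mul_classSum (Set.not_infinite.mp fun hinf => by
    rw [finsum_of_infinite_support hinf] at h3
    norm_num at h3)] at h3
  have hcard : (Nat.card (centralizer M) : ℚ) ≠ 0 := by
    intro h0
    rw [h0, zero_mul] at h3
    norm_num at h3
  rw [eq_div_iff hcard, mul_comm, h3]

theorem neg_classSum_fixTri_div_three {n : ℕ} (hn : 0 < n) {M : PMat} (hM : M ∈ matSet n) :
    -classSum M fixTri / 3 = weight M := by
  classical
  rw [weight]
  by_cases h1 : IsScalar M
  · rw [if_pos h1, classSum_fixTri_of_isScalar h1]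
    norm_num
  rw [if_neg h1]
  by_cases h2 : IsElliptic M
  · rw [if_pos h2, classSum_fixTri_of_isElliptic h2]
    ring
  rw [if_neg h2, classSum_fixTri_of_disc_nonneg hn hM h1 (not_lt.mp h2)]
  split_ifs <;> norm_num

end HeckeTrace

theorem theorem1 (n : ℕ) (hn : 0 < n) (R : Finset HeckeTrace.PMat)
    (hR : HeckeTrace.IsReprSet n R) (ξ : HeckeTrace.Alg) (hξ : ξ ∈ HeckeTrace.Rn n)
    (hA : HeckeTrace.CondA n R ξ) (hB : HeckeTrace.CondB n ξ) :
    (∀ M ∈ HeckeTrace.matSet n, HeckeTrace.pairing ξ (HeckeTrace.rightCoset M) = -1) ∧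
      ∀ M ∈ HeckeTrace.matSet n,
        HeckeTrace.pairing ξ (HeckeTrace.conjClass M) = HeckeTrace.weight M := by
  have h := HeckeTrace.isSolution_of_cond hn hR hξ hA hB
  refine ⟨fun M hM => h.pairing_rightCoset hn hM, fun M hM => ?_⟩
  rw [h.pairing_conjClass hn hM, HeckeTrace.neg_classSum_fixTri_div_three hn hM]
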